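/- Let $R$ be a commutative ring, $q\in R$ invertible, $n\ge 0$, and let $\mathcal H=\mathcal H_{R,q}(\mathfrak S_n)$ be the unital associative $R$-algebra with generators $T_1,\dots,T_{n-1}$ and relations $T_iT_j=T_jT_i$ ($|i-j|>1$), $T_iT_{i+1}T_i=T_{i+1}T_iT_{i+1}$, $(T_i+1)(T_i-q)=0$. Let $\mathfrak S_n$ act from the right on $\{1,\dots,n\}$, and put $T_w=T_{i_1}\cdots T_{i_k}$ for any reduced expression $w=(i_1,i_1+1)\cdots(i_k,i_k+1)$. Let $*$ be the anti-automorphism of $\mathcal H$ with $T_i^*=T_i$. A composition $\mu$ of $n$ is a finite sequence $(\mu_1,\dots,\mu_l)$ of non-negative integers with sum $n$; it is a partition if it is weakly decreasing. Write $\mu\rhd\lambda$ for strict dominance (missing parts count as $0$). Let $\mathfrak t^\mu$ be the $\mu$-tableau with $1,\dots,n$ entered in order along the rows, $\mathfrak S_\mu$ its row stabilizer, $m_\mu=\sum_{w\in\mathfrak S_\mu}T_w$ and $M^\mu=m_\mu\mathcal H$. For a $\mu$-tableau $\mathfrak t$ containing each of $1,\dots,n$ once, let $d(\mathfrak t)$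 be the permutation with $\mathfrak t=\mathfrak t^\mu d(\mathfrak t)$; $\mathfrak t$ is row-standard if its entries increase along rows, and standard if they also increase down columns. Put $m_{\mathfrak s\mathfrak t}=T_{d(\mathfrak s)}^*m_\mu T_{d(\mathfrak t)}$. For a partition $\lambda$ of $n$ let $\mathcal H^{\rhd\lambda}$ be the two-sided ideal of $\mathcal H$ generated by all $m_{\mathfrak s\mathfrak t}$ with $\mathfrak s,\mathfrak t$ standard $\mu$-tableaux for some partition $\mu\rhd\lambda$ of $n$ (these elements in fact span it over $R$), and let $S^\lambda=(\mathcal H^{\rhd\lambda}+m_\lambda)\mathcal H\subseteq\mathcal H/\mathcal H^{\rhd\lambda}$ be the Specht module. Let $\lambda=(\lambda_1,\dots,\lambda_a)$ be a partition of $n$ and $\nu=(\nu_1,\dots,\nu_b)$ a composition of $n$. Let $\mathcal T_{\mathrm r}(\lambda,\nu)$ be the set of $\lambda$-tableaux in which each $i$ occurs $\nu_i$ times ($1\le i\le b$) and entries weakly increase along rows. For $S\in\mathcal T_{\mathrm r}(\lambda,\nu)$ there is a unique homomorphism of right $\mathcal H$-modules $\Theta_S:M^\nu\to S^\lambda$ with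 $$\Theta_S(m_\nu)=\mathcal H^{\rhd\lambda}+\sum_{\mathfrak s}m_\lambda T_{d(\mathfrak s)},$$ where $\mathfrak s$ runs over the row-standard $\lambda$-tableaux that become $S$ when each letter is replaced by the index of its row in $\mathfrak t^\nu$. Let $S^i_r$, $S^{<i}_r$, $S^{>i}_r$ be the number of entries of row $r$ of $S$ that are equal to, less than, greater than $i$. Let $\left[{m\atop k}\right]=\frac{[m]!}{[k]!\,[m-k]!}$ be the Gaussian binomial coefficient (a polynomial in $q$), where $[m]=1+q+\dots+q^{m-1}$ and $[m]!=[1][2]\cdots[m]$. **Theorem.** Let $S\in\mathcal T_{\mathrm r}(\lambda,\nu)$, $1\le r\le a-1$ and $1\le d\le b$. (1) Let $\mathcal G$ be the set of sequences $g=(g_1,\dots,g_b)$ of non-negative integers with $g_d=0$, $\sum_i g_i=S^d_{r+1}$ and $g_i\le S^i_r$ for all $i$. For $g\in\mathcal G$ let $U_g$ be the row-standard tableau obtained from $S$ by moving all entries $d$ from row $r+1$ to row $r$ and, for $i\ne d$, moving $g_i$ entries $i$ from row $r$ to row $r+1$. Then $$\Theta_S=(-1)^{S^d_{r+1}}q^{-\binom{S^d_{r+1}+1}{2}}q^{-S^d_{r+1}S^{<d}_{r+1}}\sum_{g\in\mathcal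 G}q^{g_1+\dots+g_{d-1}}\prod_{i=1}^b q^{g_iS^{<i}_{r+1}}\left[{S^i_{r+1}+g_i\atop g_i}\right]\Theta_{U_g}.$$ (2) Suppose $\lambda_r=\lambda_{r+1}$. Let $\mathcal G$ be the set of sequences $g=(g_1,\dots,g_b)$ of non-negative integers with $g_d=0$, $\sum_i g_i=S^d_r$ and $g_i\le S^i_{r+1}$ for all $i$. For $g\in\mathcal G$ let $U_g$ be the row-standard tableau obtained from $S$ by moving all entries $d$ from row $r$ to row $r+1$ and, for $i\ne d$, moving $g_i$ entries $i$ from row $r+1$ to row $r$. Then $$\Theta_S=(-1)^{S^d_r}q^{-\binom{S^d_r}{2}}q^{-S^d_rS^{>d}_r}\sum_{g\in\mathcal G}q^{-(g_1+\dots+g_{d-1})}\prod_{i=1}^b q^{g_iS^{>i}_r}\left[{S^i_r+g_i\atop g_i}\right]\Theta_{U_g}.$$ -/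

import Mathlib

/-! ### Hecke algebras of type `A` -/

/-- Defining relations of the Hecke algebra of `𝔖_n`. The generator with index `i : Fin (n - 1)`
corresponds to the transposition of the `i`-th and `(i + 1)`-st letters (counted from `0`). -/
inductive HeckeRel (R : Type*) [CommRing R] (q : Rˣ) (n : ℕ) :
    FreeAlgebra R (Fin (n - 1)) → FreeAlgebra R (Fin (n - 1)) → Prop
  | comm (i j : Fin (n - 1)) (h : (i : ℕ) + 1 < j) :
      HeckeRel R q n (FreeAlgebra.ι R i * FreeAlgebra.ι R j)
        (FreeAlgebra.ι R j * FreeAlgebra.ι R i)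
  | braid (i j : Fin (n - 1)) (h : (i : ℕ) + 1 = j) :
      HeckeRel R q n (FreeAlgebra.ι R i * FreeAlgebra.ι R j * FreeAlgebra.ι R i)
        (FreeAlgebra.ι R j * FreeAlgebra.ι R i * FreeAlgebra.ι R j)
  | quad (i : Fin (n - 1)) :
      HeckeRel R q n
        ((FreeAlgebra.ι R i + 1) * (FreeAlgebra.ι R i - algebraMap R _ (q : R))) 0

/-- The Hecke algebra `H_{R,q}(𝔖_n)`. -/
def HeckeAlgebra (R : Type*) [CommRing R] (q : Rˣ) (n : ℕ) : Type _ :=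
  RingQuot (HeckeRel R q n)

noncomputable section

namespace HeckeAlgebra

variable {R : Type*} [CommRing R] (q : Rˣ) (n : ℕ)

instance : Ring (HeckeAlgebra R q n) := inferInstanceAs (Ring (RingQuot (HeckeRel R q n)))

instance : Algebra R (HeckeAlgebra R q n) :=
  inferInstanceAs (Algebra R (RingQuot (HeckeRel R q n)))

variable {n}

/-- The generator `T_i`. -/
def gen (i : Fin (n - 1)) : HeckeAlgebra R q n :=
  RingQuot.mkAlgHom R (HeckeRel R q n) (FreeAlgebra.ι R i)

theorem gen_comm (i j : Fin (n - 1)) (h : (i : ℕ) + 1 < j) :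
    gen q i * gen q j = gen q j * gen q i := by
  have := RingQuot.mkAlgHom_rel R (HeckeRel.comm (q := q) i j h)
  simp only [map_mul] at this
  exact this

theorem gen_braid (i j : Fin (n - 1)) (h : (i : ℕ) + 1 = j) :
    gen q i * gen q j * gen q i = gen q j * gen q i * gen q j := by
  have := RingQuot.mkAlgHom_rel R (HeckeRel.braid (q := q) i j h)
  simp only [map_mul] at this
  exact this

theorem gen_quad (i : Fin (n - 1)) :
    (gen q i + 1) * (gen q i - algebraMap R (HeckeAlgebra R q n) (q : R)) = 0 := by
  have := RingQuot.mkAlgHom_rel R (HeckeRel.quad (q := q) i)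
  simp only [map_mul, map_add, map_sub, map_one, map_zero, AlgHom.commutes] at this
  exact this

/-- The anti-automorphism `*` of the Hecke algebra with `T_i^* = T_i`, as an algebra homomorphism
to the opposite algebra. -/
def starHom : HeckeAlgebra R q n →ₐ[R] (HeckeAlgebra R q n)ᵐᵒᵖ :=
  RingQuot.liftAlgHom R ⟨FreeAlgebra.lift R (fun i => MulOpposite.op (gen q i)), by
    intro x y h
    cases h with
    | comm i j h =>
      simp only [map_mul, FreeAlgebra.lift_ι_apply, ← MulOpposite.op_mul]
      rw [gen_comm q i j h]
    | braid i j h =>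
      simp only [map_mul, FreeAlgebra.lift_ι_apply, ← MulOpposite.op_mul]
      rw [← mul_assoc, gen_braid q i j h, mul_assoc]
    | quad i =>
      simp only [map_mul, map_add, map_sub, map_one, map_zero, FreeAlgebra.lift_ι_apply,
        AlgHom.commutes]
      apply MulOpposite.unop_injective
      have h := gen_quad q i
      have hc := Algebra.commutes (q : R) (gen q i)
      simp only [MulOpposite.unop_mul, MulOpposite.unop_add, MulOpposite.unop_sub,
        MulOpposite.unop_one, MulOpposite.unop_zero, MulOpposite.unop_op,
        MulOpposite.algebraMap_apply]
      rw [← h]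
      simp only [add_mul, mul_add, sub_mul, mul_sub, mul_one, one_mul, hc]
      abel⟩

/-- `h^*`. -/
def heckeStar (h : HeckeAlgebra R q n) : HeckeAlgebra R q n := MulOpposite.unop (starHom q h)

/-- The transposition `(i, i + 1)`. -/
def simpleTransposition (i : Fin (n - 1)) : Equiv.Perm (Fin n) :=
  Equiv.swap ⟨i, by omega⟩ ⟨i + 1, by omega⟩

/-- The permutation `(i₁, i₁ + 1) ⋯ (i_k, i_k + 1)`, where permutations act from the right: the
leftmost factor is applied first. Since the product of `Equiv.Perm` applies the rightmost factor
first, the word is reversed. -/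
def wordPerm (l : List (Fin (n - 1))) : Equiv.Perm (Fin n) :=
  (l.reverse.map simpleTransposition).prod

/-- The word `l` is a reduced expression of `w`. -/
def IsReducedExpr (l : List (Fin (n - 1))) (w : Equiv.Perm (Fin n)) : Prop :=
  wordPerm l = w ∧ ∀ l' : List (Fin (n - 1)), wordPerm l' = w → l.length ≤ l'.length

theorem exists_wordPerm (w : Equiv.Perm (Fin n)) : ∃ l, wordPerm l = w := by
  cases n with
  | zero => exact ⟨[], Subsingleton.elim _ _⟩
  | succ m =>
    have hw : w ∈ Submonoid.closure
        (Set.range fun i : Fin m => Equiv.swap i.castSucc i.succ) := by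
      rw [Equiv.Perm.mclosure_swap_castSucc_succ]; trivial
    induction hw using Submonoid.closure_induction with
    | mem x hx =>
      obtain ⟨i, rfl⟩ := hx
      refine ⟨[i], ?_⟩
      simp only [wordPerm, List.reverse_singleton, List.map_cons, List.map_nil, List.prod_cons,
        List.prod_nil, mul_one]
      rfl
    | one => exact ⟨[], rfl⟩
    | mul x y _ _ hx hy =>
      obtain ⟨l, rfl⟩ := hx
      obtain ⟨l', rfl⟩ := hy
      exact ⟨l' ++ l, by simp [wordPerm]⟩

theorem exists_isReducedExpr (w : Equiv.Perm (Fin n)) : ∃ l, IsReducedExpr l w := by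
  classical
  have hex : ∃ k, ∃ l : List (Fin (n - 1)), wordPerm l = w ∧ l.length = k := by
    obtain ⟨l, hl⟩ := exists_wordPerm w
    exact ⟨_, l, hl, rfl⟩
  obtain ⟨l, hl, hk⟩ := Nat.find_spec hex
  exact ⟨l, hl, fun l' hl' => hk ▸ Nat.find_min' hex ⟨l', hl', rfl⟩⟩

/-- `T_w = T_{i₁} ⋯ T_{i_k}` for a reduced expression `w = (i₁, i₁ + 1) ⋯ (i_k, i_k + 1)`. -/
def T (w : Equiv.Perm (Fin n)) : HeckeAlgebra R q n :=
  ((exists_isReducedExpr w).choose.map (gen q)).prod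

end HeckeAlgebra

/-! ### Compositions and tableaux -/

/-- A composition of `n` with `l` parts: a sequence of `l` non-negative integers with sum `n`. -/
structure WeakComposition (n l : ℕ) where
  part : Fin l → ℕ
  sum_part : ∑ i, part i = n

namespace WeakComposition

variable {n l : ℕ} (μ : WeakComposition n l)

/-- A partition is a weakly decreasing composition. -/
def IsPartition : Prop := Antitone μ.part

/-- The sum of the first `j` parts, where missing parts count as zero. -/
def partialSum (j : ℕ) : ℕ := ∑ i ∈ (Finset.univ : Finset (Fin l)).filter (fun i : Fin l => i.val < j), μ.part i

/-- The dominance order `μ ⊵ ν`. -/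
def Dominates {l' : ℕ} (ν : WeakComposition n l') : Prop :=
  ∀ j, ν.partialSum j ≤ μ.partialSum j

/-- The strict dominance order `μ ▷ ν`; two compositions that differ only in trailing zeros
are not strictly comparable. -/
def StrictlyDominates {l' : ℕ} (ν : WeakComposition n l') : Prop :=
  μ.Dominates ν ∧ ¬ ν.Dominates μ

/-- The nodes `(r, c)` of the Young diagram. -/
abbrev Node : Type := (r : Fin l) × Fin (μ.part r)

/-- A `μ`-tableau in which each of the `n` letters appears exactly once. -/
abbrev BijTableau : Type := μ.Node ≃ Fin n

/-- The tableau `𝔱^μ`, with the letters entered in order along the rows. -/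
def initialTableau : μ.BijTableau := finSigmaFinEquiv.trans (finCongr μ.sum_part)

/-- The row of `𝔱^μ` in which a letter lies. -/
def rowIndex (k : Fin n) : Fin l := (μ.initialTableau.symm k).1

/-- The row stabilizer `𝔖_μ` of `𝔱^μ`. -/
def youngSubgroup : Finset (Equiv.Perm (Fin n)) :=
  {w | ∀ k, μ.rowIndex (w k) = μ.rowIndex k}

variable {μ}

/-- The permutation `d(𝔱)` with `𝔱 = 𝔱^μ d(𝔱)`. -/
def BijTableau.d (t : μ.BijTableau) : Equiv.Perm (Fin n) := μ.initialTableau.symm.trans t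

/-- Entries increase along the rows. -/
def BijTableau.IsRowStandard (t : μ.BijTableau) : Prop :=
  ∀ r, StrictMono fun c : Fin (μ.part r) => t ⟨r, c⟩

/-- Entries increase along the rows and down the columns. -/
def BijTableau.IsStandard (t : μ.BijTableau) : Prop :=
  t.IsRowStandard ∧ ∀ x y : μ.Node, x.1 < y.1 → (x.2 : ℕ) = y.2 → t x < t y

end WeakComposition

open WeakComposition

/-- A row-standard `μ`-tableau of type `ν`. -/
structure RowTableau {n a b : ℕ} (μ : WeakComposition n a) (ν : WeakComposition n b) where
  entry : μ.Node → Fin b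
  type_eq : ∀ i, Fintype.card {x // entry x = i} = ν.part i
  rowMono : ∀ r, Monotone fun c : Fin (μ.part r) => entry ⟨r, c⟩

namespace RowTableau

variable {n a b : ℕ} {μ : WeakComposition n a} {ν : WeakComposition n b} (S : RowTableau μ ν)

/-- `S^i_r`: the number of entries `i` in row `r`. -/
def count (i : Fin b) (r : Fin a) : ℕ := Fintype.card {c : Fin (μ.part r) // S.entry ⟨r, c⟩ = i}

/-- `S^{<i}_r`: the number of entries less than `i` in row `r`. -/
def countLT (i : Fin b) (r : Fin a) : ℕ := ∑ j ∈ Finset.Iio i, S.count j r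

/-- `S^{>i}_r`: the number of entries greater than `i` in row `r`. -/
def countGT (i : Fin b) (r : Fin a) : ℕ := ∑ j ∈ Finset.Ioi i, S.count j r

theorem sum_count_row (r : Fin a) : ∑ i, S.count i r = μ.part r := by
  have h := Fintype.card_congr (Equiv.sigmaFiberEquiv fun c : Fin (μ.part r) => S.entry ⟨r, c⟩)
  simpa [count, Fintype.card_sigma] using h

theorem card_entry_eq_sum (f : μ.Node → Fin b) (i : Fin b) :
    Fintype.card {x // f x = i} =
      ∑ r, Fintype.card {c : Fin (μ.part r) // f ⟨r, c⟩ = i} := by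
  rw [← Fintype.card_sigma]
  refine Fintype.card_congr ⟨fun x => ⟨x.1.1, x.1.2, x.2⟩, fun y => ⟨⟨y.1, y.2.1⟩, y.2.2⟩,
    fun _ => rfl, fun _ => rfl⟩

theorem sum_count_col (i : Fin b) : ∑ r, S.count i r = ν.part i := by
  rw [← S.type_eq i, card_entry_eq_sum]; rfl

theorem fst_finSigmaFinEquiv_symm_mono {m : ℕ} (k : Fin m → ℕ) :
    Monotone fun c : Fin (∑ i, k i) => (finSigmaFinEquiv.symm c).1 := by
  intro c c' h
  by_contra hlt
  obtain ⟨x, rfl⟩ := finSigmaFinEquiv.surjective c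
  obtain ⟨y, rfl⟩ := finSigmaFinEquiv.surjective c'
  simp only [Equiv.symm_apply_apply, not_le] at hlt
  have h' : (finSigmaFinEquiv x : ℕ) ≤ finSigmaFinEquiv y := h
  rw [finSigmaFinEquiv_apply, finSigmaFinEquiv_apply] at h'
  have e : ∀ z : (i : Fin m) × Fin (k i),
      ∑ i : Fin z.1, k (Fin.castLE z.1.2.le i) = ∑ i ∈ Finset.Iio z.1, k i := by
    intro z
    refine Finset.sum_bij (fun i _ => Fin.castLE z.1.2.le i) ?_ ?_ ?_ ?_
    · intro i _
      rw [Finset.mem_Iio, Fin.lt_def]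
      exact i.2
    · intro i _ j _ hij
      exact Fin.castLE_injective _ hij
    · intro j hj
      exact ⟨⟨j, Fin.lt_def.1 (Finset.mem_Iio.1 hj)⟩, Finset.mem_univ _, rfl⟩
    · intro i _; rfl
  rw [e, e] at h'
  have hsub : insert y.1 (Finset.Iio y.1) ⊆ Finset.Iio x.1 := by
    intro j hj
    simp only [Finset.mem_insert, Finset.mem_Iio] at hj ⊢
    rcases hj with rfl | hj
    · exact hlt
    · exact hj.trans hlt
  have hs := Finset.sum_le_sum_of_subset (f := k) hsub
  rw [Finset.sum_insert (by simp)] at hs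
  have := y.2.2
  omega

theorem card_row (m : Fin a → Fin b → ℕ) (hrow : ∀ r, ∑ i, m r i = μ.part r)
    (i : Fin b) (r : Fin a) :
    Fintype.card {c : Fin (μ.part r) //
      (finSigmaFinEquiv.symm (finCongr (hrow r).symm c)).1 = i} = m r i := by
  refine (Fintype.card_congr ((Equiv.subtypeEquiv
    ((finCongr (hrow r).symm).trans finSigmaFinEquiv.symm) (fun c => Iff.rfl)).trans
    (Equiv.sigmaSubtype (α := Fin b) (β := fun j => Fin (m r j)) i))).trans ?_
  exact Fintype.card_fin _

/-- The row-standard tableau with `m r i` entries `i` in row `r`. -/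
def ofCounts (m : Fin a → Fin b → ℕ) (hrow : ∀ r, ∑ i, m r i = μ.part r)
    (hcol : ∀ i, ∑ r, m r i = ν.part i) : RowTableau μ ν where
  entry x := (finSigmaFinEquiv.symm (finCongr (hrow x.1).symm x.2)).1
  type_eq i := by
    rw [card_entry_eq_sum, ← hcol i]
    exact Finset.sum_congr rfl fun r _ => card_row m hrow i r
  rowMono r := by
    intro c c' h
    exact fst_finSigmaFinEquiv_symm_mono (m r) (by simpa using h)

theorem count_ofCounts (m : Fin a → Fin b → ℕ) (hrow : ∀ r, ∑ i, m r i = μ.part r)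
    (hcol : ∀ i, ∑ r, m r i = ν.part i) (i : Fin b) (r : Fin a) :
    (ofCounts m hrow hcol).count i r = m r i :=
  card_row m hrow i r

/-- The set `𝒢` of sequences `g` with `g_d = 0`, `∑ g_i = S^d_{r₂}` and `g_i ≤ S^i_{r₁}`. -/
def moves (d : Fin b) (r₁ r₂ : Fin a) : Finset (Fin b → ℕ) :=
  (Fintype.piFinset fun i => Finset.range (S.count i r₁ + 1)).filter
    fun g => g d = 0 ∧ ∑ i, g i = S.count d r₂

theorem mem_moves {d : Fin b} {r₁ r₂ : Fin a} {g : Fin b → ℕ} :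
    g ∈ S.moves d r₁ r₂ ↔
      g d = 0 ∧ ∑ i, g i = S.count d r₂ ∧ ∀ i, g i ≤ S.count i r₁ := by
  simp only [moves, Finset.mem_filter, Fintype.mem_piFinset, Finset.mem_range, Nat.lt_succ_iff]
  tauto

/-- The entry counts after all entries `d` of row `r₂` have been moved to row `r₁` and, for
`i ≠ d`, `g_i` entries `i` of row `r₁` have been moved to row `r₂`. -/
def movedCount (d : Fin b) (r₁ r₂ : Fin a) (g : Fin b → ℕ) (r : Fin a) (i : Fin b) : ℕ :=
  if r = r₁ then (if i = d then S.count d r₁ + S.count d r₂ else S.count i r₁ - g i)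
  else if r = r₂ then (if i = d then 0 else S.count i r₂ + g i)
  else S.count i r

theorem movedCount_row {d : Fin b} {r₁ r₂ : Fin a} (g : S.moves d r₁ r₂) (r : Fin a) :
    ∑ i, S.movedCount d r₁ r₂ g r i = μ.part r := by
  obtain ⟨g, hg⟩ := g
  obtain ⟨h0, hs, hle⟩ := S.mem_moves.1 hg
  rw [← S.sum_count_row r]
  by_cases h1 : r = r₁
  · subst h1
    have key : ∑ i, (S.movedCount d r r₂ g r i + g i) =
        ∑ i, (S.count i r + if i = d then S.count d r₂ else 0) := by
      refine Finset.sum_congr rfl fun i _ => ?_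
      have := hle i
      by_cases hi : i = d
      · subst hi; simp [movedCount, h0]
      · simp only [movedCount, hi, if_true, if_false]; omega
    simp only [Finset.sum_add_distrib, Finset.sum_ite_eq', Finset.mem_univ, if_true, hs] at key
    simpa using key
  · by_cases h2 : r = r₂
    · subst h2
      have key : ∑ i, (S.movedCount d r₁ r g r i + if i = d then S.count d r else 0) =
          ∑ i, (S.count i r + g i) := by
        refine Finset.sum_congr rfl fun i _ => ?_
        by_cases hi : i = d
        · subst hi; simp [movedCount, h0, h1]
        · simp [movedCount, hi, h1]
      simp only [Finset.sum_add_distrib, Finset.sum_ite_eq', Finset.mem_univ, if_true, hs] at key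
      simpa using key
    · simp [movedCount, h1, h2]

theorem movedCount_col {d : Fin b} {r₁ r₂ : Fin a} (hr : r₁ ≠ r₂) (g : S.moves d r₁ r₂)
    (i : Fin b) : ∑ r, S.movedCount d r₁ r₂ g r i = ν.part i := by
  obtain ⟨g, hg⟩ := g
  obtain ⟨h0, hs, hle⟩ := S.mem_moves.1 hg
  rw [← S.sum_count_col i, ← Finset.add_sum_erase _ _ (Finset.mem_univ r₁),
    ← Finset.add_sum_erase _ _ (Finset.mem_univ r₁),
    ← Finset.add_sum_erase (Finset.univ.erase r₁) _ (a := r₂) (by simp [hr.symm]),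
    ← Finset.add_sum_erase (Finset.univ.erase r₁) _ (a := r₂) (by simp [hr.symm]),
    ← add_assoc, ← add_assoc]
  congr 1
  · have := hle i
    by_cases hi : i = d
    · subst hi; simp [movedCount, hr.symm]
    · simp only [movedCount, hi, hr.symm, if_true, if_false]; omega
  · refine Finset.sum_congr rfl fun r hr' => ?_
    simp only [Finset.mem_erase, Finset.mem_univ, and_true] at hr'
    simp [movedCount, hr'.1, hr'.2]

/-- The row-standard tableau `U_g` obtained from `S` by moving all entries `d` from row `r₂` to
row `r₁` and, for `i ≠ d`, moving `g_i` entries `i` from row `r₁` to row `r₂`. -/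
def move {d : Fin b} {r₁ r₂ : Fin a} (hr : r₁ ≠ r₂) (g : S.moves d r₁ r₂) : RowTableau μ ν :=
  ofCounts (S.movedCount d r₁ r₂ g) (S.movedCount_row g) (S.movedCount_col hr g)

theorem ne_of_adjacent {r r' : Fin a} (h : (r' : ℕ) = r + 1) : r ≠ r' := by
  rintro rfl
  omega

end RowTableau

/-! ### Gaussian binomial coefficients -/

/-- `[m] = 1 + x + ⋯ + x^(m-1)`. -/
def qNumber {R : Type*} [CommRing R] (x : R) (m : ℕ) : R := ∑ i ∈ Finset.range m, x ^ i

/-- `[m]! = [1] [2] ⋯ [m]`. -/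
def qFactorial {R : Type*} [CommRing R] (x : R) : ℕ → R
  | 0 => 1
  | m + 1 => qNumber x (m + 1) * qFactorial x m

/-- The Gaussian binomial coefficient `[m]! / ([k]! [m-k]!)`, a polynomial in `x`, computed by the
Pascal rule so that it makes sense in every commutative ring; see `qBinomial_mul_qFactorial`. -/
def qBinomial {R : Type*} [CommRing R] (x : R) : ℕ → ℕ → R
  | _, 0 => 1
  | 0, _ + 1 => 0
  | m + 1, k + 1 => qBinomial x m k + x ^ (k + 1) * qBinomial x m (k + 1)

theorem qNumber_add {R : Type*} [CommRing R] (x : R) (k m : ℕ) :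
    qNumber x (k + m) = qNumber x k + x ^ k * qNumber x m := by
  simp [qNumber, Finset.sum_range_add, pow_add, Finset.mul_sum]

theorem qBinomial_eq_zero {R : Type*} [CommRing R] (x : R) :
    ∀ m k : ℕ, m < k → qBinomial x m k = 0
  | _, 0, h => absurd h (Nat.not_lt_zero _)
  | 0, _ + 1, _ => by simp [qBinomial]
  | m + 1, k + 1, h => by
    rw [qBinomial, qBinomial_eq_zero x m k (by omega), qBinomial_eq_zero x m (k + 1) (by omega)]
    ring

theorem qBinomial_self {R : Type*} [CommRing R] (x : R) : ∀ m : ℕ, qBinomial x m m = 1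
  | 0 => by simp [qBinomial]
  | m + 1 => by
    rw [qBinomial, qBinomial_self x m, qBinomial_eq_zero x m (m + 1) (by omega)]
    ring

theorem qBinomial_mul_qFactorial {R : Type*} [CommRing R] (x : R) :
    ∀ k m : ℕ, qBinomial x (k + m) k * (qFactorial x k * qFactorial x m) = qFactorial x (k + m)
  | 0, m => by simp [qBinomial, qFactorial]
  | k + 1, 0 => by simp [qBinomial_self, qFactorial]
  | k + 1, m + 1 => by
    have h1 := qBinomial_mul_qFactorial x k (m + 1)
    have h2 := qBinomial_mul_qFactorial x (k + 1) m
    have e1 : k + 1 + (m + 1) = (k + (m + 1)) + 1 := by ring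
    have e2 : k + 1 + m = k + (m + 1) := by ring
    rw [e2] at h2
    have e3 : qNumber x (k + (m + 1) + 1) =
        qNumber x (k + 1) + x ^ (k + 1) * qNumber x (m + 1) := by
      rw [← qNumber_add]; congr 1; ring
    have hk : qFactorial x (k + 1) = qNumber x (k + 1) * qFactorial x k := rfl
    have hm : qFactorial x (m + 1) = qNumber x (m + 1) * qFactorial x m := rfl
    have hkm : qFactorial x (k + (m + 1) + 1) =
        qNumber x (k + (m + 1) + 1) * qFactorial x (k + (m + 1)) := rfl
    rw [hm] at h1
    rw [hk] at h2
    rw [e1, qBinomial, hkm, e3, hk, hm]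
    linear_combination qNumber x (k + 1) * h1 + x ^ (k + 1) * qNumber x (m + 1) * h2

/-! ### Permutation modules, Specht modules and the maps `Θ_S` -/

namespace HeckeAlgebra

variable {R : Type*} [CommRing R] (q : Rˣ) {n a b : ℕ}

/-- `m_μ`, the sum of `T_w` over `w ∈ 𝔖_μ`. -/
def mElt (μ : WeakComposition n a) : HeckeAlgebra R q n := ∑ w ∈ μ.youngSubgroup, T q w

/-- The right module `M^μ = m_μ H`. Right `H`-modules are modules over the opposite ring. -/
def permModule (μ : WeakComposition n a) :
    Submodule (HeckeAlgebra R q n)ᵐᵒᵖ (HeckeAlgebra R q n) :=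
  Submodule.span _ {mElt q μ}

/-- `m_μ` as an element of `M^μ`. -/
def permGen (μ : WeakComposition n a) : permModule q μ :=
  ⟨mElt q μ, Submodule.mem_span_singleton_self _⟩

/-- `m_{𝔰𝔱} = T_{d(𝔰)}^* m_μ T_{d(𝔱)}`. -/
def murphy {μ : WeakComposition n a} (s t : μ.BijTableau) : HeckeAlgebra R q n :=
  heckeStar q (T q s.d) * mElt q μ * T q t.d

/-- The two-sided ideal generated by the elements `m_{𝔰𝔱}` with `𝔰, 𝔱` standard tableaux of some
partition shape `μ ▷ lam`, as a right module: it is generated as such by all `h * m_{𝔰𝔱}`. -/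
def higherIdeal (lam : WeakComposition n a) :
    Submodule (HeckeAlgebra R q n)ᵐᵒᵖ (HeckeAlgebra R q n) :=
  Submodule.span _ {x | ∃ (l : ℕ) (μ : WeakComposition n l) (s t : μ.BijTableau)
    (h : HeckeAlgebra R q n), μ.IsPartition ∧ μ.StrictlyDominates lam ∧
      s.IsStandard ∧ t.IsStandard ∧ x = h * murphy q s t}

/-- The Specht module `S^lam`: the right submodule of `H / higherIdeal` generated by the class of
`m_lam`. -/
def spechtModule (lam : WeakComposition n a) :
    Submodule (HeckeAlgebra R q n)ᵐᵒᵖ (HeckeAlgebra R q n ⧸ higherIdeal q lam) :=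
  Submodule.span _ {(higherIdeal q lam).mkQ (mElt q lam)}

/-- The projection `π_lam : M^lam → S^lam`. -/
def spechtProj (lam : WeakComposition n a) :
    permModule q lam →ₗ[(HeckeAlgebra R q n)ᵐᵒᵖ] spechtModule q lam :=
  (higherIdeal q lam).mkQ.restrict (by
    intro x hx
    have h := Submodule.mem_map_of_mem (f := (higherIdeal q lam).mkQ) hx
    rwa [permModule, Submodule.map_span, Set.image_singleton] at h)

open Classical in
/-- The element `∑ m_lam T_{d(𝔰)}` of `M^lam`, where `𝔰` runs through the row-standard
`lam`-tableaux that become `S` on replacing each letter by its row index in `𝔱^ν`. -/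
def thetaElt {lam : WeakComposition n a} {ν : WeakComposition n b} (S : RowTableau lam ν) :
    permModule q lam :=
  ∑ s : lam.BijTableau with s.IsRowStandard ∧ ∀ x, ν.rowIndex (s x) = S.entry x,
    MulOpposite.op (T q s.d) • permGen q lam

/-- `φ` sends `m_ν` to the class of `∑ m_lam T_{d(𝔰)}`. Since `m_ν` generates `M^ν`, at most one
homomorphism has this property. -/
def IsTheta {lam : WeakComposition n a} {ν : WeakComposition n b} (S : RowTableau lam ν)
    (φ : permModule q ν →ₗ[(HeckeAlgebra R q n)ᵐᵒᵖ] spechtModule q lam) : Prop :=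
  φ (permGen q ν) = spechtProj q lam (thetaElt q S)

open Classical in
/-- `Θ_S : M^ν → S^lam`, the homomorphism determined by `IsTheta`. -/
def theta {lam : WeakComposition n a} {ν : WeakComposition n b} (S : RowTableau lam ν) :
    permModule q ν →ₗ[(HeckeAlgebra R q n)ᵐᵒᵖ] spechtModule q lam :=
  if h : ∃ φ, IsTheta q S φ then h.choose else 0

end HeckeAlgebra

end

/-! A row-standard $\lambda$-tableau is encoded by the word $v$ that records the row of each letter.
Then $m_\lambda T_{d(\mathfrak s)}$ is the sum of $T_w$ over all $w$ taking the sorted word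
`lam.rowIndex` to $v$ (`cosetSum`, `mElt_mul_T_d`), and $\Theta_S(m_\nu)$ is the class of the sum
over all words with $S^i_r$ letters $r$ in the block of positions given by row $i$ of $\mathfrak
t^\nu$ (`coe_thetaElt`). The theorem thus concerns sums of words modulo the higher ideal.

The relations come from `shiftSum`: fix a word $v$ and adjacent rows $p,p'$, and sum over all ways
of changing $t>0$ letters $p$ of $v$ into $p'$, weighted by a power of $q$ that counts crossings.
Right multiplication by $T_i$ carries the sum for $v$ to the sum for $v$ with an ascent exchanged
(`shiftSum_mul_gen`), which reduces to sorted $v$. There the sum runs over full cosets of the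
stabilizer of $v$ and is a left multiple of the stabilizer sum. Compared with $\lambda$, the word
$v$ has $t$ more letters $p$ and $t$ fewer letters $p'$. If $p$ is the upper row, or if both rows
have the same length, its letter counts sort to a partition strictly dominating $\lambda$, so the
sum vanishes in $S^\lambda$ (`shiftSum_mem_higherIdeal`).

The rest is $q$-combinatorics. Let $s$ be the number of letters $p'$ in block $d$, and start from
the words in which these have become $p$. Applying the relations to words with the positions $K$
already overwritten gives, for every $K$ with fewer than $s$ elements, a relation between the sets
$L\supseteq K$ of size $s$ (`ShiftVanishing.sum_superset`). Combined with the weights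
`straightCoeff`, these relations equate a sum over the $L$ that avoid block $d$ with a sum over the
$L$ inside block $d$ (`ShiftVanishing.sum_word`). The former yields the $\Theta_{U_g}$, the latter
$\Theta_S$; the Gaussian binomials count, with weights, how often a given word arises
(`sum_words_shift`). Part (1) is the case $p=r$, $p'=r+1$. Part (2) is the case $p=r+1$, $p'=r$,
treated by reversing the orders of positions and blocks (`straighten_dual`). -/

set_option linter.unusedSectionVars false

open WeakComposition

/-! ### Inversions and reduced words in the symmetric group -/

namespace HeckeAlgebra

section Inversions

variable {n : ℕ} {α : Type*} [LinearOrder α]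

/-- The letter `i` moved by `simpleTransposition i`. -/
def lower (i : Fin (n - 1)) : Fin n := ⟨i, by omega⟩

/-- The letter `i + 1` moved by `simpleTransposition i`. -/
def upper (i : Fin (n - 1)) : Fin n := ⟨i + 1, by omega⟩

theorem simpleTransposition_eq (i : Fin (n - 1)) :
    simpleTransposition i = Equiv.swap (lower i) (upper i) := rfl

theorem lower_lt_upper (i : Fin (n - 1)) : lower i < upper i := by
  simp [lower, upper, Fin.lt_def]

@[simp] theorem simpleTransposition_lower (i : Fin (n - 1)) :
    simpleTransposition i (lower i) = upper i := Equiv.swap_apply_left _ _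

@[simp] theorem simpleTransposition_upper (i : Fin (n - 1)) :
    simpleTransposition i (upper i) = lower i := Equiv.swap_apply_right _ _

@[simp] theorem simpleTransposition_inv (i : Fin (n - 1)) :
    (simpleTransposition i)⁻¹ = simpleTransposition i := Equiv.swap_inv _ _

@[simp] theorem simpleTransposition_mul_self (i : Fin (n - 1)) :
    simpleTransposition i * simpleTransposition i = 1 := Equiv.swap_mul_self _ _

@[simp] theorem simpleTransposition_mul_cancel (i : Fin (n - 1)) (w : Equiv.Perm (Fin n)) :
    simpleTransposition i * (simpleTransposition i * w) = w := by
  rw [← mul_assoc, simpleTransposition_mul_self, one_mul]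

@[simp] theorem simpleTransposition_apply_apply (i : Fin (n - 1)) (k : Fin n) :
    simpleTransposition i (simpleTransposition i k) = k := by
  rw [← Equiv.Perm.mul_apply, simpleTransposition_mul_self, Equiv.Perm.one_apply]

theorem simpleTransposition_val (i : Fin (n - 1)) (k : Fin n) :
    ((simpleTransposition i k : Fin n) : ℕ) =
      if (k : ℕ) = i then (i : ℕ) + 1 else if (k : ℕ) = i + 1 then (i : ℕ) else k := by
  rw [simpleTransposition_eq, Equiv.swap_apply_def]
  simp only [lower, upper, Fin.ext_iff]
  split_ifs <;> rfl

/-- A simple transposition preserves the order of every pair but the one it exchanges. -/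
theorem simpleTransposition_lt_iff (i : Fin (n - 1)) {x y : Fin n}
    (h : ¬ (x = lower i ∧ y = upper i)) (h' : ¬ (y = lower i ∧ x = upper i)) :
    simpleTransposition i x < simpleTransposition i y ↔ x < y := by
  simp only [Fin.lt_def, simpleTransposition_val, lower, upper, Fin.ext_iff] at *
  split_ifs <;> omega

/-- The number of inversions of a finite sequence. -/
def invCount (f : Fin n → α) : ℕ :=
  (Finset.univ.filter fun x : Fin n × Fin n => x.1 < x.2 ∧ f x.2 < f x.1).card

/-- The pair of exchanged positions is the one new inversion; `simpleTransposition i` applied to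
both entries matches all the others. -/
theorem invCount_comp_simpleTransposition {f : Fin n → α} {i : Fin (n - 1)}
    (h : f (lower i) < f (upper i)) :
    invCount (f ∘ simpleTransposition i) = invCount f + 1 := by
  classical
  have hi : (lower i, upper i) ∈ Finset.univ.filter fun x : Fin n × Fin n =>
      x.1 < x.2 ∧ (f ∘ simpleTransposition i) x.2 < (f ∘ simpleTransposition i) x.1 := by
    simp [lower_lt_upper, h]
  rw [invCount, ← Finset.card_erase_add_one hi, invCount, add_left_inj]
  refine Finset.card_bij'
    (fun x _ => (simpleTransposition i x.1, simpleTransposition i x.2))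
    (fun x _ => (simpleTransposition i x.1, simpleTransposition i x.2)) ?_ ?_ ?_ ?_
  · rintro ⟨x, y⟩ hx
    simp only [Finset.mem_erase, Finset.mem_filter, Finset.mem_univ, true_and, Function.comp,
      ne_eq, Prod.mk.injEq] at hx ⊢
    refine ⟨(simpleTransposition_lt_iff i hx.1 ?_).2 hx.2.1, hx.2.2⟩
    rintro ⟨rfl, rfl⟩
    exact lt_asymm hx.2.1 (lower_lt_upper i)
  · rintro ⟨x, y⟩ hx
    simp only [Finset.mem_erase, Finset.mem_filter, Finset.mem_univ, true_and, Function.comp,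
      ne_eq, Prod.mk.injEq, simpleTransposition_apply_apply] at hx ⊢
    refine ⟨?_, (simpleTransposition_lt_iff i ?_ ?_).2 hx.1, hx.2⟩
    · rintro ⟨h1, h2⟩
      have h1' : x = upper i := by rw [← simpleTransposition_apply_apply i x, h1]; simp
      have h2' : y = lower i := by rw [← simpleTransposition_apply_apply i y, h2]; simp
      subst h1' h2'
      exact lt_asymm hx.1 (lower_lt_upper i)
    · rintro ⟨rfl, rfl⟩
      exact lt_asymm hx.2 h
    · rintro ⟨rfl, rfl⟩
      exact lt_asymm hx.1 (lower_lt_upper i)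
  · rintro ⟨x, y⟩ _
    simp
  · rintro ⟨x, y⟩ _
    simp

theorem comp_simpleTransposition_comp {β : Type*} (f : Fin n → β) (i : Fin (n - 1)) :
    (f ∘ simpleTransposition i) ∘ simpleTransposition i = f := by
  funext k; simp

theorem invCount_of_descent {f : Fin n → α} {i : Fin (n - 1)}
    (h : f (upper i) < f (lower i)) :
    invCount f = invCount (f ∘ simpleTransposition i) + 1 := by
  have := invCount_comp_simpleTransposition (f := f ∘ simpleTransposition i) (i := i) (by simpa)
  rwa [comp_simpleTransposition_comp] at this

theorem monotone_of_no_descent {f : Fin n → α}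
    (h : ∀ i : Fin (n - 1), f (lower i) ≤ f (upper i)) : Monotone f := by
  cases n with
  | zero => exact fun x => x.elim0
  | succ m => exact Fin.monotone_iff_le_succ.2 fun i => h i

/-- Induction along adjacent exchanges that increase the number of inversions. -/
theorem word_induction {P : (Fin n → α) → Prop} (mono : ∀ f, Monotone f → P f)
    (step : ∀ f (i : Fin (n - 1)), f (lower i) < f (upper i) → P f →
      P (f ∘ simpleTransposition i)) (f : Fin n → α) : P f := by
  induction hk : invCount f using Nat.strong_induction_on generalizing f with
  | _ k ih =>
    by_cases hd : ∀ i : Fin (n - 1), f (lower i) ≤ f (upper i)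
    · exact mono f (monotone_of_no_descent hd)
    · push Not at hd
      obtain ⟨i, hi⟩ := hd
      have h1 := invCount_of_descent hi
      have h2 := step (f ∘ simpleTransposition i) i (by simpa)
        (ih _ (by omega) _ rfl)
      rwa [comp_simpleTransposition_comp] at h2

theorem perm_eq_one_of_monotone {w : Equiv.Perm (Fin n)} (h : Monotone w) : w = 1 := by
  have hs : StrictMono w := h.strictMono_of_injective w.injective
  have := Subsingleton.elim (hs.orderIsoOfSurjective w w.surjective) (OrderIso.refl _)
  ext k
  exact congrArg (fun e : Fin n ≃o Fin n => (e k : ℕ)) this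

/-- The length of a permutation. -/
def permLength (w : Equiv.Perm (Fin n)) : ℕ := invCount ⇑(w⁻¹)

theorem coe_inv_simpleTransposition_mul (i : Fin (n - 1)) (w : Equiv.Perm (Fin n)) :
    ⇑((simpleTransposition i * w)⁻¹) = ⇑(w⁻¹) ∘ simpleTransposition i := by
  rw [mul_inv_rev, simpleTransposition_inv, Equiv.Perm.coe_mul]

theorem permLength_mul_of_ascent {w : Equiv.Perm (Fin n)} {i : Fin (n - 1)}
    (h : w⁻¹ (lower i) < w⁻¹ (upper i)) :
    permLength (simpleTransposition i * w) = permLength w + 1 := by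
  rw [permLength, coe_inv_simpleTransposition_mul, invCount_comp_simpleTransposition h, permLength]

theorem permLength_of_descent {w : Equiv.Perm (Fin n)} {i : Fin (n - 1)}
    (h : w⁻¹ (upper i) < w⁻¹ (lower i)) :
    permLength w = permLength (simpleTransposition i * w) + 1 := by
  rw [permLength, invCount_of_descent h, permLength, coe_inv_simpleTransposition_mul]

theorem ascent_or_descent (w : Equiv.Perm (Fin n)) (i : Fin (n - 1)) :
    w⁻¹ (lower i) < w⁻¹ (upper i) ∨ w⁻¹ (upper i) < w⁻¹ (lower i) :=
  lt_or_gt_of_ne fun h => (lower_lt_upper i).ne (w⁻¹.injective h)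

@[simp] theorem wordPerm_nil : wordPerm ([] : List (Fin (n - 1))) = 1 := rfl

@[simp] theorem wordPerm_append_singleton (l : List (Fin (n - 1))) (i : Fin (n - 1)) :
    wordPerm (l ++ [i]) = simpleTransposition i * wordPerm l := by
  simp [wordPerm]

theorem wordPerm_reverse (l : List (Fin (n - 1))) : wordPerm l.reverse = (wordPerm l)⁻¹ := by
  rw [wordPerm, wordPerm, List.prod_inv_reverse]
  simp [Function.comp_def]

theorem permLength_one : permLength (1 : Equiv.Perm (Fin n)) = 0 := by
  rw [permLength, invCount, Finset.card_eq_zero, Finset.filter_eq_empty_iff]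
  rintro ⟨x, y⟩ _ ⟨h1, h2⟩
  exact lt_asymm h1 (by simpa using h2)

theorem permLength_wordPerm_le (l : List (Fin (n - 1))) : permLength (wordPerm l) ≤ l.length := by
  induction l using List.reverseRecOn with
  | nil => simp [permLength_one]
  | append_singleton l i ih =>
    rw [wordPerm_append_singleton, List.length_append, List.length_singleton]
    rcases ascent_or_descent (wordPerm l) i with h | h
    · rw [permLength_mul_of_ascent h]; omega
    · have := permLength_of_descent h; omega

/-- Induction on permutations along ascents. -/
theorem perm_induction {P : Equiv.Perm (Fin n) → Prop} (one : P 1)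
    (step : ∀ w (i : Fin (n - 1)), w⁻¹ (lower i) < w⁻¹ (upper i) → P w →
      P (simpleTransposition i * w)) (w : Equiv.Perm (Fin n)) : P w := by
  have key : ∀ f : Fin n → Fin n, ∀ w : Equiv.Perm (Fin n), f = ⇑(w⁻¹) → P w := by
    intro f
    induction f using word_induction with
    | mono f hf =>
      rintro w rfl
      rwa [inv_eq_one.1 (perm_eq_one_of_monotone hf)]
    | step f i hi ih =>
      intro w hw
      have h1 : f = ⇑((simpleTransposition i * w)⁻¹) := by
        rw [coe_inv_simpleTransposition_mul, ← hw, comp_simpleTransposition_comp]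
      have h2 := step _ i (h1 ▸ hi) (ih _ h1)
      rwa [simpleTransposition_mul_cancel] at h2
  exact key _ w rfl

theorem exists_wordPerm_length (w : Equiv.Perm (Fin n)) :
    ∃ l, wordPerm l = w ∧ l.length = permLength w := by
  induction w using perm_induction with
  | one => exact ⟨[], rfl, permLength_one.symm⟩
  | step w i hi ih =>
    obtain ⟨l, rfl, hl⟩ := ih
    exact ⟨l ++ [i], by simp, by rw [permLength_mul_of_ascent hi]; simp [hl]⟩

/-- Each letter changes the inversion number by exactly one, so it bounds the length of every
expression from below, and sorting along descents attains the bound. -/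
theorem isReducedExpr_iff {l : List (Fin (n - 1))} {w : Equiv.Perm (Fin n)} :
    IsReducedExpr l w ↔ wordPerm l = w ∧ l.length = permLength w := by
  constructor
  · rintro ⟨h, hmin⟩
    obtain ⟨l', h', hl'⟩ := exists_wordPerm_length w
    have := hmin l' h'
    have := permLength_wordPerm_le l
    rw [h] at this
    exact ⟨h, by omega⟩
  · rintro ⟨h, hl⟩
    refine ⟨h, fun l' h' => ?_⟩
    have := permLength_wordPerm_le l'
    rw [h'] at this
    omega

theorem permLength_inv (w : Equiv.Perm (Fin n)) : permLength w⁻¹ = permLength w := by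
  have h : ∀ w : Equiv.Perm (Fin n), permLength w⁻¹ ≤ permLength w := by
    intro w
    obtain ⟨l, rfl, hl⟩ := exists_wordPerm_length w
    have := permLength_wordPerm_le l.reverse
    rw [wordPerm_reverse, List.length_reverse] at this
    omega
  have h1 := h w
  have h2 := h w⁻¹
  rw [inv_inv] at h2
  omega

theorem descent_of_reduced {l : List (Fin (n - 1))} {i : Fin (n - 1)} {w : Equiv.Perm (Fin n)}
    (h : wordPerm (l ++ [i]) = w) (hl : (l ++ [i]).length = permLength w) :
    wordPerm l = simpleTransposition i * w ∧ l.length = permLength (simpleTransposition i * w) ∧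
      w⁻¹ (upper i) < w⁻¹ (lower i) := by
  have h0 : wordPerm l = simpleTransposition i * w := by
    rw [← h, wordPerm_append_singleton, simpleTransposition_mul_cancel]
  have h2 := permLength_wordPerm_le l
  rw [h0] at h2
  rw [List.length_append, List.length_singleton] at hl
  rcases ascent_or_descent w i with h1 | h1
  · have := permLength_mul_of_ascent h1
    omega
  · have := permLength_of_descent h1
    exact ⟨h0, by omega, h1⟩

theorem simpleTransposition_comm {i j : Fin (n - 1)} (h : (i : ℕ) + 1 < j) :
    simpleTransposition i * simpleTransposition j =
      simpleTransposition j * simpleTransposition i := by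
  ext k
  simp only [Equiv.Perm.mul_apply, simpleTransposition_val]
  split_ifs <;> omega

theorem simpleTransposition_braid {i j : Fin (n - 1)} (h : (i : ℕ) + 1 = j) :
    simpleTransposition i * simpleTransposition j * simpleTransposition i =
      simpleTransposition j * simpleTransposition i * simpleTransposition j := by
  have e0 : lower j = upper i := by ext; simp [lower, upper, h]
  have h1 : lower i ≠ upper i := (lower_lt_upper i).ne
  have h2 : upper i ≠ upper j := e0 ▸ (lower_lt_upper j).ne
  have h3 : lower i ≠ upper j := ((lower_lt_upper i).trans (e0 ▸ lower_lt_upper j)).ne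
  simp only [simpleTransposition_eq, e0]
  rw [Equiv.swap_mul_swap_mul_swap h1 h3, Equiv.swap_comm (lower i) (upper i),
    Equiv.swap_comm (upper i) (upper j), Equiv.swap_mul_swap_mul_swap h2.symm h3.symm,
    Equiv.swap_comm]

/-- A map from the generators that satisfies the braid relations takes the same value on any two
reduced expressions of a permutation. -/
theorem prod_eq_of_reduced {M : Type*} [Monoid M] (g : Fin (n - 1) → M)
    (hcomm : ∀ i j : Fin (n - 1), (i : ℕ) + 1 < j → g i * g j = g j * g i)
    (hbraid : ∀ i j : Fin (n - 1), (i : ℕ) + 1 = j → g i * g j * g i = g j * g i * g j)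
    (w : Equiv.Perm (Fin n)) {l l' : List (Fin (n - 1))} (h : wordPerm l = w)
    (hl : l.length = permLength w) (h' : wordPerm l' = w) (hl' : l'.length = permLength w) :
    (l.map g).prod = (l'.map g).prod := by
  induction hk : permLength w using Nat.strong_induction_on generalizing w l l' with
  | _ k ih =>
  -- If $w$ has commuting descents at $i$ and $j$, it has reduced expressions $u\,j\,i$ and
  -- $u\,i\,j$ with the same $u$. By induction they may replace the two given ones.
  have far : ∀ (i j : Fin (n - 1)) (l l' : List (Fin (n - 1))), (i : ℕ) + 1 < j →
      wordPerm (l ++ [i]) = w → (l ++ [i]).length = permLength w →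
      wordPerm (l' ++ [j]) = w → (l' ++ [j]).length = permLength w →
      ((l ++ [i]).map g).prod = ((l' ++ [j]).map g).prod := by
    intro i j l l' hij h hl h' hl'
    obtain ⟨h1, hl1, hi⟩ := descent_of_reduced h hl
    obtain ⟨h1', hl1', hj⟩ := descent_of_reduced h' hl'
    have hlen := permLength_of_descent hi
    have hlen' := permLength_of_descent hj
    obtain ⟨u, hu, hul⟩ :=
      exists_wordPerm_length (simpleTransposition j * (simpleTransposition i * w))
    have hd : (simpleTransposition i * w)⁻¹ (upper j) < (simpleTransposition i * w)⁻¹ (lower j) := by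
      rw [coe_inv_simpleTransposition_mul]
      have e1 : simpleTransposition i (upper j) = upper j := by
        ext; simp only [simpleTransposition_val, upper]; split_ifs <;> omega
      have e2 : simpleTransposition i (lower j) = lower j := by
        ext; simp only [simpleTransposition_val, lower]; split_ifs <;> omega
      simpa [e1, e2] using hj
    have hlen2 := permLength_of_descent hd
    have r1 := ih _ (by omega) (simpleTransposition i * w) h1 hl1
      (l' := u ++ [j]) (by simp [hu]) (by simp [hul]; omega) rfl
    have r2 := ih _ (by omega) (simpleTransposition j * w) h1' hl1'
      (l' := u ++ [i]) (by
        rw [wordPerm_append_singleton, hu, ← mul_assoc, ← mul_assoc, simpleTransposition_comm hij,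
          mul_assoc (simpleTransposition j), simpleTransposition_mul_self, mul_one])
      (by simp [hul]; omega) rfl
    simp only [List.map_append, List.prod_append, List.map_cons, List.map_nil, List.prod_cons,
      List.prod_nil, mul_one] at r1 r2 ⊢
    rw [r1, r2, mul_assoc, mul_assoc, hcomm i j hij]
  -- Descents at the adjacent places $i,j$ give reduced expressions $u\,i\,j\,i$ and $u\,j\,i\,j$,
  -- which the braid relation identifies.
  have near : ∀ (i j : Fin (n - 1)) (l l' : List (Fin (n - 1))), (i : ℕ) + 1 = j →
      wordPerm (l ++ [i]) = w → (l ++ [i]).length = permLength w →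
      wordPerm (l' ++ [j]) = w → (l' ++ [j]).length = permLength w →
      ((l ++ [i]).map g).prod = ((l' ++ [j]).map g).prod := by
    intro i j l l' hij h hl h' hl'
    obtain ⟨h1, hl1, hi⟩ := descent_of_reduced h hl
    obtain ⟨h1', hl1', hj⟩ := descent_of_reduced h' hl'
    have hlen := permLength_of_descent hi
    have hlen' := permLength_of_descent hj
    obtain ⟨u, hu, hul⟩ := exists_wordPerm_length
      (simpleTransposition i * (simpleTransposition j * (simpleTransposition i * w)))
    have e0 : lower j = upper i := by ext; simp [lower, upper, hij]
    have e1 : simpleTransposition i (upper j) = upper j := by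
      ext; simp only [simpleTransposition_val, upper]; split_ifs <;> omega
    have e2 : simpleTransposition j (lower i) = lower i := by
      ext; simp only [simpleTransposition_val, lower]; split_ifs <;> omega
    have e3 : simpleTransposition j (upper i) = upper j := by
      rw [← e0, simpleTransposition_lower]
    have hd : (simpleTransposition i * w)⁻¹ (upper j) < (simpleTransposition i * w)⁻¹ (lower j) := by
      rw [coe_inv_simpleTransposition_mul]
      simp only [Function.comp, e0, e1, simpleTransposition_upper]
      exact hj.trans (e0 ▸ hi)
    have hd2 : (simpleTransposition j * (simpleTransposition i * w))⁻¹ (upper i) <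
        (simpleTransposition j * (simpleTransposition i * w))⁻¹ (lower i) := by
      rw [coe_inv_simpleTransposition_mul, coe_inv_simpleTransposition_mul]
      simp only [Function.comp, e1, e2, e3, simpleTransposition_lower]
      exact e0 ▸ hj
    have hlen2 := permLength_of_descent hd
    have hlen3 := permLength_of_descent hd2
    have r1 := ih _ (by omega) (simpleTransposition i * w) h1 hl1
      (l' := u ++ [i] ++ [j]) (by
        rw [wordPerm_append_singleton, wordPerm_append_singleton, hu]
        simp) (by simp [hul]; omega) rfl
    have r2 := ih _ (by omega) (simpleTransposition j * w) h1' hl1'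
      (l' := u ++ [j] ++ [i]) (by
        have hb := simpleTransposition_braid hij
        have hu' : wordPerm u = simpleTransposition j * (simpleTransposition i *
            (simpleTransposition j * w)) := by
          rw [hu]; simp only [← mul_assoc]; rw [hb]
        rw [wordPerm_append_singleton, wordPerm_append_singleton, hu']
        simp)
      (by simp [hul]; omega) rfl
    simp only [List.map_append, List.prod_append, List.map_cons, List.map_nil, List.prod_cons,
      List.prod_nil, mul_one] at r1 r2 ⊢
    rw [r1, r2]
    have := hbraid i j hij
    simp only [mul_assoc] at this ⊢
    rw [this]
  rcases l.eq_nil_or_concat with rfl | ⟨l, i, rfl⟩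
  · have : l' = [] := by
      rw [← List.length_eq_zero_iff, hl', ← hl]; rfl
    rw [this]
  rcases l'.eq_nil_or_concat with rfl | ⟨l', j, rfl⟩
  · simp at hl' hl; omega
  simp only [List.concat_eq_append] at *
  rcases lt_trichotomy (i : ℕ) j with hij | hij | hij
  · rcases (Nat.succ_le_of_lt hij).lt_or_eq with hij | hij
    · exact far i j l l' hij h hl h' hl'
    · exact near i j l l' hij h hl h' hl'
  · obtain rfl := Fin.ext hij
    obtain ⟨h1, hl1, hi⟩ := descent_of_reduced h hl
    obtain ⟨h1', hl1', -⟩ := descent_of_reduced h' hl'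
    have hlen := permLength_of_descent hi
    have := ih _ (by omega) _ h1 hl1 h1' hl1' rfl
    simp [this]
  · rcases (Nat.succ_le_of_lt hij).lt_or_eq with hij | hij
    · exact (far j i l' l hij h' hl' h hl).symm
    · exact (near j i l' l hij h' hl' h hl).symm

end Inversions

/-! ### The elements `T_w` -/

section Basis

variable {R : Type*} [CommRing R] (q : Rˣ) {n : ℕ}

/-- Frees `T` from the reduced expression chosen in its definition. -/
theorem prod_gen_eq_T {l : List (Fin (n - 1))} {w : Equiv.Perm (Fin n)} (h : wordPerm l = w)
    (hl : l.length = permLength w) : (l.map (gen q)).prod = T q w := by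
  have hc := isReducedExpr_iff.1 (exists_isReducedExpr w).choose_spec
  exact prod_eq_of_reduced (gen q) (gen_comm q) (gen_braid q) w h hl hc.1 hc.2

theorem T_one : T q (1 : Equiv.Perm (Fin n)) = 1 := by
  rw [← prod_gen_eq_T q (l := []) (w := 1) rfl permLength_one.symm]; rfl

theorem T_mul_gen {w : Equiv.Perm (Fin n)} {i : Fin (n - 1)}
    (h : w⁻¹ (lower i) < w⁻¹ (upper i)) :
    T q w * gen q i = T q (simpleTransposition i * w) := by
  obtain ⟨l, rfl, hl⟩ := exists_wordPerm_length w
  rw [← prod_gen_eq_T q rfl hl, ← prod_gen_eq_T q (wordPerm_append_singleton l i)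
    (by rw [permLength_mul_of_ascent h]; simp [hl])]
  simp

theorem gen_mul_self (i : Fin (n - 1)) :
    gen q i * gen q i = ((q : R) - 1) • gen q i + (q : R) • (1 : HeckeAlgebra R q n) := by
  have h := gen_quad q i
  rw [mul_sub, add_mul, add_mul, one_mul, one_mul, ← Algebra.commutes, ← Algebra.smul_def,
    Algebra.algebraMap_eq_smul_one] at h
  rw [sub_smul, one_smul]
  rw [← sub_eq_zero, ← h]
  abel

theorem T_mul_gen_of_descent {w : Equiv.Perm (Fin n)} {i : Fin (n - 1)}
    (h : w⁻¹ (upper i) < w⁻¹ (lower i)) :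
    T q w * gen q i = ((q : R) - 1) • T q w + (q : R) • T q (simpleTransposition i * w) := by
  have h1 := T_mul_gen q (w := simpleTransposition i * w) (i := i)
    (by rw [coe_inv_simpleTransposition_mul]; simpa using h)
  rw [simpleTransposition_mul_cancel] at h1
  rw [← h1, mul_assoc, gen_mul_self, mul_add, mul_smul_comm, mul_smul_comm, mul_one]

/-- The quadratic relation gives the inverse $q^{-1}(T_i-(q-1))$. -/
theorem isUnit_gen (i : Fin (n - 1)) : IsUnit (gen q i) := by
  have h := gen_mul_self q i
  have e : gen q i * ((↑q⁻¹ : R) • (gen q i - ((q : R) - 1) • 1)) = 1 := by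
    rw [mul_smul_comm, mul_sub, h, mul_smul_comm, mul_one, add_sub_cancel_left, smul_smul,
      Units.inv_mul, one_smul]
  have e' : ((↑q⁻¹ : R) • (gen q i - ((q : R) - 1) • 1)) * gen q i = 1 := by
    rw [smul_mul_assoc, sub_mul, h, smul_mul_assoc, one_mul, add_sub_cancel_left, smul_smul,
      Units.inv_mul, one_smul]
  exact ⟨⟨_, _, e, e'⟩, rfl⟩

theorem heckeStar_mul (x y : HeckeAlgebra R q n) :
    heckeStar q (x * y) = heckeStar q y * heckeStar q x := by
  simp [heckeStar]

theorem heckeStar_sum {ι : Type*} (s : Finset ι) (f : ι → HeckeAlgebra R q n) :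
    heckeStar q (∑ x ∈ s, f x) = ∑ x ∈ s, heckeStar q (f x) := by
  simp [heckeStar]

theorem heckeStar_gen (i : Fin (n - 1)) : heckeStar q (gen q i) = gen q i := by
  simp only [heckeStar, starHom, gen]
  erw [RingQuot.liftAlgHom_mkAlgHom_apply]
  rw [FreeAlgebra.lift_ι_apply]
  rfl

theorem heckeStar_prod (l : List (Fin (n - 1))) :
    heckeStar q (l.map (gen q)).prod = (l.reverse.map (gen q)).prod := by
  induction l with
  | nil => simp [heckeStar]
  | cons i l ih => simp [heckeStar_mul, ih, heckeStar_gen]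

theorem heckeStar_T (w : Equiv.Perm (Fin n)) : heckeStar q (T q w) = T q w⁻¹ := by
  obtain ⟨l, rfl, hl⟩ := exists_wordPerm_length w
  rw [← prod_gen_eq_T q rfl hl, heckeStar_prod]
  exact prod_gen_eq_T q (wordPerm_reverse l) (by rw [permLength_inv, List.length_reverse, hl])

end Basis

end HeckeAlgebra

/-! ### Sums of `T_w` over cosets -/

namespace HeckeAlgebra

section CosetSums

variable {R : Type*} [CommRing R] (q : Rˣ) {n : ℕ} {ι κ : Type*} [LinearOrder ι] [LinearOrder κ]

/-- The sum of all `T_w` for which `w` takes the word `ρ` to the word `v`. -/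
noncomputable def cosetSum (ρ v : Fin n → ι) : HeckeAlgebra R q n :=
  ∑ w : Equiv.Perm (Fin n) with ρ ∘ (w⁻¹ : Equiv.Perm (Fin n)) = v, T q w

variable {ρ : Fin n → ι}

/-- Since `ρ` is sorted, every `w` in the coset inherits the ascent of `v` at `i`, so all lengths go
up and the product is computed term by term. -/
theorem cosetSum_mul_gen_of_lt (hρ : Monotone ρ) {v : Fin n → ι} {i : Fin (n - 1)}
    (h : v (lower i) < v (upper i)) :
    cosetSum q ρ v * gen q i = cosetSum q ρ (v ∘ simpleTransposition i) := by
  rw [cosetSum, cosetSum, Finset.sum_mul]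
  refine Finset.sum_bij' (fun w _ => simpleTransposition i * w)
    (fun w _ => simpleTransposition i * w) ?_ ?_ ?_ ?_ ?_
  · intro w hw
    simp only [Finset.mem_filter, Finset.mem_univ, true_and] at hw ⊢
    rw [coe_inv_simpleTransposition_mul, ← hw]
    rfl
  · intro w hw
    simp only [Finset.mem_filter, Finset.mem_univ, true_and] at hw ⊢
    rw [coe_inv_simpleTransposition_mul, ← Function.comp_assoc, hw, comp_simpleTransposition_comp]
  · intro w _
    simp
  · intro w _
    simp
  · intro w hw
    simp only [Finset.mem_filter, Finset.mem_univ, true_and] at hw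
    refine T_mul_gen q (lt_of_not_ge fun hge => ?_)
    rw [← hw] at h
    exact absurd (hρ hge) (not_le.2 h)

theorem comp_simpleTransposition_of_eq {β : Type*} {v : Fin n → β} {i : Fin (n - 1)}
    (h : v (lower i) = v (upper i)) : v ∘ simpleTransposition i = v := by
  funext k
  simp only [Function.comp, simpleTransposition_eq, Equiv.swap_apply_def]
  split_ifs with h1 h2
  · rw [h1, h]
  · rw [h2, h]
  · rfl

/-- The coset is a union of pairs `w`, `simpleTransposition i * w`, and the sum $T_w+T_wT_i$ over a
pair is multiplied by $q$ under $T_i$. -/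
theorem cosetSum_mul_gen_of_eq {v : Fin n → ι} {i : Fin (n - 1)}
    (h : v (lower i) = v (upper i)) :
    cosetSum q ρ v * gen q i = (q : R) • cosetSum q ρ v := by
  have hv := comp_simpleTransposition_of_eq h
  have hmem : ∀ w : Equiv.Perm (Fin n),
      ρ ∘ ⇑(simpleTransposition i * w)⁻¹ = v ↔ ρ ∘ (w⁻¹ : Equiv.Perm (Fin n)) = v := by
    intro w
    rw [coe_inv_simpleTransposition_mul, ← Function.comp_assoc]
    constructor
    · intro h'
      rw [← comp_simpleTransposition_comp (ρ ∘ (w⁻¹ : Equiv.Perm (Fin n))) i, h', hv]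
    · intro h'
      rw [h', hv]
  let P : Equiv.Perm (Fin n) → Prop := fun w => w⁻¹ (lower i) < w⁻¹ (upper i)
  have hP : ∀ w, P (simpleTransposition i * w) ↔ ¬ P w := by
    intro w
    simp only [P]
    rw [coe_inv_simpleTransposition_mul]
    simp only [Function.comp, simpleTransposition_lower, simpleTransposition_upper, not_lt]
    exact ⟨le_of_lt, fun h => h.lt_of_ne fun h' => (lower_lt_upper i).ne' (w⁻¹.injective h')⟩
  have hbij : ∀ f : Equiv.Perm (Fin n) → HeckeAlgebra R q n,
      ∑ w with (ρ ∘ (w⁻¹ : Equiv.Perm (Fin n)) = v ∧ ¬ P w), f w =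
        ∑ w with (ρ ∘ (w⁻¹ : Equiv.Perm (Fin n)) = v ∧ P w), f (simpleTransposition i * w) := by
    intro f
    refine Finset.sum_bij' (fun w _ => simpleTransposition i * w)
      (fun w _ => simpleTransposition i * w) ?_ ?_ ?_ ?_ ?_
    · intro w hw
      simpa only [Finset.mem_filter, Finset.mem_univ, true_and, hmem, hP] using hw
    · intro w hw
      simpa only [Finset.mem_filter, Finset.mem_univ, true_and, hmem, hP, not_not] using hw
    · intro w _; simp
    · intro w _; simp
    · intro w _; simp
  have split : ∀ f : Equiv.Perm (Fin n) → HeckeAlgebra R q n,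
      ∑ w with ρ ∘ (w⁻¹ : Equiv.Perm (Fin n)) = v, f w =
        ∑ w with (ρ ∘ (w⁻¹ : Equiv.Perm (Fin n)) = v ∧ P w), (f w + f (simpleTransposition i * w)) := by
    intro f
    rw [Finset.sum_add_distrib, ← hbij, ← Finset.filter_filter, ← Finset.filter_filter,
      Finset.sum_filter_add_sum_filter_not]
  rw [cosetSum, Finset.sum_mul, split, split, Finset.smul_sum]
  refine Finset.sum_congr rfl fun w hw => ?_
  simp only [Finset.mem_filter, Finset.mem_univ, true_and] at hw
  have hd : (simpleTransposition i * w)⁻¹ (upper i) < (simpleTransposition i * w)⁻¹ (lower i) := by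
    rw [coe_inv_simpleTransposition_mul]
    simpa [P] using hw.2
  rw [T_mul_gen q hw.2, T_mul_gen_of_descent q hd, simpleTransposition_mul_cancel, smul_add,
    sub_smul, one_smul]
  abel

/-- The hypothesis on `d` says that it is the shortest element of its coset. Along a reduced
expression of such a `d` no two equal letters are ever exchanged, so only the ascent rule is needed.
-/
theorem cosetSum_self_mul_T (hρ : Monotone ρ) (d : Equiv.Perm (Fin n))
    (hd : ∀ x y, x < y → ρ x = ρ y → d x < d y) :
    cosetSum q ρ ρ * T q d = cosetSum q ρ (ρ ∘ ⇑d⁻¹) := by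
  induction d using perm_induction with
  | one => rw [T_one, mul_one]; rfl
  | step w i hi ih =>
    have hne : ρ (w⁻¹ (lower i)) ≠ ρ (w⁻¹ (upper i)) := by
      intro h
      have := hd _ _ hi h
      simp only [Equiv.Perm.mul_apply, Equiv.Perm.coe_inv, Equiv.apply_symm_apply, simpleTransposition_lower,
        simpleTransposition_upper] at this
      exact lt_asymm this (lower_lt_upper i)
    have hw : ∀ x y, x < y → ρ x = ρ y → w x < w y := by
      intro x y hxy h
      by_cases h1 : w x = lower i ∧ w y = upper i
      · rw [h1.1, h1.2]; exact lower_lt_upper i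
      by_cases h2 : w y = lower i ∧ w x = upper i
      · rw [← h2.1, ← h2.2, Equiv.Perm.coe_inv, Equiv.symm_apply_apply, Equiv.symm_apply_apply] at hi
        exact absurd hi (lt_asymm hxy)
      · exact (simpleTransposition_lt_iff i h1 h2).1 (hd x y hxy h)
    rw [← T_mul_gen q hi, ← mul_assoc, ih hw,
      cosetSum_mul_gen_of_lt q hρ ((hρ hi.le).lt_of_ne hne), coe_inv_simpleTransposition_mul]
    rfl

/-- Any rearrangement of `ρ` is reached from `ρ` by exchanging ascents, and each exchange is
multiplication by an invertible $T_i$. -/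
theorem exists_cosetSum_eq_mul_unit (hρ : Monotone ρ) (v : Fin n → ι)
    (hv : ∃ u : Equiv.Perm (Fin n), ρ ∘ u = v) :
    ∃ h : (HeckeAlgebra R q n)ˣ, cosetSum q ρ v = cosetSum q ρ ρ * h := by
  induction v using word_induction with
  | mono v hm =>
    obtain ⟨u, rfl⟩ := hv
    have := Tuple.unique_monotone (f := ρ) (σ := u) (τ := 1) hm hρ
    rw [this]
    exact ⟨1, by simp⟩
  | step v i hi ih =>
    obtain ⟨u, hu⟩ := hv
    obtain ⟨h, hh⟩ := ih ⟨u * simpleTransposition i, by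
      rw [Equiv.Perm.coe_mul, ← Function.comp_assoc, hu, comp_simpleTransposition_comp]⟩
    obtain ⟨g, hg⟩ := isUnit_gen q i
    exact ⟨h * g, by rw [← cosetSum_mul_gen_of_lt q hρ hi, hh, Units.val_mul, hg, mul_assoc]⟩

theorem heckeStar_cosetSum (v : Fin n → ι) :
    heckeStar q (cosetSum q ρ v) = ∑ w : Equiv.Perm (Fin n) with ρ ∘ (w : Equiv.Perm (Fin n)) = v, T q w := by
  rw [cosetSum, heckeStar_sum]
  refine Finset.sum_bij' (fun w _ => w⁻¹) (fun w _ => w⁻¹) ?_ ?_ ?_ ?_ ?_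
  · intro w hw; simpa using hw
  · intro w hw; simpa only [Finset.mem_filter, Finset.mem_univ, true_and, inv_inv] using hw
  · intro w _; simp
  · intro w _; simp
  · intro w _; exact heckeStar_T q w

theorem heckeStar_cosetSum_self : heckeStar q (cosetSum q ρ ρ) = cosetSum q ρ ρ := by
  rw [heckeStar_cosetSum, cosetSum]
  refine Finset.sum_congr (Finset.filter_congr fun w _ => ?_) fun _ _ => rfl
  constructor
  · intro h
    funext k
    have := congrFun h (w⁻¹ k)
    simpa using this.symm
  · intro h
    funext k
    have := congrFun h (w k)
    simpa using this.symm

/-- The anti-automorphism $*$ turns this into `exists_cosetSum_eq_mul_unit`, because it sends $T_w$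
to $T_{w^{-1}}$ and fixes the stabilizer sum. -/
theorem exists_sum_eq_mul_cosetSum (hρ : Monotone ρ) (v : Fin n → ι) :
    ∃ h, ∑ w : Equiv.Perm (Fin n) with ρ ∘ (w : Equiv.Perm (Fin n)) = v, T q w = h * cosetSum q ρ ρ := by
  by_cases hv : ∃ u : Equiv.Perm (Fin n), ρ ∘ u = v
  · obtain ⟨h, hh⟩ := exists_cosetSum_eq_mul_unit q hρ v hv
    refine ⟨heckeStar q h, ?_⟩
    rw [← heckeStar_cosetSum, hh, heckeStar_mul, heckeStar_cosetSum_self]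
  · refine ⟨0, ?_⟩
    rw [zero_mul, Finset.filter_eq_empty_iff.2, Finset.sum_empty]
    intro w _ hw
    exact hv ⟨w, hw⟩

/-- A sum of `T_w` over a union of cosets of the stabilizer of `ρ` is a left multiple of the sum
over the stabilizer. -/
theorem exists_sum_T_eq_mul_cosetSum (hρ : Monotone ρ) (D : Finset (Equiv.Perm (Fin n)))
    (hD : ∀ w ∈ D, ∀ w', ρ ∘ (w' : Equiv.Perm (Fin n)) = ρ ∘ (w : Equiv.Perm (Fin n)) → w' ∈ D) :
    ∃ h, ∑ w ∈ D, T q w = h * cosetSum q ρ ρ := by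
  classical
  choose c hc using fun v => exists_sum_eq_mul_cosetSum q hρ v
  refine ⟨∑ v ∈ D.image fun w => ρ ∘ (w : Equiv.Perm (Fin n)), c v, ?_⟩
  rw [← Finset.sum_fiberwise_of_maps_to (t := D.image fun w => ρ ∘ (w : Equiv.Perm (Fin n)))
    (g := fun w => ρ ∘ (w : Equiv.Perm (Fin n))) (fun w hw => Finset.mem_image_of_mem _ hw), Finset.sum_mul]
  refine Finset.sum_congr rfl fun v hv => ?_
  rw [← hc v]
  refine Finset.sum_congr ?_ fun _ _ => rfl
  obtain ⟨w, hw, rfl⟩ := Finset.mem_image.1 hv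
  ext w'
  simp only [Finset.mem_filter, Finset.mem_univ, true_and, and_iff_right_iff_imp]
  exact fun h => hD w hw _ h

/-- The stabilizer sums of two sorted words that agree up to a overwriteling and a rearrangement
generate the same two-sided ideal. -/
theorem exists_cosetSum_eq_mul_mul {σ : Fin n → κ} (hρ : Monotone ρ) (hσ : Monotone σ) (e : κ ≃ ι)
    (u : Equiv.Perm (Fin n)) (hu : ρ ∘ u = e ∘ σ) :
    ∃ h h', cosetSum q ρ ρ = h * cosetSum q σ σ * h' := by
  obtain ⟨x, hx⟩ := exists_cosetSum_eq_mul_unit q hρ (e ∘ σ) ⟨u, hu⟩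
  obtain ⟨y, hy⟩ := exists_sum_eq_mul_cosetSum q hσ (e.symm ∘ ρ)
  refine ⟨y, ↑x⁻¹, ?_⟩
  -- The sum of all $T_w$ with $\rho\circ w^{-1}=e\circ\sigma$ is a right multiple of one stabilizer
  -- sum by a unit. The same condition reads $\sigma\circ w=e^{-1}\circ\rho$, so it is also a left
  -- multiple of the other.
  rw [← hy, Units.eq_mul_inv_iff_mul_eq, ← hx, cosetSum]
  refine Finset.sum_congr (Finset.filter_congr fun w _ => ?_) fun _ _ => rfl
  constructor
  · intro h
    funext k
    have := congrFun h (w k)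
    simp only [Function.comp, Equiv.Perm.coe_inv, Equiv.symm_apply_apply] at this
    simp [this]
  · intro h
    funext k
    have := congrFun h (w⁻¹ k)
    simp only [Function.comp, Equiv.Perm.coe_inv, Equiv.apply_symm_apply] at this
    simp [this]

end CosetSums

end HeckeAlgebra

/-! ### Changing letters in words -/

namespace HeckeAlgebra

section ShiftSums

variable {R : Type*} [CommRing R] (q : Rˣ) {n : ℕ} {ι : Type*} [LinearOrder ι]

/-- The number of pairs of a letter `p'` of `v` and a position in `K` that are in the order in
which `p'` and `p` are not. -/
def shiftStat (p p' : ι) (v : Fin n → ι) (K : Finset (Fin n)) : ℕ :=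
  (Finset.univ.filter fun x : Fin n × Fin n =>
    x.2 ∈ K ∧ v x.1 = p' ∧ (x.1 < x.2 ↔ p < p')).card

variable {ρ : Fin n → ι}

/-- The sum over all ways of changing `t` letters `p` of the word `v` into `p'`. -/
noncomputable def shiftSum (ρ : Fin n → ι) (p p' : ι) (t : ℕ) (v : Fin n → ι) :
    HeckeAlgebra R q n :=
  ∑ K ∈ (Finset.univ.filter fun k => v k = p).powersetCard t,
    (q : R) ^ shiftStat p p' v K • cosetSum q ρ (K.piecewise (fun _ => p') v)

variable {p p' : ι}

theorem piecewise_comp_simpleTransposition {κ : Type*} {p' : κ} (v : Fin n → κ) (K : Finset (Fin n))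
    (i : Fin (n - 1)) :
    (K.map (simpleTransposition i).toEmbedding).piecewise (fun _ => p')
      (v ∘ simpleTransposition i) = K.piecewise (fun _ => p') v ∘ simpleTransposition i := by
  funext k
  have : k ∈ K.map (simpleTransposition i).toEmbedding ↔ simpleTransposition i k ∈ K := by
    rw [Finset.mem_map_equiv, ← Equiv.Perm.coe_inv, simpleTransposition_inv]
  simp only [Finset.piecewise, Function.comp, this]

theorem shiftStat_map (v : Fin n → ι) (K : Finset (Fin n)) (i : Fin (n - 1)) :
    shiftStat p p' (v ∘ simpleTransposition i) (K.map (simpleTransposition i).toEmbedding) =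
      (Finset.univ.filter fun x : Fin n × Fin n => x.2 ∈ K ∧ v x.1 = p' ∧
        (simpleTransposition i x.1 < simpleTransposition i x.2 ↔ p < p')).card := by
  have hm : ∀ k, k ∈ K.map (simpleTransposition i).toEmbedding ↔ simpleTransposition i k ∈ K := by
    intro k
    rw [Finset.mem_map_equiv, ← Equiv.Perm.coe_inv, simpleTransposition_inv]
  refine Finset.card_bij'
    (fun x _ => (simpleTransposition i x.1, simpleTransposition i x.2))
    (fun x _ => (simpleTransposition i x.1, simpleTransposition i x.2)) ?_ ?_ ?_ ?_
  · intro x hx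
    simpa only [Finset.mem_filter, Finset.mem_univ, true_and, hm, Function.comp,
      simpleTransposition_apply_apply] using hx
  · intro x hx
    simpa only [Finset.mem_filter, Finset.mem_univ, true_and, hm, Function.comp,
      simpleTransposition_apply_apply] using hx
  · intro x _; simp
  · intro x _; simp

/-- A pair counted by `shiftStat` carries the letter `p'` at both places after overwriting, so
exchanging two different letters does not reverse any such pair. -/
theorem shiftStat_map_of_ne {v : Fin n → ι} {K : Finset (Fin n)} {i : Fin (n - 1)}
    (hK : ∀ k ∈ K, v k = p)
    (h : K.piecewise (fun _ => p') v (lower i) ≠ K.piecewise (fun _ => p') v (upper i))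
    (hpp : p ≠ p') :
    shiftStat p p' (v ∘ simpleTransposition i) (K.map (simpleTransposition i).toEmbedding) =
      shiftStat p p' v K := by
  rw [shiftStat_map, shiftStat]
  congr 1
  refine Finset.filter_congr ?_
  rintro ⟨l, k⟩ _
  simp only
  refine and_congr_right fun hk => and_congr_right fun hl => ?_
  have hlK : l ∉ K := fun hl' => hpp ((hK l hl').symm.trans hl)
  rw [simpleTransposition_lt_iff]
  · rintro ⟨rfl, rfl⟩
    simp [hk, hlK, hl] at h
  · rintro ⟨rfl, rfl⟩
    simp [hk, hlK, hl] at h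

/-- Different letters that become equal by overwriting are an original `p'` and a letter of `K`.
Their exchange adds exactly this pair, which accounts for the factor $q$ in
`cosetSum_mul_gen_of_eq`. -/
theorem shiftStat_map_of_eq {v : Fin n → ι} {K : Finset (Fin n)} {i : Fin (n - 1)}
    (hv : v (lower i) < v (upper i)) (hK : ∀ k ∈ K, v k = p)
    (h : K.piecewise (fun _ => p') v (lower i) = K.piecewise (fun _ => p') v (upper i)) :
    shiftStat p p' (v ∘ simpleTransposition i) (K.map (simpleTransposition i).toEmbedding) =
      shiftStat p p' v K + 1 := by
  classical
  obtain ⟨l₀, k₀, hlk, hk₀, hl₀K, hl₀⟩ : ∃ l₀ k₀ : Fin n,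
      ((l₀ = lower i ∧ k₀ = upper i) ∨ (k₀ = lower i ∧ l₀ = upper i)) ∧ k₀ ∈ K ∧ l₀ ∉ K ∧
        v l₀ = p' := by
    by_cases h1 : lower i ∈ K <;> by_cases h2 : upper i ∈ K
    · exact absurd hv (by rw [hK _ h1, hK _ h2]; exact lt_irrefl _)
    · refine ⟨upper i, lower i, Or.inr ⟨rfl, rfl⟩, h1, h2, ?_⟩
      simpa [h1, h2, eq_comm] using h
    · refine ⟨lower i, upper i, Or.inl ⟨rfl, rfl⟩, h2, h1, ?_⟩
      simpa [h1, h2] using h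
    · simp only [h1, h2, not_false_eq_true, Finset.piecewise_eq_of_notMem] at h
      exact absurd h hv.ne
  have hk₀v := hK _ hk₀
  have hlt : l₀ < k₀ ↔ p' < p := by
    rw [← hl₀, ← hk₀v]
    rcases hlk with ⟨rfl, rfl⟩ | ⟨rfl, rfl⟩
    · exact iff_of_true (lower_lt_upper i) hv
    · exact iff_of_false (lower_lt_upper i).not_gt hv.not_gt
  have hlt' : simpleTransposition i l₀ < simpleTransposition i k₀ ↔ p < p' := by
    rw [← hl₀, ← hk₀v]
    rcases hlk with ⟨rfl, rfl⟩ | ⟨rfl, rfl⟩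
    · simpa using iff_of_false (lower_lt_upper i).not_gt hv.not_gt
    · simpa using iff_of_true (lower_lt_upper i) hv
  have hpp : p ≠ p' := by
    rintro rfl
    rcases hlk with ⟨rfl, rfl⟩ | ⟨rfl, rfl⟩
    · exact hv.ne (hl₀.trans hk₀v.symm)
    · exact hv.ne (hk₀v.trans hl₀.symm)
  rw [shiftStat_map, shiftStat]
  rw [← Finset.card_erase_add_one (a := (l₀, k₀))
    (by simp only [Finset.mem_filter, Finset.mem_univ, true_and]; exact ⟨hk₀, hl₀, hlt'⟩)]
  congr 2
  ext ⟨l, k⟩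
  simp only [Finset.mem_erase, Finset.mem_filter, Finset.mem_univ, true_and, ne_eq, Prod.mk.injEq]
  have hex : ∀ l k, k ∈ K → v l = p' →
      ((l = lower i ∧ k = upper i) ∨ (k = lower i ∧ l = upper i)) → l = l₀ ∧ k = k₀ := by
    rintro l k hk hl (⟨rfl, rfl⟩ | ⟨rfl, rfl⟩) <;> rcases hlk with ⟨rfl, rfl⟩ | ⟨rfl, rfl⟩ <;>
      first
      | exact ⟨rfl, rfl⟩
      | exact absurd hk hl₀K
  constructor
  · rintro ⟨hne, hk, hl, hR⟩
    refine ⟨hk, hl, ?_⟩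
    rwa [simpleTransposition_lt_iff] at hR
    · exact fun h' => hne (hex l k hk hl (Or.inl h'))
    · exact fun h' => hne (hex l k hk hl (Or.inr h'))
  · rintro ⟨hk, hl, hR⟩
    have hne : ¬ (l = l₀ ∧ k = k₀) := by
      rintro ⟨rfl, rfl⟩
      rw [hlt] at hR
      rcases lt_or_gt_of_ne hpp with h' | h'
      · exact lt_asymm h' (hR.2 h')
      · exact lt_asymm h' (hR.1 h')
    refine ⟨hne, hk, hl, ?_⟩
    rwa [simpleTransposition_lt_iff]
    · rintro ⟨rfl, rfl⟩
      exact hne (hex _ _ hk hl (Or.inl ⟨rfl, rfl⟩))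
    · rintro ⟨rfl, rfl⟩
      exact hne (hex _ _ hk hl (Or.inr ⟨rfl, rfl⟩))

/-- No letter lies strictly between `p` and `p'`, so after overwriting, the ascent of `v` is still
an ascent or an equality. The two multiplication rules for `cosetSum` then match the two rules for
`shiftStat` term by term. -/
theorem shiftSum_mul_gen (hρ : Monotone ρ) (hp : p ⋖ p' ∨ p' ⋖ p) (t : ℕ) {v : Fin n → ι}
    {i : Fin (n - 1)} (hv : v (lower i) < v (upper i)) :
    shiftSum q ρ p p' t v * gen q i = shiftSum q ρ p p' t (v ∘ simpleTransposition i) := by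
  have hpp : p ≠ p' := hp.elim (fun h => h.lt.ne) fun h => h.lt.ne'
  have hset : (Finset.univ.filter fun k => (v ∘ simpleTransposition i) k = p) =
      (Finset.univ.filter fun k => v k = p).map (simpleTransposition i).toEmbedding := by
    ext k
    rw [Finset.mem_map_equiv, ← Equiv.Perm.coe_inv, simpleTransposition_inv]
    simp
  rw [shiftSum, shiftSum, hset, Finset.powersetCard_map, Finset.sum_map, Finset.sum_mul]
  refine Finset.sum_congr rfl fun K hK => ?_
  have hKp : ∀ k ∈ K, v k = p := fun k hk => by
    simpa using (Finset.mem_powersetCard.1 hK).1 hk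
  change _ = (q : R) ^ shiftStat p p' _ (K.map (simpleTransposition i).toEmbedding) •
    cosetSum q ρ ((K.map (simpleTransposition i).toEmbedding).piecewise (fun _ => p') _)
  rw [piecewise_comp_simpleTransposition, smul_mul_assoc]
  by_cases h : K.piecewise (fun _ => p') v (lower i) = K.piecewise (fun _ => p') v (upper i)
  · rw [shiftStat_map_of_eq hv hKp h, cosetSum_mul_gen_of_eq q h, smul_smul, ← pow_succ,
      comp_simpleTransposition_of_eq h]
  · rw [shiftStat_map_of_ne hKp h hpp, cosetSum_mul_gen_of_lt q hρ]
    refine lt_of_le_of_ne ?_ h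
    by_cases h1 : lower i ∈ K <;> by_cases h2 : upper i ∈ K
    · exact absurd hv (by rw [hKp _ h1, hKp _ h2]; exact lt_irrefl _)
    · have := hKp _ h1
      rw [this] at hv
      simp only [h1, h2, not_false_eq_true, Finset.piecewise_eq_of_notMem,
        Finset.piecewise_eq_of_mem]
      exact hp.elim (fun h => h.ge_of_gt hv) fun h => (h.lt.trans hv).le
    · have := hKp _ h2
      rw [this] at hv
      simp only [h1, h2, not_false_eq_true, Finset.piecewise_eq_of_notMem,
        Finset.piecewise_eq_of_mem]
      exact hp.elim (fun h => (hv.trans h.lt).le) fun h => h.le_of_lt hv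
    · simpa only [h1, h2, not_false_eq_true, Finset.piecewise_eq_of_notMem] using hv.le

theorem shiftStat_of_monotone {v : Fin n → ι} (hv : Monotone v) (hpp : p ≠ p')
    {K : Finset (Fin n)} (hK : ∀ k ∈ K, v k = p) : shiftStat p p' v K = 0 := by
  rw [shiftStat, Finset.card_eq_zero, Finset.filter_eq_empty_iff]
  rintro ⟨l, k⟩ _ ⟨hk, hl, hR⟩
  simp only at hk hl hR
  have hk' := hK k hk
  rcases lt_or_gt_of_ne hpp with h | h
  · exact absurd (hv (hR.2 h).le) (not_le.2 (by rw [hl, hk']; exact h))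
  · have : l < k := by
      by_contra hlk
      have := hv (not_lt.1 hlk)
      rw [hl, hk'] at this
      exact absurd h (not_lt.2 this)
    exact lt_asymm h (hR.1 this)

/-- For sorted `v` all weights are $1$, and the condition "some `t` letters `p` become `p'`" is
invariant under the stabilizer of `v`. Hence the sum runs over full cosets. -/
theorem exists_shiftSum_eq_mul (hpp : p ≠ p') (t : ℕ) {v : Fin n → ι} (hv : Monotone v) :
    ∃ h, shiftSum q ρ p p' t v = h * cosetSum q v v := by
  classical
  have hKp : ∀ K ∈ (Finset.univ.filter fun k => v k = p).powersetCard t, ∀ k ∈ K, v k = p :=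
    fun K hK k hk => by simpa using (Finset.mem_powersetCard.1 hK).1 hk
  let D : Finset (Equiv.Perm (Fin n)) :=
    ((Finset.univ.filter fun k => v k = p).powersetCard t).biUnion fun K =>
      Finset.univ.filter fun w : Equiv.Perm (Fin n) =>
        ρ ∘ (w⁻¹ : Equiv.Perm (Fin n)) = K.piecewise (fun _ => p') v
  have hsum : shiftSum q ρ p p' t v = ∑ w ∈ D, T q w := by
    rw [Finset.sum_biUnion, shiftSum]
    · refine Finset.sum_congr rfl fun K hK => ?_
      rw [shiftStat_of_monotone hv hpp (hKp K hK), pow_zero, one_smul, cosetSum]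
    · intro K hK K' hK' hne
      rw [Function.onFun, Finset.disjoint_filter]
      intro w _ h h'
      refine hne ?_
      -- The set `K` can be read off from `w`, so the cosets for different `K` are disjoint.
      have key : ∀ K ∈ (Finset.univ.filter fun k => v k = p).powersetCard t,
          ρ ∘ (w⁻¹ : Equiv.Perm (Fin n)) = K.piecewise (fun _ => p') v →
          K = Finset.univ.filter fun k => v k = p ∧ ρ (w⁻¹ k) = p' := by
        intro K hK h
        ext k
        have hk := congrFun h k
        simp only [Function.comp, Finset.piecewise] at hk
        simp only [Finset.mem_filter, Finset.mem_univ, true_and]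
        constructor
        · intro hkK
          exact ⟨hKp K hK k hkK, by simpa [hkK] using hk⟩
        · rintro ⟨h1, h2⟩
          by_contra hkK
          rw [if_neg hkK, h1, h2] at hk
          exact hpp hk.symm
      rw [key K hK h, ← key K' hK' h']
  rw [hsum]
  refine exists_sum_T_eq_mul_cosetSum q hv D ?_
  intro w hw w' hww'
  simp only [D, Finset.mem_biUnion, Finset.mem_filter, Finset.mem_univ, true_and] at hw ⊢
  obtain ⟨K, hK, hwK⟩ := hw
  have hst : ∀ k, v (w (w'⁻¹ k)) = v k := by
    intro k
    have := congrFun hww' (w'⁻¹ k)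
    simp only [Function.comp, Equiv.Perm.coe_inv, Equiv.apply_symm_apply] at this ⊢
    exact this.symm
  have hm : ∀ k, k ∈ K.map (w' * w⁻¹).toEmbedding ↔ w (w'⁻¹ k) ∈ K := by
    intro k
    rw [Finset.mem_map_equiv]
    rfl
  -- The permutation `w' * w⁻¹` fixes the word `v`, so it carries `K` to another set of `t`
  -- positions of `p`.
  refine ⟨K.map (w' * w⁻¹).toEmbedding, ?_, ?_⟩
  · rw [Finset.mem_powersetCard, Finset.card_map]
    refine ⟨?_, (Finset.mem_powersetCard.1 hK).2⟩
    intro k hk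
    have := hKp K hK _ ((hm k).1 hk)
    rw [hst] at this
    simpa using this
  · funext k
    have := congrFun hwK (w (w'⁻¹ k))
    simp only [Function.comp, Equiv.Perm.coe_inv, Equiv.symm_apply_apply] at this ⊢
    rw [this]
    simp only [Finset.piecewise, hm, Equiv.Perm.coe_inv]
    have := hst k
    rw [Equiv.Perm.coe_inv] at this
    rw [this]

/-- Every shift sum lies in the two-sided ideal generated by the stabilizer sum of the sorted
word. -/
theorem exists_shiftSum_eq_mul_mul (hρ : Monotone ρ) (hp : p ⋖ p' ∨ p' ⋖ p) (t : ℕ)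
    (v : Fin n → ι) :
    ∃ (v₀ : Fin n → ι) (u : Equiv.Perm (Fin n)) (h h' : HeckeAlgebra R q n),
      Monotone v₀ ∧ v₀ ∘ u = v ∧ shiftSum q ρ p p' t v = h * cosetSum q v₀ v₀ * h' := by
  have hpp : p ≠ p' := hp.elim (fun h => h.lt.ne) fun h => h.lt.ne'
  induction v using word_induction with
  | mono v hv =>
    obtain ⟨h, hh⟩ := exists_shiftSum_eq_mul q (ρ := ρ) hpp t hv
    exact ⟨v, 1, h, 1, hv, rfl, by rw [mul_one, hh]⟩
  | step v i hv ih =>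
    obtain ⟨v₀, u, h, h', hm, hu, hh⟩ := ih
    refine ⟨v₀, u * simpleTransposition i, h, h' * gen q i, hm, ?_, ?_⟩
    · rw [← hu]; rfl
    · rw [← shiftSum_mul_gen q hρ hp t hv, hh, mul_assoc]

end ShiftSums

end HeckeAlgebra

/-! ### Dominance and the ideal of higher terms -/

namespace WeakComposition

variable {n l : ℕ} (μ : WeakComposition n l)

theorem rowIndex_monotone : Monotone μ.rowIndex := fun _ _ h =>
  RowTableau.fst_finSigmaFinEquiv_symm_mono μ.part (by simpa using h)

theorem rowIndex_initialTableau (x : μ.Node) : μ.rowIndex (μ.initialTableau x) = x.1 := by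
  rw [rowIndex, Equiv.symm_apply_apply]

theorem card_rowIndex (r : Fin l) : Fintype.card {k // μ.rowIndex k = r} = μ.part r := by
  refine (Fintype.card_congr ((Equiv.subtypeEquiv μ.initialTableau.symm (fun c => Iff.rfl)).trans
    (Equiv.sigmaSubtype (α := Fin l) (β := fun j => Fin (μ.part j)) r))).trans ?_
  exact Fintype.card_fin _

theorem initialTableau_lt (x y : μ.Node) (h : x.1 < y.1) :
    μ.initialTableau x < μ.initialTableau y := by
  refine lt_of_not_ge fun hge => ?_
  have := μ.rowIndex_monotone hge
  rw [rowIndex_initialTableau, rowIndex_initialTableau] at this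
  exact absurd h (not_lt.2 this)

theorem initialTableau_strictMono (r : Fin l) :
    StrictMono fun c : Fin (μ.part r) => μ.initialTableau ⟨r, c⟩ := by
  intro c c' h
  rw [Fin.lt_def]
  simp only [initialTableau, Equiv.trans_apply, finCongr_apply_coe, finSigmaFinEquiv_apply]
  simpa using h

theorem initialTableau_isStandard : BijTableau.IsStandard μ.initialTableau :=
  ⟨μ.initialTableau_strictMono, fun x y h _ => μ.initialTableau_lt x y h⟩

/-- Among all sets of `j` parts of a partition, the first `j` have the largest sum. -/
theorem IsPartition.sum_le_partialSum {μ : WeakComposition n l} (hμ : μ.IsPartition)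
    (B : Finset (Fin l)) {j : ℕ} (hB : B.card ≤ j) : ∑ i ∈ B, μ.part i ≤ μ.partialSum j := by
  classical
  set C := (Finset.univ : Finset (Fin l)).filter (fun i : Fin l => i.val < j) with hC
  rw [partialSum, ← hC, ← Finset.sum_inter_add_sum_sdiff B C, ← Finset.sum_inter_add_sum_sdiff C B,
    Finset.inter_comm C B]
  refine Nat.add_le_add_left ?_ _
  by_cases hj : j < l
  · have hcard : C.card = j := by
      rw [hC]
      exact (Fin.card_filter_val_lt).trans (min_eq_right hj.le)
    have hle : (B \ C).card ≤ (C \ B).card := by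
      have h1 := Finset.card_sdiff_add_card_inter B C
      have h2 := Finset.card_sdiff_add_card_inter C B
      rw [Finset.inter_comm C B] at h2
      omega
    -- The part with index `j` separates the two sides: it bounds the parts outside `C` from above
    -- and those inside `C` from below.
    calc ∑ i ∈ B \ C, μ.part i ≤ (B \ C).card • μ.part ⟨j, hj⟩ :=
          Finset.sum_le_card_nsmul _ _ _ fun i hi => hμ (by
            simp only [hC, Finset.mem_sdiff, Finset.mem_filter, Finset.mem_univ, true_and,
              not_lt] at hi
            exact hi.2)
      _ ≤ (C \ B).card • μ.part ⟨j, hj⟩ := Nat.mul_le_mul_right _ hle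
      _ ≤ ∑ i ∈ C \ B, μ.part i := Finset.card_nsmul_le_sum _ _ _ fun i hi => hμ (by
            simp only [hC, Finset.mem_sdiff, Finset.mem_filter, Finset.mem_univ, true_and] at hi
            exact hi.1.le)
  · have : B \ C = ∅ := by
      ext i
      simp only [hC, Finset.mem_sdiff, Finset.mem_filter, Finset.mem_univ, true_and,
        Finset.notMem_empty, iff_false, not_and, not_lt]
      intro _
      have := i.2
      omega
    rw [this, Finset.sum_empty]
    exact Nat.zero_le _

/-- If the parts of `κ`, rearranged by `τ`, arise from a partition `lam` by moving `t > 0` nodes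
from row `r'` up to row `r`, then the parts of `κ` form a partition that strictly dominates
`lam`. -/
theorem exists_strictlyDominates {lam κ : WeakComposition n l} (τ : Equiv.Perm (Fin l))
    {r r' : Fin l} (hrr : r < r') {t : ℕ} (ht : 0 < t) (hr : κ.part (τ r) = lam.part r + t)
    (hr' : κ.part (τ r') + t = lam.part r')
    (hne : ∀ i, i ≠ r → i ≠ r' → κ.part (τ i) = lam.part i) :
    ∃ (μ : WeakComposition n l) (e : Equiv.Perm (Fin l)), μ.IsPartition ∧
      (∀ i, μ.part i = κ.part (e i)) ∧ μ.StrictlyDominates lam := by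
  let e := Tuple.sort (OrderDual.toDual ∘ κ.part)
  let μ : WeakComposition n l := ⟨κ.part ∘ e, (Equiv.sum_comp e κ.part).trans κ.sum_part⟩
  have hμ : μ.IsPartition := fun i j hij =>
    Tuple.monotone_sort (OrderDual.toDual ∘ κ.part) hij
  -- The first `j` rows correspond under `τ` to `j` parts of `κ`, whose sum is at most that of the
  -- `j` largest parts. Since `r < r'`, this gives dominance, and at `j = r + 1` only the left
  -- correction is present, which gives strictness.
  have hsum : ∀ j : ℕ, lam.partialSum j + (if r.val < j then t else 0) ≤
      μ.partialSum j + (if r'.val < j then t else 0) := by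
    intro j
    have h1 : ∑ i ∈ Finset.univ.filter (fun i : Fin l => i.val < j), κ.part (τ i) ≤
        μ.partialSum j := by
      have h2 := hμ.sum_le_partialSum (j := j)
        ((Finset.univ.filter (fun i : Fin l => i.val < j)).map (τ.trans e.symm).toEmbedding)
        (by rw [Finset.card_map]; exact Fin.card_filter_val_lt.trans_le (min_le_right _ _))
      rw [Finset.sum_map] at h2
      simpa [μ] using h2
    have h3 : ∑ i ∈ Finset.univ.filter (fun i : Fin l => i.val < j),
        (κ.part (τ i) + if r' = i then t else 0) =
        ∑ i ∈ Finset.univ.filter (fun i : Fin l => i.val < j),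
        (lam.part i + if r = i then t else 0) := by
      refine Finset.sum_congr rfl fun i _ => ?_
      by_cases h4 : r = i
      · subst h4; simp [hrr.ne', hr]
      by_cases h5 : r' = i
      · subst h5; simp [hrr.ne, hr']
      simp [h4, h5, hne i (Ne.symm h4) (Ne.symm h5)]
    rw [Finset.sum_add_distrib, Finset.sum_add_distrib, Finset.sum_ite_eq, Finset.sum_ite_eq] at h3
    simp only [Finset.mem_filter, Finset.mem_univ, true_and] at h3
    rw [partialSum]
    omega
  refine ⟨μ, e, hμ, fun _ => rfl, fun j => ?_, fun h => ?_⟩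
  · have := hsum j
    have : r.val < r'.val := hrr
    split_ifs at * <;> omega
  · have h1 := hsum (r.val + 1)
    have h2 := h (r.val + 1)
    have : r.val < r'.val := hrr
    rw [if_pos (by omega), if_neg (by omega)] at h1
    omega

end WeakComposition

namespace HeckeAlgebra

variable {R : Type*} [CommRing R] (q : Rˣ) {n a : ℕ}

theorem mElt_eq_cosetSum (μ : WeakComposition n a) :
    mElt q μ = cosetSum q μ.rowIndex μ.rowIndex := by
  rw [mElt, cosetSum]
  refine Finset.sum_congr ?_ fun _ _ => rfl
  ext w
  simp only [youngSubgroup, Finset.mem_filter, Finset.mem_univ, true_and]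
  constructor
  · intro h
    funext k
    have := h (w⁻¹ k)
    simpa using this.symm
  · intro h k
    have := congrFun h (w k)
    simpa using this.symm

theorem mul_mem_higherIdeal {lam : WeakComposition n a} {x : HeckeAlgebra R q n}
    (hx : x ∈ higherIdeal q lam) (y : HeckeAlgebra R q n) : x * y ∈ higherIdeal q lam :=
  (higherIdeal q lam).smul_mem (MulOpposite.op y) hx

theorem mElt_mem_higherIdeal {lam : WeakComposition n a} {l : ℕ} {μ : WeakComposition n l}
    (hμ : μ.IsPartition) (h : μ.StrictlyDominates lam) (x : HeckeAlgebra R q n) :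
    x * mElt q μ ∈ higherIdeal q lam := by
  refine Submodule.subset_span
    ⟨l, μ, μ.initialTableau, μ.initialTableau, x, hμ, h, μ.initialTableau_isStandard,
      μ.initialTableau_isStandard, ?_⟩
  have : BijTableau.d μ.initialTableau = 1 := Equiv.symm_trans_self _
  rw [murphy, this, T_one, mul_one]
  simp [heckeStar]

theorem exists_comp_eq_of_card_eq {α ι : Type*} [Fintype α] [DecidableEq ι] {f g : α → ι}
    (h : ∀ c, Fintype.card {k // f k = c} = Fintype.card {k // g k = c}) :
    ∃ u : Equiv.Perm α, f ∘ u = g := by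
  have e : ∀ c, Nonempty ({k // g k = c} ≃ {k // f k = c}) := fun c =>
    Fintype.card_eq.1 (h c).symm
  refine ⟨Equiv.ofFiberEquiv (fun c => (e c).some), ?_⟩
  funext k
  exact Equiv.ofFiberEquiv_map _ k

theorem card_fiber_comp_perm {α ι : Type*} [Fintype α] [DecidableEq ι] (f : α → ι)
    (u : Equiv.Perm α) (c : ι) :
    Fintype.card {k // (f ∘ u) k = c} = Fintype.card {k // f k = c} :=
  Fintype.card_congr (Equiv.subtypeEquiv u fun _ => Iff.rfl)

/-- Shift sums between two adjacent rows vanish in the Specht module. -/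
theorem shiftSum_mem_higherIdeal {lam : WeakComposition n a} (τ : Equiv.Perm (Fin a))
    (hτ : ∀ i, lam.part (τ i) = lam.part i) {r r' : Fin a} (hrr : r < r')
    (hp : τ r ⋖ τ r' ∨ τ r' ⋖ τ r) {t : ℕ} (ht : 0 < t) (v : Fin n → Fin a) :
    shiftSum q lam.rowIndex (τ r) (τ r') t v ∈ higherIdeal q lam := by
  classical
  have hpp : τ r ≠ τ r' := fun h => hrr.ne (τ.injective h)
  -- If no overwritten word is a rearrangement of `lam.rowIndex`, all coset sums in the shift sum
  -- are empty. Otherwise one such `K` determines the letter counts of `v`, and these form the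
  -- composition `κ` below.
  by_cases hK : ∃ K ∈ (Finset.univ.filter fun k => v k = τ r).powersetCard t,
      ∃ u : Equiv.Perm (Fin n), lam.rowIndex ∘ u = K.piecewise (fun _ => τ r') v
  · obtain ⟨K, hK, u, hu⟩ := hK
    obtain ⟨v₀, u₀, h, h', hm, hu₀, hh⟩ :=
      exists_shiftSum_eq_mul_mul q lam.rowIndex_monotone hp t v
    rw [Finset.mem_powersetCard] at hK
    let κ : WeakComposition n a := ⟨fun i => Fintype.card {k // v k = i}, by
      rw [← Fintype.card_sigma, Fintype.card_congr (Equiv.sigmaFiberEquiv v), Fintype.card_fin]⟩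
    have hcard : ∀ i, (Finset.univ.filter fun k => K.piecewise (fun _ => τ r') v k = i).card =
        lam.part i := by
      intro i
      rw [← Fintype.card_subtype, ← hu, card_fiber_comp_perm, card_rowIndex]
    have hκ : ∀ i, κ.part i = (Finset.univ.filter fun k => v k = i).card := fun i =>
      Fintype.card_subtype fun k => v k = i
    have hKp : ∀ k ∈ K, v k = τ r := fun k hk => by simpa using hK.1 hk
    obtain ⟨μ, e, hμ, hμe, hdom⟩ := exists_strictlyDominates (lam := lam) (κ := κ) τ hrr ht
      (by
        rw [← hτ, ← hcard (τ r), hκ, ← hK.2, ← Finset.card_union_of_disjoint]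
        · congr 1
          ext k
          simp only [Finset.mem_union, Finset.mem_filter, Finset.mem_univ, true_and,
            Finset.piecewise]
          by_cases hk : k ∈ K
          · simp [hk, hKp k hk]
          · simp [hk]
        · rw [Finset.disjoint_left]
          intro k hk hkK
          simp [hkK, hpp.symm] at hk)
      (by
        rw [← hτ, ← hcard (τ r'), hκ, ← hK.2, ← Finset.card_union_of_disjoint]
        · congr 1
          ext k
          simp only [Finset.mem_union, Finset.mem_filter, Finset.mem_univ, true_and,
            Finset.piecewise]
          by_cases hk : k ∈ K
          · simp [hk]
          · simp [hk]
        · rw [Finset.disjoint_left]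
          intro k hk hkK
          simp only [Finset.mem_filter, Finset.mem_univ, true_and] at hk
          exact hpp ((hKp k hkK).symm.trans hk))
      (by
        intro i hi hi'
        rw [← hτ, ← hcard (τ i), hκ]
        congr 1
        ext k
        simp only [Finset.mem_filter, Finset.mem_univ, true_and, Finset.piecewise]
        by_cases hk : k ∈ K
        · simp [hk, hKp k hk, Ne.symm hi, Ne.symm hi']
        · simp [hk])
    -- The sorted word `v₀` has content `κ`, hence is a rearrangement of the row word of $\mathfrak
    -- t^\mu$ with its letters renamed by `e`.
    obtain ⟨u', hu'⟩ : ∃ u' : Equiv.Perm (Fin n), v₀ ∘ u' = e ∘ μ.rowIndex := by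
      refine exists_comp_eq_of_card_eq fun c => ?_
      rw [← card_fiber_comp_perm v₀ u₀, hu₀]
      change κ.part c = _
      rw [← e.apply_symm_apply c, ← hμe, ← card_rowIndex]
      exact Fintype.card_congr (Equiv.subtypeEquivRight fun k => by simp [Equiv.eq_symm_apply])
    obtain ⟨x, x', hx⟩ := exists_cosetSum_eq_mul_mul q hm μ.rowIndex_monotone e u' hu'
    rw [hh, hx, ← mElt_eq_cosetSum, ← mul_assoc, ← mul_assoc, mul_assoc _ x' h']
    exact mul_mem_higherIdeal q (mElt_mem_higherIdeal q hμ hdom _) _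
  · push Not at hK
    rw [shiftSum, Finset.sum_eq_zero]
    · exact Submodule.zero_mem _
    · intro K hK'
      rw [cosetSum, Finset.filter_eq_empty_iff.2, Finset.sum_empty, smul_zero]
      intro w _ hw
      exact hK K hK' w⁻¹ hw

end HeckeAlgebra

/-! ### Identities for Gaussian binomial coefficients -/

section GaussianBinomials

variable {R : Type*} [CommRing R] (x : R)

theorem qBinomial_zero_right (m : ℕ) : qBinomial x m 0 = 1 := by
  cases m <;> rfl

theorem qBinomial_succ_succ (m k : ℕ) :
    qBinomial x (m + 1) (k + 1) = qBinomial x m k + x ^ (k + 1) * qBinomial x m (k + 1) := rfl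

theorem qBinomial_succ_succ' (m k : ℕ) (h : k ≤ m) :
    qBinomial x (m + 1) (k + 1) = qBinomial x m (k + 1) + x ^ (m - k) * qBinomial x m k := by
  induction m generalizing k with
  | zero =>
    obtain rfl : k = 0 := by omega
    simp [qBinomial]
  | succ m ih =>
    rcases h.lt_or_eq with h | rfl
    · rw [qBinomial_succ_succ x (m + 1) k]
      cases k with
      | zero =>
        have h1 := ih 0 (by omega)
        have h2 := qBinomial_succ_succ x m 0
        simp only [qBinomial_zero_right, Nat.sub_zero, zero_add, pow_one, mul_one] at h1 h2 ⊢
        linear_combination x * h1 - h2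
      | succ k =>
        have h1 := ih k (by omega)
        have h2 := ih (k + 1) (by omega)
        have h3 := qBinomial_succ_succ x m k
        have h4 := qBinomial_succ_succ x m (k + 1)
        obtain ⟨c, rfl⟩ : ∃ c, m = k + 1 + c := ⟨m - (k + 1), by omega⟩
        have e1 : k + 1 + c - k = c + 1 := by omega
        have e2 : k + 1 + c - (k + 1) = c := by omega
        have e3 : k + 1 + c + 1 - (k + 1) = c + 1 := by omega
        rw [e1] at h1
        rw [e2] at h2
        rw [e3]
        linear_combination h1 + x ^ (k + 2) * h2 - h4 - x ^ (c + 1) * h3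
    · rw [qBinomial_self, qBinomial_eq_zero x (m + 1) _ (by omega), qBinomial_self]
      simp

theorem qBinomial_symm (m k : ℕ) (h : k ≤ m) : qBinomial x m (m - k) = qBinomial x m k := by
  induction m generalizing k with
  | zero =>
    obtain rfl : k = 0 := by omega
    rfl
  | succ m ih =>
    cases k with
    | zero => simp [qBinomial_zero_right, qBinomial_self]
    | succ k =>
      rcases (Nat.le_of_succ_le_succ h).lt_or_eq with h' | rfl
      · obtain ⟨c, rfl⟩ : ∃ c, m = k + 1 + c := ⟨m - (k + 1), by omega⟩
        have e : k + 1 + c + 1 - (k + 1) = c + 1 := by omega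
        have h1 := ih k (by omega)
        have h2 := ih (k + 1) (by omega)
        have e1 : k + 1 + c - k = c + 1 := by omega
        have e2 : k + 1 + c - (k + 1) = c := by omega
        have e3 : k + 1 + c - c = k + 1 := by omega
        rw [e1] at h1
        rw [e2] at h2
        rw [e, qBinomial_succ_succ' x _ c (by omega), qBinomial_succ_succ, h1, h2, e3]
      · simp [qBinomial_zero_right, qBinomial_self]

/-- The $q$-binomial theorem for $\prod_{k<e}(1-x^k)$. For positive `e`, Pascal's rule gives each
partial sum in closed form, and the full sum contains a binomial $\left[{e-1\atop e}\right]=0$. -/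
theorem sum_neg_one_pow_qBinomial (e : ℕ) :
    ∑ j ∈ Finset.range (e + 1), (-1) ^ j * x ^ (j.choose 2) * qBinomial x e j =
      if e = 0 then 1 else 0 := by
  cases e with
  | zero => simp [qBinomial]
  | succ e =>
    rw [if_neg (Nat.succ_ne_zero e)]
    have key : ∀ m : ℕ, ∑ j ∈ Finset.range (m + 1),
        (-1) ^ j * x ^ (j.choose 2) * qBinomial x (e + 1) j =
          (-1) ^ m * x ^ ((m + 1).choose 2) * qBinomial x e m := by
      intro m
      induction m with
      | zero => simp [qBinomial_zero_right]
      | succ m ih =>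
        rw [Finset.sum_range_succ, ih, qBinomial_succ_succ]
        have : (m + 1 + 1).choose 2 = (m + 1).choose 2 + (m + 1) := by
          rw [Nat.choose_succ_succ' (m + 1) 1, Nat.choose_one_right, add_comm]
        rw [this]
        ring
    rw [key, qBinomial_eq_zero x e (e + 1) (by omega), mul_zero]

/-- Expansion of $u^f$ in the products $\prod_{k<l}(u-x^k)$; the induction multiplies each of them
by $u=(u-x^l)+x^l$. -/
theorem sum_qBinomial_mul_prod (u : R) (f : ℕ) :
    ∑ l ∈ Finset.range (f + 1), qBinomial x f l * ∏ k ∈ Finset.range l, (u - x ^ k) = u ^ f := by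
  induction f with
  | zero => simp [qBinomial]
  | succ f ih =>
    rw [Finset.sum_range_succ']
    simp only [qBinomial_succ_succ, add_mul, Finset.sum_add_distrib, qBinomial_zero_right,
      Finset.prod_range_zero, mul_one]
    have h1 : ∑ l ∈ Finset.range (f + 1), x ^ (l + 1) * qBinomial x f (l + 1) *
        ∏ k ∈ Finset.range (l + 1), (u - x ^ k) + 1 =
        ∑ l ∈ Finset.range (f + 1), x ^ l * qBinomial x f l *
          ∏ k ∈ Finset.range l, (u - x ^ k) := by
      have := Finset.sum_range_succ' (fun l => x ^ l * qBinomial x f l *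
          ∏ k ∈ Finset.range l, (u - x ^ k)) (f + 1)
      rw [Finset.sum_range_succ, qBinomial_eq_zero x f (f + 1) (by omega)] at this
      simp only [mul_zero, zero_mul, add_zero, pow_zero, qBinomial_zero_right,
        Finset.prod_range_zero, mul_one] at this
      exact this.symm
    rw [add_assoc, h1, ← Finset.sum_add_distrib, pow_succ, ← ih, Finset.sum_mul]
    refine Finset.sum_congr rfl fun l _ => ?_
    rw [Finset.prod_range_succ]
    ring

end GaussianBinomials

/-! ### Counting subsets by crossings -/

namespace HeckeAlgebra

section Crossings

section Content

variable {α γ : Type*} [DecidableEq γ]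

/-- The number of elements of `K` in the block `i`. -/
def content (σ : α → γ) (K : Finset α) (i : γ) : ℕ := (K.filter fun k => σ k = i).card

theorem content_insert [DecidableEq α] (σ : α → γ) {K : Finset α} {m : α} (hm : m ∉ K) :
    content σ (insert m K) = Function.update (content σ K) (σ m) (content σ K (σ m) + 1) := by
  funext i
  rw [content, Finset.filter_insert]
  by_cases hi : σ m = i
  · subst hi
    rw [if_pos rfl, Finset.card_insert_of_notMem (by simp [hm]), Function.update_self, content]
  · rw [if_neg hi, Function.update_of_ne (Ne.symm hi), content]

theorem sum_content [Fintype γ] (σ : α → γ) (K : Finset α) : ∑ i, content σ K i = K.card :=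
  (Finset.card_eq_sum_card_fiberwise fun k _ => Finset.mem_coe.2 (Finset.mem_univ (σ k))).symm

theorem content_mono (σ : α → γ) {K L : Finset α} (h : K ⊆ L) (i : γ) :
    content σ K i ≤ content σ L i :=
  Finset.card_le_card (Finset.filter_subset_filter _ h)

theorem content_sdiff [DecidableEq α] (σ : α → γ) {K L : Finset α} (h : K ⊆ L) (i : γ) :
    content σ (L \ K) i = content σ L i - content σ K i := by
  have : (L \ K).filter (fun k => σ k = i) =
      L.filter (fun k => σ k = i) \ K.filter (fun k => σ k = i) := by
    ext k
    simp only [Finset.mem_filter, Finset.mem_sdiff]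
    tauto
  rw [content, this, Finset.card_sdiff_of_subset (Finset.filter_subset_filter _ h)]
  rfl

end Content

variable {R : Type*} [CommRing R] (x : R)

/-- The weighted number of ways of choosing `h i` out of `c i` elements in consecutive blocks. -/
def blockCoeff {γ : Type*} [Fintype γ] [LinearOrder γ] (c h : γ → ℕ) : R :=
  x ^ (∑ i, h i * ∑ j with j < i, (c j - h j)) * ∏ i, qBinomial x (c i) (h i)

section

variable {γ : Type*} [Fintype γ] [LinearOrder γ]

theorem blockCoeff_eq_zero {c h : γ → ℕ} {i : γ} (hi : c i < h i) : blockCoeff x c h = 0 := by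
  rw [blockCoeff, Finset.prod_eq_zero (Finset.mem_univ i) (qBinomial_eq_zero x _ _ hi), mul_zero]

theorem blockCoeff_exponent_update {c h : γ → ℕ} {i₀ : γ} (hle : h i₀ ≤ c i₀)
    (hh : ∀ i < i₀, h i = 0) :
    ∑ i, h i * ∑ j with j < i, (Function.update c i₀ (c i₀ + 1) j - h j) + h i₀ =
      ∑ i, h i * ∑ j with j < i, (c j - h j) + ∑ i, h i := by
  have h1 : ∀ i, ∑ j with j < i, (Function.update c i₀ (c i₀ + 1) j - h j) =
      ∑ j with j < i, (c j - h j) + if i₀ < i then 1 else 0 := by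
    intro i
    have : ∀ j, Function.update c i₀ (c i₀ + 1) j - h j = c j - h j + if i₀ = j then 1 else 0 := by
      intro j
      by_cases hj : i₀ = j
      · subst hj; simp; omega
      · simp [hj, Ne.symm hj]
    simp only [this, Finset.sum_add_distrib, Finset.sum_ite_eq, Finset.mem_filter,
      Finset.mem_univ, true_and]
  simp only [h1, mul_add, Finset.sum_add_distrib, add_assoc, mul_ite, mul_one, mul_zero]
  congr 1
  have h2 : h i₀ = ∑ i, if i₀ = i then h i else 0 := by simp
  rw [h2, ← Finset.sum_add_distrib]
  refine Finset.sum_congr rfl fun i _ => ?_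
  rcases lt_trichotomy i i₀ with hi | hi | hi
  · simp [hh i hi]
  · simp [hi]
  · simp [hi, hi.ne]

theorem blockCoeff_update_of_eq_zero {c h : γ → ℕ} {i₀ : γ} (hc : ∀ i < i₀, c i = 0)
    (h0 : h i₀ = 0) :
    blockCoeff x (Function.update c i₀ (c i₀ + 1)) h = x ^ (∑ i, h i) * blockCoeff x c h := by
  by_cases hh : ∀ i < i₀, h i = 0
  · have := blockCoeff_exponent_update (c := c) (h := h) (i₀ := i₀) (by omega) hh
    rw [h0, add_zero] at this
    rw [blockCoeff, blockCoeff, this, ← mul_assoc, ← pow_add, add_comm (∑ i, h i)]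
    congr 1
    refine Finset.prod_congr rfl fun i _ => ?_
    by_cases hi : i = i₀
    · subst hi; rw [h0, qBinomial_zero_right, qBinomial_zero_right]
    · rw [Function.update_of_ne hi]
  · push Not at hh
    obtain ⟨i, hi, hne⟩ := hh
    have h1 := hc i hi
    rw [blockCoeff_eq_zero x (i := i), blockCoeff_eq_zero x (i := i), mul_zero]
    · omega
    · rw [Function.update_of_ne hi.ne]; omega

/-- The recursion for a new smallest element in block `i₀`. Left unchosen, it precedes every chosen
element and contributes $x^{\sum h_i}$; chosen, it creates no crossing and lowers `h i₀` by one. -/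
theorem blockCoeff_update_of_eq_succ {c h : γ → ℕ} {i₀ : γ} (hc : ∀ i < i₀, c i = 0) {k : ℕ}
    (hk : h i₀ = k + 1) :
    blockCoeff x (Function.update c i₀ (c i₀ + 1)) h =
      x ^ (∑ i, h i) * blockCoeff x c h + blockCoeff x c (Function.update h i₀ k) := by
  by_cases hh : ∀ i < i₀, h i = 0
  · have hE : ∑ i, h i * ∑ j with j < i, (Function.update c i₀ (c i₀ + 1) j - h j) =
        ∑ i, Function.update h i₀ k i * ∑ j with j < i, (c j - Function.update h i₀ k j) := by
      refine Finset.sum_congr rfl fun i _ => ?_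
      have h1 : ∀ j, Function.update c i₀ (c i₀ + 1) j - h j =
          c j - Function.update h i₀ k j := by
        intro j
        by_cases hj : j = i₀
        · subst hj; simp; omega
        · simp [hj]
      simp only [h1]
      by_cases hi : i = i₀
      · subst hi
        rw [Finset.sum_eq_zero, mul_zero, mul_zero]
        intro j hj
        simp only [Finset.mem_filter, Finset.mem_univ, true_and] at hj
        rw [hc j hj, Nat.zero_sub]
      · rw [Function.update_of_ne hi]
    have hQ : ∀ c' h' : γ → ℕ, (∀ i, i ≠ i₀ → c' i = c i) → (∀ i, i ≠ i₀ → h' i = h i) →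
        ∏ i, qBinomial x (c' i) (h' i) = qBinomial x (c' i₀) (h' i₀) *
          ∏ i ∈ Finset.univ.erase i₀, qBinomial x (c i) (h i) := by
      intro c' h' h1 h2
      rw [← Finset.mul_prod_erase _ _ (Finset.mem_univ i₀)]
      congr 1
      refine Finset.prod_congr rfl fun i hi => ?_
      rw [h1 i (Finset.ne_of_mem_erase hi), h2 i (Finset.ne_of_mem_erase hi)]
    rw [blockCoeff, blockCoeff, blockCoeff, ← hE,
      hQ _ h (fun i hi => Function.update_of_ne hi _ _) (fun _ _ => rfl),
      hQ c h (fun _ _ => rfl) (fun _ _ => rfl),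
      hQ c _ (fun _ _ => rfl) (fun i hi => Function.update_of_ne hi _ _)]
    simp only [Function.update_self, hk, qBinomial_succ_succ]
    by_cases hle : k + 1 ≤ c i₀
    · have := blockCoeff_exponent_update (c := c) (h := h) (i₀ := i₀) (by omega) hh
      rw [hk] at this
      rw [← mul_assoc (x ^ (∑ i, h i)), ← pow_add, add_comm (∑ i, h i), ← this, pow_add]
      ring
    · rw [qBinomial_eq_zero x (c i₀) (k + 1) (by omega)]
      ring
  · push Not at hh
    obtain ⟨i, hi, hne⟩ := hh
    have h1 := hc i hi
    rw [blockCoeff_eq_zero x (i := i), blockCoeff_eq_zero x (i := i),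
      blockCoeff_eq_zero x (i := i), mul_zero, add_zero]
    · rw [Function.update_of_ne hi.ne]; omega
    · omega
    · rw [Function.update_of_ne hi.ne]; omega

end

variable {α : Type*} [LinearOrder α]

/-- The number of pairs `a < b` with `a ∈ A` and `b ∈ B`. -/
def cross (A B : Finset α) : ℕ := ∑ a ∈ A, ∑ b ∈ B, if a < b then 1 else 0

theorem cross_union_left {A A' : Finset α} (h : Disjoint A A') (B : Finset α) :
    cross (A ∪ A') B = cross A B + cross A' B := Finset.sum_union h

theorem cross_union_right (A : Finset α) {B B' : Finset α} (h : Disjoint B B') :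
    cross A (B ∪ B') = cross A B + cross A B' := by
  simp only [cross, Finset.sum_union h, Finset.sum_add_distrib]

variable {γ : Type*} [Fintype γ] [LinearOrder γ]

/-- Within a block the crossings are counted by a Gaussian binomial. Between two blocks, every
unchosen element of the earlier one crosses every chosen element of the later one, which is the
exponent in `blockCoeff`. -/
theorem sum_pow_cross {σ : α → γ} (hσ : Monotone σ) (L : Finset α) (h : γ → ℕ) :
    ∑ K ∈ L.powerset with content σ K = h, x ^ cross (L \ K) K =
      blockCoeff x (content σ L) h := by
  induction L using Finset.induction_on_min generalizing h with
  | empty =>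
    rw [Finset.powerset_empty, Finset.sum_filter, Finset.sum_singleton]
    have h0 : content σ ∅ = 0 := by funext i; simp [content]
    rw [h0]
    split_ifs with hh
    · subst hh
      simp [cross, blockCoeff, qBinomial]
    · obtain ⟨i, hi⟩ := Function.ne_iff.1 hh
      rw [blockCoeff_eq_zero x (i := i)]
      exact Nat.pos_of_ne_zero (Ne.symm hi)
  | insert m L hm ih =>
    have hmL : m ∉ L := fun h => lt_irrefl _ (hm m h)
    have hc : ∀ i < σ m, content σ L i = 0 := by
      intro i hi
      rw [content, Finset.card_eq_zero, Finset.filter_eq_empty_iff]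
      rintro k hk rfl
      exact absurd (hσ (hm k hk).le) (not_le.2 hi)
    rw [Finset.sum_filter, Finset.sum_powerset_insert hmL, content_insert σ hmL]
    have e1 : ∑ K ∈ L.powerset, (if content σ K = h then x ^ cross (insert m L \ K) K else 0) =
        x ^ (∑ i, h i) * blockCoeff x (content σ L) h := by
      rw [← ih h, Finset.sum_filter, Finset.mul_sum]
      refine Finset.sum_congr rfl fun K hK => ?_
      rw [Finset.mem_powerset] at hK
      split_ifs with hh
      · rw [← pow_add, ← hh, sum_content, Finset.insert_sdiff_of_notMem _ (fun h => hmL (hK h)),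
          Finset.insert_eq, cross_union_left (by simp [hmL])]
        congr 2
        rw [cross, Finset.sum_singleton, Finset.sum_ite, Finset.sum_const_zero, add_zero,
          Finset.sum_const, smul_eq_mul, mul_one, Finset.filter_true_of_mem]
        exact fun k hk => hm k (hK hk)
      · rw [mul_zero]
    have e2 : ∀ K ∈ L.powerset, cross (insert m L \ insert m K) (insert m K) =
        cross (L \ K) K := by
      intro K hK
      rw [Finset.mem_powerset] at hK
      rw [Finset.insert_sdiff_insert, Finset.sdiff_insert_of_notMem hmL, Finset.insert_eq,
        cross_union_right _ (by simpa using fun h => hmL (hK h)), Nat.add_eq_right, cross]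
      refine Finset.sum_eq_zero fun k hk => ?_
      rw [Finset.sum_singleton, if_neg]
      exact (hm k (Finset.mem_sdiff.1 hk).1).not_gt
    have e3 : ∀ K ∈ L.powerset, content σ (insert m K) =
        Function.update (content σ K) (σ m) (content σ K (σ m) + 1) := by
      intro K hK
      rw [Finset.mem_powerset] at hK
      exact content_insert σ fun h => hmL (hK h)
    rw [e1]
    rcases Nat.eq_zero_or_eq_succ_pred (h (σ m)) with h0 | hk
    · rw [blockCoeff_update_of_eq_zero x hc h0]
      refine add_eq_left.2 (Finset.sum_eq_zero fun K hK => ?_)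
      rw [if_neg]
      rintro rfl
      rw [e3 K hK, Function.update_self] at h0
      omega
    · rw [blockCoeff_update_of_eq_succ x hc hk, ← ih (Function.update h (σ m) _), Finset.sum_filter]
      congr 1
      refine Finset.sum_congr rfl fun K hK => ?_
      rw [e2 K hK, e3 K hK]
      congr 1
      apply propext
      constructor
      · rintro rfl
        simp
      · intro hK'
        rw [hK', Function.update_self, ← Nat.succ_eq_add_one, ← hk, Function.update_idem,
          Function.update_eq_self]

end Crossings

end HeckeAlgebra

/-! ### Straightening sums of words -/

namespace HeckeAlgebra

section Coefficients

variable {R : Type*} [CommRing R] (x : R)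

/-- The coefficients with which shift sums are combined in `sum_straightCoeff_smul`. -/
def straightCoeff (s j l : ℕ) : R :=
  (-1) ^ j * x ^ (j.choose 2) * x ^ (l * j) * ∏ k ∈ Finset.range l, (x ^ (s - 1 - j) - x ^ k)

/-- The factor with `k = l - 1 = s - 1 - j` vanishes. This is why, among the sets of full size `s`,
only those inside block `d` survive. -/
theorem straightCoeff_eq_zero {s j l : ℕ} (h : j + l = s) (hl : l ≠ 0) :
    straightCoeff x s j l = 0 := by
  rw [straightCoeff, Finset.prod_eq_zero (i := s - 1 - j) (Finset.mem_range.2 (by omega))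
    (sub_self _), mul_zero]

theorem straightCoeff_zero_right (s j : ℕ) :
    straightCoeff x s j 0 = (-1) ^ j * x ^ (j.choose 2) := by
  simp [straightCoeff]

/-- The sum over `l` is `sum_qBinomial_mul_prod` at $u=x^{s-1-j}$ and gives $x^{(s-1)f}$,
independent of `j`; the alternating sum over `j` then kills every `e > 0`. -/
theorem sum_straightCoeff_mul {s e f : ℕ} (h : e + f ≤ s) :
    ∑ j ∈ Finset.range (e + 1), ∑ l ∈ Finset.range (f + 1),
      straightCoeff x s j l * (x ^ ((f - l) * j) * (qBinomial x e j * qBinomial x f l)) =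
      if e = 0 then x ^ ((s - 1) * f) else 0 := by
  have h1 : ∀ j ∈ Finset.range (e + 1), ∑ l ∈ Finset.range (f + 1),
      straightCoeff x s j l * (x ^ ((f - l) * j) * (qBinomial x e j * qBinomial x f l)) =
      (-1) ^ j * x ^ (j.choose 2) * qBinomial x e j * x ^ ((s - 1) * f) := by
    intro j hj
    rw [Finset.mem_range] at hj
    have h2 : x ^ ((s - 1) * f) = x ^ (f * j) * (x ^ (s - 1 - j)) ^ f := by
      rw [← pow_mul, ← pow_add]
      -- The truncated difference `s - 1 - j` is genuine unless `j ≥ s`, and then `j ≤ e` and `e + f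
      -- ≤ s` force `f = 0`.
      rcases Nat.lt_or_ge j s with hjs | hjs
      · obtain ⟨c, rfl⟩ : ∃ c, s = j + 1 + c := ⟨s - (j + 1), by omega⟩
        have e1 : j + 1 + c - 1 = j + c := by omega
        rw [e1, Nat.add_sub_cancel_left]
        ring_nf
      · obtain rfl : f = 0 := by omega
        simp
    rw [h2, ← sum_qBinomial_mul_prod x (x ^ (s - 1 - j)) f, Finset.mul_sum, Finset.mul_sum]
    refine Finset.sum_congr rfl fun l hl => ?_
    rw [Finset.mem_range] at hl
    have h3 : f * j = l * j + (f - l) * j := by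
      rw [← Nat.add_mul]; congr 1; omega
    rw [straightCoeff, h3, pow_add]
    ring
  rw [Finset.sum_congr rfl h1, ← Finset.sum_mul, sum_neg_one_pow_qBinomial]
  split_ifs <;> simp

end Coefficients

/-- The position of `ρ k` relative to `d`. -/
def relPos {α β : Type*} [LinearOrder β] (ρ : α → β) (d : β) (k : α) : Fin 3 :=
  if ρ k < d then 0 else if ρ k = d then 1 else 2

theorem relPos_monotone {α β : Type*} [Preorder α] [LinearOrder β] {ρ : α → β} (hρ : Monotone ρ) (d : β) : Monotone (relPos ρ d) := by
  intro k k' h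
  have := hρ h
  unfold relPos
  rcases lt_trichotomy (ρ k) d with h1 | h1 | h1
  · rw [if_pos h1]
    exact Fin.zero_le _
  · rw [if_neg h1.not_lt, if_pos h1, if_neg (h1 ▸ this).not_gt]
    split_ifs <;> decide
  · rw [if_neg (h1.trans_le this).not_gt, if_neg (h1.trans_le this).ne', if_neg h1.not_gt,
      if_neg h1.ne']

theorem content_relPos_one {α β : Type*} [LinearOrder β] (ρ : α → β) (d : β) (K : Finset α) :
    content (relPos ρ d) K 1 = content ρ K d := by
  rw [content, content]
  congr 1
  refine Finset.filter_congr fun k _ => ?_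
  unfold relPos
  rcases lt_trichotomy (ρ k) d with h | h | h
  · simp [h, h.ne]
  · simp [h]
  · simp [h.not_gt, h.ne']

theorem content_relPos_two {α β : Type*} [Fintype β] [LinearOrder β] (ρ : α → β) (d : β) (K : Finset α) :
    content (relPos ρ d) K 2 = ∑ i with d < i, content ρ K i := by
  have h1 : content (relPos ρ d) K 2 = (K.filter fun k => d < ρ k).card := by
    rw [content]
    congr 1
    refine Finset.filter_congr fun k _ => ?_
    unfold relPos
    rcases lt_trichotomy (ρ k) d with h | h | h
    · simp [h, h.le]
    · simp [h]
    · simp [h.not_gt, h.ne', h]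
  rw [h1, Finset.card_eq_sum_card_fiberwise (f := ρ) (t := Finset.univ.filter fun i => d < i)
    (fun k hk => by simpa using (Finset.mem_filter.1 hk).2)]
  refine Finset.sum_congr rfl fun i hi => ?_
  rw [content, Finset.filter_filter]
  congr 1
  refine Finset.filter_congr fun k _ => ?_
  simp only [Finset.mem_filter, Finset.mem_univ, true_and] at hi
  exact ⟨fun h => h.2, fun h => ⟨h ▸ hi, h⟩⟩

section Straightening

variable {R : Type*} [CommRing R] (x : R) {α β : Type*} [LinearOrder α] [LinearOrder β]

/-- The total weight with which `L` enters the combination over its subsets `K`. Only the numbers of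
elements before, in and after block `d` matter, hence the three blocks of `relPos`. -/
theorem sum_straightCoeff_mul_pow_cross {ρ : α → β} (hρ : Monotone ρ) (d : β) (L : Finset α) :
    ∑ K ∈ L.powerset with content (relPos ρ d) K 0 = 0,
      straightCoeff x L.card (content (relPos ρ d) K 1) (content (relPos ρ d) K 2) *
        x ^ cross K (L \ K) =
      if content (relPos ρ d) L 1 = 0 then x ^ ((L.card - 1) * content (relPos ρ d) L 2) else 0 := by
  set σ := relPos ρ d with hσ
  have hcard := sum_content σ L
  rw [Fin.sum_univ_three] at hcard
  rw [← sum_straightCoeff_mul x (s := L.card) (e := content σ L 1) (f := content σ L 2) (by omega),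
    ← Finset.sum_product', ← Finset.sum_fiberwise_of_maps_to
      (t := Finset.range (content σ L 1 + 1) ×ˢ Finset.range (content σ L 2 + 1))
      (g := fun K => (content σ K 1, content σ K 2))]
  · refine Finset.sum_congr rfl ?_
    rintro ⟨j, l⟩ hjl
    simp only [Finset.mem_product, Finset.mem_range, Nat.lt_succ_iff] at hjl
    have h1 : ∑ K ∈ (L.powerset.filter fun K => content σ K 0 = 0) with
        (content σ K 1, content σ K 2) = (j, l),
        straightCoeff x L.card (content σ K 1) (content σ K 2) * x ^ cross K (L \ K) =
        straightCoeff x L.card j l * ∑ K ∈ L.powerset with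
          content σ K = ![content σ L 0, content σ L 1 - j, content σ L 2 - l],
          x ^ cross (L \ K) K := by
      rw [Finset.mul_sum]
      -- Complements are taken because `sum_pow_cross` counts crossings from the unchosen to the
      -- chosen elements.
      refine Finset.sum_bij' (fun K _ => L \ K) (fun K _ => L \ K) ?_ ?_ ?_ ?_ ?_
      · intro K hK
        simp only [Finset.mem_filter, Finset.mem_powerset, Prod.mk.injEq] at hK ⊢
        refine ⟨Finset.sdiff_subset, ?_⟩
        funext i
        rw [content_sdiff σ hK.1.1]
        fin_cases i
        · simp [hK.1.2]
        · simp [hK.2.1]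
        · simp [hK.2.2]
      · intro K hK
        simp only [Finset.mem_filter, Finset.mem_powerset, Prod.mk.injEq] at hK ⊢
        rw [content_sdiff σ hK.1, content_sdiff σ hK.1, content_sdiff σ hK.1, hK.2]
        refine ⟨⟨Finset.sdiff_subset, by simp⟩, ?_, ?_⟩
        · simp only [Matrix.cons_val_one, Matrix.cons_val_zero]; omega
        · simp only [Matrix.cons_val]; omega
      · intro K hK
        simp only [Finset.mem_filter, Finset.mem_powerset] at hK
        exact Finset.sdiff_sdiff_eq_self hK.1.1
      · intro K hK
        simp only [Finset.mem_filter, Finset.mem_powerset] at hK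
        exact Finset.sdiff_sdiff_eq_self hK.1
      · intro K hK
        simp only [Finset.mem_filter, Finset.mem_powerset, Prod.mk.injEq] at hK
        rw [Finset.sdiff_sdiff_eq_self hK.1.1, hK.2.1, hK.2.2]
    rw [h1, sum_pow_cross x (hσ ▸ relPos_monotone hρ d)]
    congr 1
    rw [blockCoeff, Fin.prod_univ_three, Fin.sum_univ_three]
    simp only [Finset.sum_filter, Fin.sum_univ_three, Matrix.cons_val_zero, Matrix.cons_val_one,
      Matrix.cons_val, qBinomial_self, qBinomial_symm x _ _ hjl.1, qBinomial_symm x _ _ hjl.2,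
      one_mul]
    have e1 : content σ L 1 - (content σ L 1 - j) = j := by omega
    simp [e1]
  · intro K hK
    simp only [Finset.mem_filter, Finset.mem_powerset] at hK
    simp only [Finset.mem_product, Finset.mem_range, Nat.lt_succ_iff]
    exact ⟨content_mono σ hK.1 1, content_mono σ hK.1 2⟩

end Straightening

/-! ### Overwriting letters and the vanishing relations -/

section Words

variable {R : Type*} [CommRing R] {M : Type*} [AddCommGroup M] [Module R M]
  {α β ι : Type*} [LinearOrder α] [Fintype α] [LinearOrder β] [DecidableEq ι]

/-- The positions of the letter `p` in the word `v`. -/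
def positions (v : α → ι) (p : ι) : Finset α := Finset.univ.filter fun k => v k = p

/-- The word obtained from `v` by writing the letter `p` at all positions in `K`. -/
def overwrite (p : ι) (v : α → ι) (K : Finset α) : α → ι := K.piecewise (fun _ => p) v

theorem mem_positions {v : α → ι} {p : ι} {k : α} : k ∈ positions v p ↔ v k = p := by
  simp [positions]

theorem overwrite_of_mem {p : ι} {v : α → ι} {K : Finset α} {k : α} (h : k ∈ K) :
    overwrite p v K k = p := by simp [overwrite, h]

theorem overwrite_of_notMem {p : ι} {v : α → ι} {K : Finset α} {k : α} (h : k ∉ K) :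
    overwrite p v K k = v k := by simp [overwrite, h]

theorem overwrite_overwrite (p : ι) (v : α → ι) (K K' : Finset α) :
    overwrite p (overwrite p v K) K' = overwrite p v (K ∪ K') := by
  funext k
  by_cases h' : k ∈ K'
  · rw [overwrite_of_mem h', overwrite_of_mem (Finset.mem_union_right _ h')]
  · rw [overwrite_of_notMem h']
    by_cases h : k ∈ K
    · rw [overwrite_of_mem h, overwrite_of_mem (Finset.mem_union_left _ h)]
    · rw [overwrite_of_notMem h, overwrite_of_notMem (by simp [h, h'])]

theorem positions_overwrite_self (p : ι) (v : α → ι) (K : Finset α) :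
    positions (overwrite p v K) p = positions v p ∪ K := by
  ext k
  rw [Finset.mem_union, mem_positions, mem_positions]
  by_cases h : k ∈ K
  · simp [overwrite_of_mem h, h]
  · simp [overwrite_of_notMem h, h]

theorem positions_overwrite_of_ne {p p' : ι} (hpp : p ≠ p') (v : α → ι) (K : Finset α) :
    positions (overwrite p' v K) p = positions v p \ K := by
  ext k
  rw [Finset.mem_sdiff, mem_positions, mem_positions]
  by_cases h : k ∈ K
  · simp [overwrite_of_mem h, h, hpp.symm]
  · simp [overwrite_of_notMem h, h]

theorem disjoint_positions {p p' : ι} (hpp : p ≠ p') {v : α → ι} {K : Finset α}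
    (hK : K ⊆ positions v p) : Disjoint (positions v p') K := by
  rw [Finset.disjoint_left]
  intro k hk hkK
  exact hpp ((mem_positions.1 (hK hkK)).symm.trans (mem_positions.1 hk))

/-- All sums over the ways of changing a positive number of letters `p` into `p'` vanish. -/
def ShiftVanishing (x : R) (p p' : ι) (X : (α → ι) → M) : Prop :=
  ∀ (v : α → ι) (t : ℕ), 0 < t → ∑ K ∈ (positions v p).powersetCard t,
    x ^ cross (positions v p') K • X (overwrite p' v K) = 0

variable {x : R} {p p' : ι} {X : (α → ι) → M}

/-- This is the vanishing relation for the word with `K` already overwritten and `s - K.card`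
further changes. The new letters `p'` at `K` contribute the crossings between `K` and `L \ K`. -/
theorem ShiftVanishing.sum_superset (hX : ShiftVanishing x p p' X) (hpp : p ≠ p') (v : α → ι)
    {s : ℕ} {K : Finset α} (hK : K ⊆ positions v p) (hs : K.card < s) :
    ∑ L ∈ (positions v p).powersetCard s with K ⊆ L,
      x ^ cross K (L \ K) • x ^ cross (positions v p') L • X (overwrite p' v L) = 0 := by
  have h := congrArg (fun m => x ^ cross (positions v p') K • m)
    (hX (overwrite p' v K) (s - K.card) (by omega))
  simp only [smul_zero, Finset.smul_sum] at h
  rw [← h]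
  refine Finset.sum_bij' (fun L _ => L \ K) (fun L _ => K ∪ L) ?_ ?_ ?_ ?_ ?_
  · intro L hL
    simp only [Finset.mem_filter, Finset.mem_powersetCard] at hL
    rw [Finset.mem_powersetCard, positions_overwrite_of_ne hpp, Finset.card_sdiff_of_subset hL.2]
    exact ⟨Finset.sdiff_subset_sdiff hL.1.1 subset_rfl, by omega⟩
  · intro L hL
    rw [Finset.mem_powersetCard, positions_overwrite_of_ne hpp, Finset.subset_sdiff] at hL
    simp only [Finset.mem_filter, Finset.mem_powersetCard]
    rw [Finset.card_union_of_disjoint hL.1.2.symm]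
    exact ⟨⟨Finset.union_subset hK hL.1.1, by omega⟩, Finset.subset_union_left⟩
  · intro L hL
    simp only [Finset.mem_filter] at hL
    exact Finset.union_sdiff_of_subset hL.2
  · intro L hL
    rw [Finset.mem_powersetCard, positions_overwrite_of_ne hpp, Finset.subset_sdiff] at hL
    exact Finset.union_sdiff_cancel_left hL.1.2.symm
  · intro L hL
    simp only [Finset.mem_filter, Finset.mem_powersetCard] at hL
    have hKL : K ∪ (L \ K) = L := Finset.union_sdiff_of_subset hL.2
    rw [overwrite_overwrite, hKL, positions_overwrite_self, smul_smul, smul_smul, ← pow_add, ← pow_add,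
      cross_union_left (disjoint_positions hpp hK)]
    nth_rewrite 2 [← hKL]
    rw [cross_union_right _ Finset.disjoint_sdiff]
    congr 2
    omega

/-- The relations `sum_superset`, weighted by `straightCoeff`, are summed over all `K` without
elements before block `d`. Exchanging the sums over `K` and `L` evaluates the result in two ways. -/
theorem ShiftVanishing.sum_word (hX : ShiftVanishing x p p' X) (hpp : p ≠ p') {ρ : α → β}
    (hρ : Monotone ρ) (d : β) (s : ℕ) (v : α → ι) :
    ∑ L ∈ (positions v p).powersetCard s,
      (if content (relPos ρ d) L 1 = 0 then x ^ ((s - 1) * content (relPos ρ d) L 2) else 0) •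
        x ^ cross (positions v p') L • X (overwrite p' v L) =
    ∑ L ∈ (positions v p).powersetCard s,
      (if content (relPos ρ d) L 1 = s then (-1) ^ s * x ^ (s.choose 2) else 0) •
        x ^ cross (positions v p') L • X (overwrite p' v L) := by
  set σ := relPos ρ d with hσ
  have h1 : ∀ L ∈ (positions v p).powersetCard s,
      (if content σ L 1 = 0 then x ^ ((s - 1) * content σ L 2) else 0) •
        x ^ cross (positions v p') L • X (overwrite p' v L) =
      ∑ K ∈ L.powerset with content σ K 0 = 0,
        straightCoeff x s (content σ K 1) (content σ K 2) •
          x ^ cross K (L \ K) • x ^ cross (positions v p') L • X (overwrite p' v L) := by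
    intro L hL
    rw [Finset.mem_powersetCard] at hL
    rw [← hL.2, hσ, ← sum_straightCoeff_mul_pow_cross x hρ d L, Finset.sum_smul]
    refine Finset.sum_congr rfl fun K _ => ?_
    rw [mul_smul]
  rw [Finset.sum_congr rfl h1]
  rw [Finset.sum_comm' (t' := (positions v p).powerset.filter fun K => content σ K 0 = 0)
    (s' := fun K => ((positions v p).powersetCard s).filter fun L => K ⊆ L)
    (h := by
      intro L K
      simp only [Finset.mem_filter, Finset.mem_powerset, Finset.mem_powersetCard]
      constructor
      · rintro ⟨⟨h1, h2⟩, h3, h4⟩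
        exact ⟨⟨⟨h1, h2⟩, h3⟩, h3.trans h1, h4⟩
      · rintro ⟨⟨⟨h1, h2⟩, h3⟩, -, h4⟩
        exact ⟨⟨h1, h2⟩, h3, h4⟩)]
  simp only [← Finset.smul_sum]
  -- For fixed `K` the sum vanishes when `K` has fewer than `s` elements, is empty when it has more,
  -- and reduces to `L = K` when it has exactly `s`.
  have h2 : ∀ K ∈ (positions v p).powerset.filter fun K => content σ K 0 = 0,
      straightCoeff x s (content σ K 1) (content σ K 2) •
        ∑ L ∈ (positions v p).powersetCard s with K ⊆ L,
          x ^ cross K (L \ K) • x ^ cross (positions v p') L • X (overwrite p' v L) =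
      if K.card = s then (if content σ K 1 = s then (-1) ^ s * x ^ (s.choose 2) else 0) •
        x ^ cross (positions v p') K • X (overwrite p' v K) else 0 := by
    intro K hK
    rw [Finset.mem_filter, Finset.mem_powerset] at hK
    have hcard := sum_content σ K
    rw [Fin.sum_univ_three] at hcard
    rcases lt_trichotomy K.card s with h | h | h
    · rw [hX.sum_superset hpp v hK.1 h, smul_zero, if_neg h.ne]
    · rw [if_pos h]
      have : ((positions v p).powersetCard s).filter (fun L => K ⊆ L) = {K} := by
        ext L
        simp only [Finset.mem_filter, Finset.mem_powersetCard, Finset.mem_singleton]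
        constructor
        · rintro ⟨⟨-, h2⟩, h3⟩
          exact (Finset.eq_of_subset_of_card_le h3 (by omega)).symm
        · rintro rfl
          exact ⟨⟨hK.1, h⟩, subset_rfl⟩
      rw [this, Finset.sum_singleton, sdiff_self]
      have h0 : cross K (⊥ : Finset α) = 0 := by simp [cross]
      rw [h0, pow_zero, one_smul]
      split_ifs with h3
      · have : content σ K 2 = 0 := by omega
        rw [this, h3, straightCoeff_zero_right]
      · rw [straightCoeff_eq_zero x (by omega) (by omega)]
    · rw [if_neg h.ne', Finset.sum_eq_zero, smul_zero]
      intro L hL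
      simp only [Finset.mem_filter, Finset.mem_powersetCard] at hL
      have := Finset.card_le_card hL.2
      omega
  rw [Finset.sum_congr rfl h2, ← Finset.sum_filter]
  have h3 : ((positions v p).powerset.filter fun K => content σ K 0 = 0).filter
      (fun K => K.card = s) = ((positions v p).powersetCard s).filter fun K => content σ K 0 = 0 := by
    ext K
    simp only [Finset.mem_filter, Finset.mem_powerset, Finset.mem_powersetCard]
    tauto
  rw [h3, Finset.sum_filter]
  refine Finset.sum_congr rfl fun K hK => ?_
  rw [Finset.mem_powersetCard] at hK
  have hcard := sum_content σ K
  rw [Fin.sum_univ_three] at hcard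
  split_ifs with h4 h5 h5
  · rfl
  · rfl
  · omega
  · rw [zero_smul]

variable [Fintype β] [Fintype ι]

/-- The words with `N r i` letters `r` in the block `i`. -/
def words (ρ : α → β) (N : ι → β → ℕ) : Finset (α → ι) :=
  Finset.univ.filter fun v => ∀ r, content ρ (positions v r) = N r

theorem mem_words {ρ : α → β} {N : ι → β → ℕ} {v : α → ι} :
    v ∈ words ρ N ↔ ∀ r, content ρ (positions v r) = N r := by
  simp [words]

theorem content_union {γ : Type*} [DecidableEq γ] (σ : α → γ) {K L : Finset α} (h : Disjoint K L)
    (i : γ) : content σ (K ∪ L) i = content σ K i + content σ L i := by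
  rw [content, Finset.filter_union, Finset.card_union_of_disjoint]
  · rfl
  · exact Finset.disjoint_filter_filter h

theorem overwrite_overwrite_eq_self {v : α → ι} {K : Finset α} (hK : K ⊆ positions v p) :
    overwrite p (overwrite p' v K) K = v := by
  funext k
  by_cases h : k ∈ K
  · rw [overwrite_of_mem h, mem_positions.1 (hK h)]
  · rw [overwrite_of_notMem h, overwrite_of_notMem h]

/-- The counts after `h i` letters `p` of each block `i` have been changed into `p'`. -/
def shiftCount (p p' : ι) (Z : ι → β → ℕ) (h : β → ℕ) (r : ι) (i : β) : ℕ :=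
  if r = p then Z r i - h i else if r = p' then Z r i + h i else Z r i

/-- A resulting word `w` arises once for each choice of `L` with content `h` among its letters `p'`.
The old letters `p'` are the complement of `L`, so `sum_pow_cross` gives the multiplicity. -/
theorem sum_words_shift (hpp : p ≠ p') {ρ : α → β} (hρ : Monotone ρ) (Z : ι → β → ℕ) {h : β → ℕ}
    (hZ : ∀ i, h i ≤ Z p i) :
    ∑ v ∈ words ρ Z, ∑ L ∈ (positions v p).powerset with content ρ L = h,
      x ^ cross (positions v p') L • X (overwrite p' v L) =
    blockCoeff x (fun i => Z p' i + h i) h • ∑ v ∈ words ρ (shiftCount p p' Z h), X v := by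
  have h1 : ∀ w ∈ words ρ (shiftCount p p' Z h),
      blockCoeff x (fun i => Z p' i + h i) h • X w =
      ∑ L ∈ (positions w p').powerset with content ρ L = h,
        x ^ cross (positions w p' \ L) L • X w := by
    intro w hw
    have h2 : content ρ (positions w p') = fun i => Z p' i + h i := by
      rw [mem_words.1 hw p']
      funext i
      simp [shiftCount, hpp.symm]
    rw [← Finset.sum_smul, sum_pow_cross x hρ, h2]
  rw [Finset.smul_sum, Finset.sum_congr rfl h1, Finset.sum_sigma', Finset.sum_sigma']
  refine Finset.sum_bij' (fun y _ => ⟨overwrite p' y.1 y.2, y.2⟩)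
    (fun y _ => ⟨overwrite p y.1 y.2, y.2⟩) ?_ ?_ ?_ ?_ ?_
  · rintro ⟨v, L⟩ hy
    simp only [Finset.mem_sigma, Finset.mem_filter, Finset.mem_powerset, mem_words] at hy ⊢
    obtain ⟨hv, hL, hLh⟩ := hy
    refine ⟨fun r => ?_, ?_, hLh⟩
    · funext i
      rw [shiftCount, ← hv r, ← hLh]
      split_ifs with h2 h3
      · subst h2
        rw [positions_overwrite_of_ne hpp, content_sdiff ρ hL]
      · subst h3
        rw [positions_overwrite_self, content_union ρ (disjoint_positions hpp hL)]
      · rw [positions_overwrite_of_ne h3, Finset.sdiff_eq_self_of_disjoint]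
        exact disjoint_positions (Ne.symm h2) hL
    · rw [positions_overwrite_self]
      exact Finset.subset_union_right
  · rintro ⟨w, L⟩ hy
    simp only [Finset.mem_sigma, Finset.mem_filter, Finset.mem_powerset, mem_words] at hy ⊢
    obtain ⟨hw, hL, hLh⟩ := hy
    refine ⟨fun r => ?_, ?_, hLh⟩
    · funext i
      have h4 := congrFun (hw r) i
      have h5 := hZ i
      rw [shiftCount] at h4
      split_ifs at h4 with h2 h3
      · subst h2
        rw [positions_overwrite_self, content_union ρ (disjoint_positions hpp.symm hL), hLh]
        omega
      · subst h3
        rw [positions_overwrite_of_ne hpp.symm, content_sdiff ρ hL, hLh]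
        omega
      · rw [positions_overwrite_of_ne h2, Finset.sdiff_eq_self_of_disjoint, h4]
        exact disjoint_positions (Ne.symm h3) hL
    · rw [positions_overwrite_self]
      exact Finset.subset_union_right
  · rintro ⟨v, L⟩ hy
    simp only [Finset.mem_sigma, Finset.mem_filter, Finset.mem_powerset] at hy
    simp only [overwrite_overwrite_eq_self hy.2.1]
  · rintro ⟨w, L⟩ hy
    simp only [Finset.mem_sigma, Finset.mem_filter, Finset.mem_powerset] at hy
    simp only [overwrite_overwrite_eq_self hy.2.1]
  · rintro ⟨v, L⟩ hy
    simp only [Finset.mem_sigma, Finset.mem_filter, Finset.mem_powerset] at hy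
    simp only
    rw [positions_overwrite_self, Finset.union_sdiff_cancel_right (disjoint_positions hpp hy.2.1)]

end Words

/-! ### Summation over all words with prescribed counts -/

section Straightening

variable {R : Type*} [CommRing R] {M : Type*} [AddCommGroup M] [Module R M]
  {α β ι : Type*} [LinearOrder α] [Fintype α] [LinearOrder β] [Fintype β]
  [DecidableEq ι] [Fintype ι]

/-- The counts after all letters `p'` in the block `d` have been changed into `p` and `g i` letters
`p` of each other block `i` into `p'`. -/
def exchangeCount (N : ι → β → ℕ) (d : β) (p p' : ι) (g : β → ℕ) (r : ι) (i : β) : ℕ :=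
  if r = p then (if i = d then N p d + N p' d else N p i - g i)
  else if r = p' then (if i = d then 0 else N p' i + g i)
  else N r i

theorem shiftCount_exchangeCount {N : ι → β → ℕ} {d : β} {p p' : ι} {g : β → ℕ}
    (hg : g d = 0) :
    shiftCount p p' (exchangeCount N d p p' 0) g = exchangeCount N d p p' g := by
  funext r i
  unfold shiftCount exchangeCount
  by_cases hi : i = d
  · subst hi; split_ifs <;> simp [hg]
  · split_ifs <;> simp

theorem shiftCount_exchangeCount_single {N : ι → β → ℕ} {d : β} {p p' : ι} (hpp : p ≠ p') :
    shiftCount p p' (exchangeCount N d p p' 0) (Pi.single d (N p' d)) = N := by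
  funext r i
  unfold shiftCount exchangeCount
  by_cases hr : r = p
  · subst hr
    by_cases hi : i = d
    · subst hi; simp
    · simp [hi]
  · by_cases hr' : r = p'
    · subst hr'
      by_cases hi : i = d
      · subst hi; simp [hr]
      · simp [hi, hr]
    · simp [hr, hr']

theorem sum_exchangeCount {N : ι → β → ℕ} {d : β} {p p' : ι} (hpp : p ≠ p') (i : β) :
    ∑ j with j < i, N p' j =
      ∑ j with j < i, exchangeCount N d p p' 0 p' j + if d < i then N p' d else 0 := by
  have h1 : ∀ j, N p' j = exchangeCount N d p p' 0 p' j + if d = j then N p' d else 0 := by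
    intro j
    unfold exchangeCount
    by_cases hj : j = d
    · subst hj; simp [hpp.symm]
    · simp [hpp.symm, hj, Ne.symm hj]
  rw [Finset.sum_congr rfl fun j _ => h1 j, Finset.sum_add_distrib, Finset.sum_ite_eq]
  simp

theorem blockCoeff_add_self (x : R) (c h : β → ℕ) :
    blockCoeff x (fun i => c i + h i) h =
      x ^ (∑ i, h i * ∑ j with j < i, c j) * ∏ i, qBinomial x (c i + h i) (h i) := by
  simp only [blockCoeff, Nat.add_sub_cancel]

/-- Block `d` contains no `p'` before the change, so its binomial is $\left[{s\atop s}\right]=1$ and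
only the crossings with earlier blocks remain. -/
theorem blockCoeff_single (x : R) {N : ι → β → ℕ} {d : β} {p p' : ι} (hpp : p ≠ p') :
    blockCoeff x (fun i => exchangeCount N d p p' 0 p' i + Pi.single (M := fun _ => ℕ) d (N p' d) i)
      (Pi.single d (N p' d)) = x ^ (N p' d * ∑ j with j < d, N p' j) := by
  rw [blockCoeff_add_self, sum_exchangeCount (d := d) hpp d, if_neg (lt_irrefl d), add_zero,
    Finset.prod_eq_one, mul_one]
  · congr 1
    rw [Finset.sum_eq_single d]
    · simp
    · intro i _ hi; simp [hi]
    · simp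
  · intro i _
    by_cases hi : i = d
    · subst hi
      simp [exchangeCount, hpp.symm, qBinomial_self]
    · simp [hi, qBinomial_zero_right]

/-- Removing the $s$ letters `p'` from block `d` lowers the crossing exponent by $s\sum_{i>d}g_i$.
The extra factor restores all of this but $\sum_{i>d}g_i$, whence the negative power. -/
theorem pow_mul_blockCoeff (q : Rˣ) {N : ι → β → ℕ} {d : β} {p p' : ι} (hpp : p ≠ p') {g : β → ℕ}
    (hg : g d = 0) (hs : ∑ i, g i = N p' d) :
    (q : R) ^ ((N p' d - 1) * ∑ i with d < i, g i) *
      blockCoeff (q : R) (fun i => exchangeCount N d p p' 0 p' i + g i) g =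
    ((q ^ (-((∑ i with d < i, g i : ℕ) : ℤ)) : Rˣ) : R) *
      ∏ i, ((q : R) ^ (g i * ∑ j with j < i, N p' j) * qBinomial (q : R) (N p' i + g i) (g i)) := by
  have hB : ∏ i, qBinomial (q : R) (exchangeCount N d p p' 0 p' i + g i) (g i) =
      ∏ i, qBinomial (q : R) (N p' i + g i) (g i) := by
    refine Finset.prod_congr rfl fun i _ => ?_
    by_cases hi : i = d
    · subst hi; rw [hg, qBinomial_zero_right, qBinomial_zero_right]
    · simp [exchangeCount, hpp.symm, hi]
  have hE : (N p' d - 1) * ∑ i with d < i, g i +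
      ∑ i, g i * ∑ j with j < i, exchangeCount N d p p' 0 p' j + ∑ i with d < i, g i =
      ∑ i, g i * ∑ j with j < i, N p' j := by
    have h1 : ∑ i, g i * ∑ j with j < i, N p' j =
        ∑ i, g i * ∑ j with j < i, exchangeCount N d p p' 0 p' j +
          N p' d * ∑ i with d < i, g i := by
      rw [Finset.mul_sum, Finset.sum_filter, ← Finset.sum_add_distrib]
      refine Finset.sum_congr rfl fun i _ => ?_
      rw [sum_exchangeCount (d := d) hpp i]
      split_ifs <;> ring
    have h2 : ∑ i with d < i, g i ≤ N p' d := hs ▸ Finset.sum_le_sum_of_subset (by simp)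
    rw [h1]
    -- If `N p' d = 0`, the subtraction in `N p' d - 1` is truncated, but then all `g i` with `d <
    -- i` vanish.
    rcases Nat.eq_zero_or_pos (N p' d) with h0 | h0
    · have : ∑ i with d < i, g i = 0 := by omega
      rw [this]; simp
    · obtain ⟨c, hc⟩ := Nat.exists_eq_add_of_lt h0
      rw [hc, zero_add, Nat.add_sub_cancel]
      ring
  rw [blockCoeff_add_self, hB, Finset.prod_mul_distrib, Finset.prod_pow_eq_pow_sum, ← mul_assoc,
    ← mul_assoc, ← pow_add, ← hE, pow_add _ _ (∑ i with d < i, g i)]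
  congr 1
  rw [mul_comm (((q ^ _ : Rˣ)) : R), mul_assoc, ← Units.val_pow_eq_pow_val q (∑ i with d < i, g i),
    ← Units.val_mul, zpow_neg, zpow_natCast, mul_inv_cancel, Units.val_one, mul_one]

/-- Straightening of a sum of words with prescribed counts. -/
theorem ShiftVanishing.straighten {q : Rˣ} {p p' : ι} {X : (α → ι) → M}
    (hX : ShiftVanishing (q : R) p p' X) (hpp : p ≠ p') {ρ : α → β} (hρ : Monotone ρ)
    (N : ι → β → ℕ) (d : β) (G : Finset (β → ℕ))
    (hG : ∀ g, g ∈ G ↔ g d = 0 ∧ ∑ i, g i = N p' d ∧ ∀ i, g i ≤ N p i) :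
    ((-1) ^ N p' d * (q : R) ^ ((N p' d).choose 2) * (q : R) ^ (N p' d * ∑ j with j < d, N p' j)) •
      ∑ v ∈ words ρ N, X v =
    ∑ g ∈ G, (((q ^ (-((∑ i with d < i, g i : ℕ) : ℤ)) : Rˣ) : R) *
      ∏ i, ((q : R) ^ (g i * ∑ j with j < i, N p' j) * qBinomial (q : R) (N p' i + g i) (g i))) •
      ∑ v ∈ words ρ (exchangeCount N d p p' g), X v := by
  set s := N p' d with hs
  -- `Z` counts the words in which every `p'` of block `d` has become `p`. Changing `s` letters `p`
  -- inside block `d` leads back to `N`, while changing `g i` of them in each other block leads to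
  -- the counts of $U_g$.
  set Z := exchangeCount N d p p' 0 with hZ
  have hZp : ∀ i, Z p i = if i = d then N p d + s else N p i := by
    intro i
    simp [hZ, exchangeCount, hs]
  have key := Finset.sum_congr (s₁ := words ρ Z) rfl fun v _ => hX.sum_word hpp hρ d s v
  have hleft : ∑ v ∈ words ρ Z, ∑ L ∈ (positions v p).powersetCard s,
      (if content (relPos ρ d) L 1 = 0 then (q : R) ^ ((s - 1) * content (relPos ρ d) L 2) else 0) •
        (q : R) ^ cross (positions v p') L • X (overwrite p' v L) =
      ∑ g ∈ G, (q : R) ^ ((s - 1) * ∑ i with d < i, g i) •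
        ∑ v ∈ words ρ Z, ∑ L ∈ (positions v p).powerset with content ρ L = g,
          (q : R) ^ cross (positions v p') L • X (overwrite p' v L) := by
    simp only [Finset.smul_sum (r := (q : R) ^ ((s - 1) * _))]
    rw [Finset.sum_comm]
    refine Finset.sum_congr rfl fun v hv => ?_
    rw [mem_words] at hv
    simp only [ite_smul, zero_smul]
    rw [← Finset.sum_filter, ← Finset.sum_fiberwise_of_maps_to (t := G) (g := fun L => content ρ L)]
    · refine Finset.sum_congr rfl fun g hg => ?_
      rw [hG] at hg
      refine Finset.sum_congr ?_ fun L hL => ?_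
      · ext L
        simp only [Finset.mem_filter, Finset.mem_powersetCard, Finset.mem_powerset,
          content_relPos_one]
        constructor
        · rintro ⟨⟨⟨h1, -⟩, -⟩, h2⟩
          exact ⟨h1, h2⟩
        · rintro ⟨h1, h2⟩
          refine ⟨⟨⟨h1, ?_⟩, ?_⟩, h2⟩
          · rw [← sum_content ρ L, h2, hg.2.1]
          · rw [h2, hg.1]
      · simp only [Finset.mem_filter] at hL
        rw [content_relPos_two, hL.2]
    · intro L hL
      simp only [Finset.mem_filter, Finset.mem_powersetCard, content_relPos_one] at hL
      rw [hG]
      refine ⟨hL.2, by rw [sum_content, hL.1.2], fun i => ?_⟩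
      have h1 := content_mono ρ hL.1.1 i
      rw [hv p, hZp] at h1
      split_ifs at h1 with hi
      · subst hi; omega
      · exact h1
  have hright : ∑ v ∈ words ρ Z, ∑ L ∈ (positions v p).powersetCard s,
      (if content (relPos ρ d) L 1 = s then (-1) ^ s * (q : R) ^ (s.choose 2) else 0) •
        (q : R) ^ cross (positions v p') L • X (overwrite p' v L) =
      ((-1) ^ s * (q : R) ^ (s.choose 2)) •
        ∑ v ∈ words ρ Z, ∑ L ∈ (positions v p).powerset with content ρ L = Pi.single d s,
          (q : R) ^ cross (positions v p') L • X (overwrite p' v L) := by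
    simp only [Finset.smul_sum (r := (-1) ^ s * (q : R) ^ (s.choose 2))]
    refine Finset.sum_congr rfl fun v hv => ?_
    simp only [ite_smul, zero_smul]
    rw [← Finset.sum_filter]
    refine Finset.sum_congr ?_ fun _ _ => rfl
    ext L
    simp only [Finset.mem_filter, Finset.mem_powersetCard, Finset.mem_powerset,
      content_relPos_one]
    have hc := sum_content ρ L
    constructor
    · rintro ⟨⟨h1, h2⟩, h3⟩
      refine ⟨h1, ?_⟩
      rw [h2, ← Finset.add_sum_erase _ _ (Finset.mem_univ d), h3, Nat.add_eq_left,
        Finset.sum_eq_zero_iff] at hc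
      funext i
      by_cases hi : i = d
      · subst hi; rw [h3, Pi.single_eq_same]
      · rw [hc i (by simp [hi]), Pi.single_eq_of_ne hi]
    · rintro ⟨h1, h2⟩
      refine ⟨⟨h1, ?_⟩, ?_⟩
      · rw [← hc, h2]; simp
      · rw [h2, Pi.single_eq_same]
  rw [hleft, hright, sum_words_shift hpp hρ Z, hZ, hs, blockCoeff_single _ hpp,
    shiftCount_exchangeCount_single hpp, smul_smul] at key
  · rw [← key]
    refine Finset.sum_congr rfl fun g hg => ?_
    rw [hG] at hg
    rw [sum_words_shift hpp hρ, smul_smul, pow_mul_blockCoeff q hpp hg.1 hg.2.1,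
      shiftCount_exchangeCount hg.1]
    intro i
    rw [← hZ, hZp]
    split_ifs with hi
    · subst hi; rw [hg.1]; exact Nat.zero_le _
    · exact hg.2.2 i
  · intro i
    rw [hZp]
    by_cases hi : i = d
    · subst hi; simp
    · simp [hi]

end Straightening

/-! ### Reversal of the orders of positions and blocks -/

section Dual

open OrderDual

variable {R : Type*} [CommRing R] {M : Type*} [AddCommGroup M] [Module R M]
  {α β ι : Type*} [LinearOrder α] [Fintype α] [LinearOrder β] [Fintype β]
  [DecidableEq ι] [Fintype ι]

theorem cross_map_toDual (A B : Finset α) :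
    cross (A.map (toDual (α := α)).toEmbedding) (B.map (toDual (α := α)).toEmbedding) =
      cross B A := by
  simp only [cross, Finset.sum_map, Equiv.coe_toEmbedding, toDual_lt_toDual]
  rw [Finset.sum_comm]

theorem positions_ofDual (v : α → ι) (p : ι) :
    positions (v ∘ ofDual) p = (positions v p).map (toDual (α := α)).toEmbedding := by
  ext k
  rw [Finset.mem_map_equiv, mem_positions, mem_positions]
  rfl

theorem overwrite_ofDual (p : ι) (v : α → ι) (K : Finset α) :
    overwrite p (v ∘ ofDual) (K.map (toDual (α := α)).toEmbedding) ∘ toDual = overwrite p v K := by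
  funext k
  have : toDual k ∈ K.map (toDual (α := α)).toEmbedding ↔ k ∈ K := by
    rw [Finset.mem_map_equiv]; rfl
  rw [Function.comp]
  by_cases h : k ∈ K
  · rw [overwrite_of_mem h, overwrite_of_mem (this.2 h)]
  · rw [overwrite_of_notMem h, overwrite_of_notMem (mt this.1 h)]
    rfl

theorem content_map_toDual (ρ : α → β) (K : Finset α) (i : βᵒᵈ) :
    content (toDual ∘ ρ ∘ ofDual) (K.map (toDual (α := α)).toEmbedding) i =
      content ρ K (ofDual i) := by
  rw [content, Finset.filter_map, Finset.card_map]
  rfl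

theorem sum_words_dual (ρ : α → β) (N : ι → βᵒᵈ → ℕ) (X : (α → ι) → M) :
    ∑ v ∈ words (toDual ∘ ρ ∘ ofDual) N, X (v ∘ toDual) =
      ∑ v ∈ words ρ (fun r i => N r (toDual i)), X v := by
  refine Finset.sum_bij' (fun v _ => v ∘ toDual) (fun v _ => v ∘ ofDual) ?_ ?_ ?_ ?_ ?_
  · intro v hv
    rw [mem_words] at hv ⊢
    intro r
    funext i
    rw [← hv r]
    have := content_map_toDual ρ (positions (v ∘ toDual) r) (toDual i)
    rw [ofDual_toDual] at this
    rw [← this, ← positions_ofDual]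
    rfl
  · intro v hv
    rw [mem_words] at hv ⊢
    intro r
    funext i
    rw [positions_ofDual, content_map_toDual, hv r]
    rfl
  · intro v _; rfl
  · intro v _; rfl
  · intro v _; rfl

/-- Reversing the positions interchanges the arguments of `cross`, so weights of the opposite
orientation also yield `ShiftVanishing`. -/
theorem shiftVanishing_dual {x : R} {p p' : ι} {X : (α → ι) → M}
    (hX : ∀ (v : α → ι) (t : ℕ), 0 < t → ∑ K ∈ (positions v p).powersetCard t,
      x ^ cross K (positions v p') • X (overwrite p' v K) = 0) :
    ShiftVanishing x p p' fun v : αᵒᵈ → ι => X (v ∘ toDual) := by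
  intro v t ht
  obtain ⟨v, rfl⟩ : ∃ v' : α → ι, v = v' ∘ ofDual := ⟨v ∘ toDual, rfl⟩
  rw [← hX v t ht, positions_ofDual, Finset.powersetCard_map, Finset.sum_map]
  refine Finset.sum_congr rfl fun K _ => ?_
  rw [positions_ofDual]
  change x ^ cross _ (K.map (toDual (α := α)).toEmbedding) •
    X (overwrite p' _ (K.map (toDual (α := α)).toEmbedding) ∘ toDual) = _
  rw [cross_map_toDual, overwrite_ofDual]

theorem sum_filter_dual (d : β) (f : β → ℕ) :
    ∑ i : βᵒᵈ with toDual d < i, f (ofDual i) = ∑ i with i < d, f i :=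
  Finset.sum_equiv ofDual (by simp) (by simp)

theorem sum_filter_dual' (d : β) (f : β → ℕ) :
    ∑ i : βᵒᵈ with i < toDual d, f (ofDual i) = ∑ i with d < i, f i :=
  Finset.sum_equiv ofDual (fun i => by
    simp only [Finset.mem_filter, Finset.mem_univ, true_and]; exact Iff.rfl) (by simp)

/-- Straightening in the opposite direction. -/
theorem straighten_dual {q : Rˣ} {p p' : ι} {X : (α → ι) → M}
    (hX : ∀ (v : α → ι) (t : ℕ), 0 < t → ∑ K ∈ (positions v p).powersetCard t,
      (q : R) ^ cross K (positions v p') • X (overwrite p' v K) = 0)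
    (hpp : p ≠ p') {ρ : α → β} (hρ : Monotone ρ)
    (N : ι → β → ℕ) (d : β) (G : Finset (β → ℕ))
    (hG : ∀ g, g ∈ G ↔ g d = 0 ∧ ∑ i, g i = N p' d ∧ ∀ i, g i ≤ N p i) :
    ((-1) ^ N p' d * (q : R) ^ ((N p' d).choose 2) * (q : R) ^ (N p' d * ∑ j with d < j, N p' j)) •
      ∑ v ∈ words ρ N, X v =
    ∑ g ∈ G, (((q ^ (-((∑ i with i < d, g i : ℕ) : ℤ)) : Rˣ) : R) *
      ∏ i, ((q : R) ^ (g i * ∑ j with i < j, N p' j) * qBinomial (q : R) (N p' i + g i) (g i))) •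
      ∑ v ∈ words ρ (exchangeCount N d p p' g), X v := by
  have h := (shiftVanishing_dual hX).straighten (q := q) hpp (ρ := toDual ∘ ρ ∘ ofDual) hρ.dual
    (fun r i => N r (ofDual i)) (toDual d)
    (G.map (Equiv.arrowCongr (toDual (α := β)) (Equiv.refl ℕ)).toEmbedding) (by
      intro g
      rw [Finset.mem_map_equiv, hG]
      have : ∑ i : β, (Equiv.arrowCongr (toDual (α := β)) (Equiv.refl ℕ)).symm g i = ∑ i, g i :=
        Fintype.sum_equiv toDual _ _ fun _ => rfl
      rw [this]
      exact Iff.rfl)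
  simp only [sum_words_dual] at h
  rw [Finset.sum_map] at h
  simp only [ofDual_toDual] at h
  rw [sum_filter_dual' d (fun j => N p' j)] at h
  refine h.trans (Finset.sum_congr rfl fun g _ => ?_)
  rw [← sum_filter_dual d g]
  rfl

end Dual

end HeckeAlgebra

/-! ### The elements `∑ m_lam T_{d(𝔰)}` as sums over words -/

namespace HeckeAlgebra

variable {R : Type*} [CommRing R] (q : Rˣ) {n a b : ℕ}

section RowWord

variable {lam : WeakComposition n a}

/-- The word that records the row of each letter of a tableau. -/
def rowWord (s : lam.BijTableau) (k : Fin n) : Fin a := (s.symm k).1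

theorem rowIndex_comp_d_inv (s : lam.BijTableau) : lam.rowIndex ∘ ⇑(s.d)⁻¹ = rowWord s := by
  funext k
  exact lam.rowIndex_initialTableau (s.symm k)

/-- Row-standardness of `s` is the condition on `d(s)` required by `cosetSum_self_mul_T`. -/
theorem mElt_mul_T_d {s : lam.BijTableau} (hs : s.IsRowStandard) :
    mElt q lam * T q s.d = cosetSum q lam.rowIndex (rowWord s) := by
  rw [mElt_eq_cosetSum, cosetSum_self_mul_T q lam.rowIndex_monotone, rowIndex_comp_d_inv]
  intro k k' hkk' h
  obtain ⟨⟨r, c⟩, rfl⟩ := lam.initialTableau.surjective k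
  obtain ⟨⟨r', c'⟩, rfl⟩ := lam.initialTableau.surjective k'
  rw [rowIndex_initialTableau, rowIndex_initialTableau] at h
  simp only at h
  subst h
  have hd : ∀ x, s.d (lam.initialTableau x) = s x := fun x => by
    simp [BijTableau.d]
  rw [hd, hd]
  exact hs r ((lam.initialTableau_strictMono r).lt_iff_lt.1 hkk')

theorem rowWord_injective {s s' : lam.BijTableau} (hs : s.IsRowStandard) (hs' : s'.IsRowStandard)
    (h : rowWord s = rowWord s') : s = s' := by
  have hr : ∀ (s : lam.BijTableau) (r : Fin a),
      Set.range (fun c : Fin (lam.part r) => s ⟨r, c⟩) = {k | rowWord s k = r} := by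
    intro s r
    ext k
    simp only [Set.mem_range, rowWord]
    constructor
    · rintro ⟨c, rfl⟩
      simp
    · rintro rfl
      exact ⟨(s.symm k).2, by simp⟩
  ext ⟨r, c⟩
  have := ((hs r).range_inj (hs' r)).1 (by rw [hr, hr, h])
  exact congrArg Fin.val (congrFun this c)

theorem rowWord_apply (s : lam.BijTableau) (x : lam.Node) : rowWord s (s x) = x.1 := by
  simp [rowWord]

theorem exists_rowStandard (v : Fin n → Fin a) (hv : ∀ r, (positions v r).card = lam.part r) :
    ∃ s : lam.BijTableau, s.IsRowStandard ∧ rowWord s = v := by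
  let f : lam.Node → Fin n := fun x => (positions v x.1).orderEmbOfFin (hv x.1) x.2
  have hf : ∀ x, v (f x) = x.1 := fun x =>
    mem_positions.1 (Finset.orderEmbOfFin_mem _ _ _)
  have hinj : Function.Injective f := by
    rintro ⟨r, c⟩ ⟨r', c'⟩ h
    have h1 : r = r' := (hf ⟨r, c⟩).symm.trans ((congrArg v h).trans (hf ⟨r', c'⟩))
    subst h1
    have : c = c' := ((positions v r).orderEmbOfFin (hv r)).injective h
    rw [this]
  have hbij : Function.Bijective f := by
    rw [Fintype.bijective_iff_injective_and_card]
    refine ⟨hinj, ?_⟩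
    rw [Fintype.card_sigma, Fintype.card_fin]
    simp only [Fintype.card_fin]
    exact lam.sum_part
  refine ⟨Equiv.ofBijective f hbij, fun r => ((positions v r).orderEmbOfFin (hv r)).strictMono, ?_⟩
  funext k
  obtain ⟨x, rfl⟩ := hbij.2 k
  rw [hf]
  exact rowWord_apply (Equiv.ofBijective f hbij) x

variable {ν : WeakComposition n b}

theorem content_rowWord (s : lam.BijTableau) (r : Fin a) (i : Fin b) :
    content ν.rowIndex (positions (rowWord s) r) i =
      Fintype.card {c : Fin (lam.part r) // ν.rowIndex (s ⟨r, c⟩) = i} := by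
  rw [content, Fintype.card_subtype]
  symm
  refine Finset.card_bij (fun c _ => s ⟨r, c⟩) ?_ ?_ ?_
  · intro c hc
    simp only [Finset.mem_filter, Finset.mem_univ, true_and, mem_positions] at hc ⊢
    exact ⟨rowWord_apply s ⟨r, c⟩, hc⟩
  · intro c _ c' _ h
    have := s.injective h
    simpa using this
  · intro k hk
    simp only [Finset.mem_filter, mem_positions] at hk
    obtain ⟨⟨r', c⟩, rfl⟩ := s.surjective k
    rw [rowWord_apply] at hk
    obtain ⟨rfl, hk⟩ := hk
    exact ⟨c, by simpa using hk, rfl⟩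

theorem monotone_eq_of_card_eq {m : ℕ} {f g : Fin m → Fin b} (hf : Monotone f) (hg : Monotone g)
    (h : ∀ i, Fintype.card {c // f c = i} = Fintype.card {c // g c = i}) : f = g := by
  obtain ⟨u, rfl⟩ := exists_comp_eq_of_card_eq h
  exact Tuple.unique_monotone (f := f) (σ := 1) (τ := u) hf hg

/-- Replacing the letters of a row-standard tableau by their rows in $\mathfrak t^\nu$ gives weakly
increasing rows, and such a row is determined by its counts. -/
theorem rowWord_mem_words_iff (S : RowTableau lam ν) {s : lam.BijTableau} (hs : s.IsRowStandard) :
    rowWord s ∈ words ν.rowIndex (fun r i => S.count i r) ↔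
      ∀ x, ν.rowIndex (s x) = S.entry x := by
  rw [mem_words]
  constructor
  · rintro h ⟨r, c⟩
    refine congrFun (monotone_eq_of_card_eq
      (f := fun c : Fin (lam.part r) => ν.rowIndex (s ⟨r, c⟩)) ?_ (S.rowMono r) fun i => ?_) c
    · exact ν.rowIndex_monotone.comp (hs r).monotone
    · rw [← content_rowWord, h r]
      rfl
  · intro h r
    funext i
    rw [content_rowWord]
    simp only [h]
    rfl

theorem coe_thetaElt (S : RowTableau lam ν) :
    (thetaElt q S : HeckeAlgebra R q n) =
      ∑ v ∈ words ν.rowIndex (fun r i => S.count i r), cosetSum q lam.rowIndex v := by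
  classical
  rw [thetaElt, AddSubmonoidClass.coe_finsetSum]
  refine Finset.sum_bij (fun s _ => rowWord s) ?_ ?_ ?_ ?_
  · intro s hs
    simp only [Finset.mem_filter, Finset.mem_univ, true_and] at hs
    exact (rowWord_mem_words_iff S hs.1).2 hs.2
  · intro s hs s' hs' h
    simp only [Finset.mem_filter, Finset.mem_univ, true_and] at hs hs'
    exact rowWord_injective hs.1 hs'.1 h
  · intro v hv
    obtain ⟨s, hs, rfl⟩ := exists_rowStandard (lam := lam) v (fun r => by
      rw [← sum_content ν.rowIndex, mem_words.1 hv r, S.sum_count_row])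
    exact ⟨s, by simpa using ⟨hs, (rowWord_mem_words_iff S hs).1 hv⟩, rfl⟩
  · intro s hs
    simp only [Finset.mem_filter, Finset.mem_univ, true_and] at hs
    rw [← mElt_mul_T_d q hs.1]
    rfl

/-- The set of all `w` that occur is defined by counts depending only on `ν.rowIndex ∘ w`, hence is
a union of cosets of $\mathfrak S_\nu$. This is what makes $\Theta_S$ well defined. -/
theorem exists_thetaElt_eq_mul (S : RowTableau lam ν) :
    ∃ h, (thetaElt q S : HeckeAlgebra R q n) = h * mElt q ν := by
  classical
  set N : Fin a → Fin b → ℕ := fun r i => S.count i r with hN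
  have h1 : (thetaElt q S : HeckeAlgebra R q n) = ∑ w : Equiv.Perm (Fin n) with
      lam.rowIndex ∘ (w⁻¹ : Equiv.Perm (Fin n)) ∈ words ν.rowIndex N, T q w := by
    rw [coe_thetaElt, ← Finset.sum_fiberwise_of_maps_to (t := words ν.rowIndex N)
      (g := fun w : Equiv.Perm (Fin n) => lam.rowIndex ∘ (w⁻¹ : Equiv.Perm (Fin n)))
      (fun w hw => (Finset.mem_filter.1 hw).2)]
    refine Finset.sum_congr rfl fun v hv => ?_
    rw [cosetSum]
    refine Finset.sum_congr ?_ fun _ _ => rfl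
    ext w
    simp only [Finset.mem_filter, Finset.mem_univ, true_and]
    constructor
    · rintro rfl
      exact ⟨hv, rfl⟩
    · exact fun h => h.2
  have h2 : ∀ (w : Equiv.Perm (Fin n)) r i,
      content ν.rowIndex (positions (lam.rowIndex ∘ (w⁻¹ : Equiv.Perm (Fin n))) r) i =
        (Finset.univ.filter fun k => lam.rowIndex k = r ∧ (ν.rowIndex ∘ w) k = i).card := by
    intro w r i
    rw [content]
    refine Finset.card_bij' (fun k _ => w⁻¹ k) (fun k _ => w k) ?_ ?_ ?_ ?_
    · intro k hk
      simpa [mem_positions] using hk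
    · intro k hk
      simpa [mem_positions] using hk
    · intro k _; simp
    · intro k _; simp
  rw [h1, mElt_eq_cosetSum]
  refine exists_sum_T_eq_mul_cosetSum q ν.rowIndex_monotone _ ?_
  intro w hw w' hww'
  simp only [Finset.mem_filter, Finset.mem_univ, true_and, mem_words] at hw ⊢
  intro r
  rw [← hw r]
  funext i
  rw [h2, h2, hww']

end RowWord

/-! ### The homomorphisms `theta` and relations between classes of words -/

section Theta

variable {lam : WeakComposition n a} {ν : WeakComposition n b}

/-- Left multiplication as a homomorphism of right modules. -/
def leftMul (h : HeckeAlgebra R q n) :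
    HeckeAlgebra R q n →ₗ[(HeckeAlgebra R q n)ᵐᵒᵖ] HeckeAlgebra R q n where
  toFun x := h * x
  map_add' := mul_add h
  map_smul' y x := (mul_assoc h x y.unop).symm

theorem permModule_hom_ext {P : Type*} [AddCommGroup P] [Module (HeckeAlgebra R q n)ᵐᵒᵖ P]
    {φ ψ : permModule q ν →ₗ[(HeckeAlgebra R q n)ᵐᵒᵖ] P}
    (h : φ (permGen q ν) = ψ (permGen q ν)) : φ = ψ := by
  ext ⟨x, hx⟩
  obtain ⟨y, rfl⟩ := Submodule.mem_span_singleton.1 hx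
  have : (⟨y • mElt q ν, hx⟩ : permModule q ν) = y • permGen q ν := rfl
  rw [this, map_smul, map_smul, h]

/-- If the element attached to `U` is $h\,m_\nu$, then left multiplication by $h$, followed by the
projection, is the required homomorphism. -/
theorem isTheta_theta (U : RowTableau lam ν) : IsTheta q U (theta q U) := by
  have hex : ∃ φ, IsTheta q U φ := by
    obtain ⟨h, hh⟩ := exists_thetaElt_eq_mul q U
    refine ⟨((higherIdeal q lam).mkQ.comp (leftMul q h)).restrict ?_, ?_⟩
    · intro x hx
      obtain ⟨y, rfl⟩ := Submodule.mem_span_singleton.1 hx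
      rw [map_smul]
      refine Submodule.smul_mem _ _ ?_
      have h1 := (spechtProj q lam (thetaElt q U)).2
      have h2 : ((spechtProj q lam (thetaElt q U)) : HeckeAlgebra R q n ⧸ higherIdeal q lam) =
          (higherIdeal q lam).mkQ (thetaElt q U : HeckeAlgebra R q n) := rfl
      rw [h2, hh] at h1
      exact h1
    · apply Subtype.ext
      change (higherIdeal q lam).mkQ (h * mElt q ν) =
        (higherIdeal q lam).mkQ (thetaElt q U : HeckeAlgebra R q n)
      rw [hh]
  rw [theta, dif_pos hex]
  exact hex.choose_spec

/-- The class of a coset sum modulo the ideal of higher terms. -/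
noncomputable def wordClass (lam : WeakComposition n a) (v : Fin n → Fin a) :
    HeckeAlgebra R q n ⧸ higherIdeal q lam :=
  (higherIdeal q lam).mkQ (cosetSum q lam.rowIndex v)

theorem coe_theta_permGen (U : RowTableau lam ν) :
    (theta q U (permGen q ν) : HeckeAlgebra R q n ⧸ higherIdeal q lam) =
      ∑ v ∈ words ν.rowIndex (fun r i => U.count i r), wordClass q lam v := by
  rw [isTheta_theta q U]
  change (higherIdeal q lam).mkQ (thetaElt q U : HeckeAlgebra R q n) = _
  rw [coe_thetaElt, map_sum]
  rfl

theorem sum_smul_wordClass (p p' : Fin a) (t : ℕ) (v : Fin n → Fin a)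
    (h : shiftSum q lam.rowIndex p p' t v ∈ higherIdeal q lam) :
    ∑ K ∈ (positions v p).powersetCard t,
      (q : R) ^ shiftStat p p' v K • wordClass q lam (overwrite p' v K) = 0 := by
  rw [← Submodule.ker_mkQ (higherIdeal q lam), LinearMap.mem_ker, shiftSum, map_sum] at h
  rw [← h]
  rfl

theorem shiftStat_eq_cross {p p' : Fin a} (h : p < p') (v : Fin n → Fin a) (K : Finset (Fin n)) :
    shiftStat p p' v K = cross (positions v p') K := by
  rw [shiftStat, cross, ← Finset.sum_product', ← Finset.sum_filter, ← Finset.card_eq_sum_ones]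
  congr 1
  ext ⟨l, k⟩
  simp only [Finset.mem_filter, Finset.mem_univ, true_and, Finset.mem_product, mem_positions, h,
    iff_true]
  tauto

theorem shiftStat_eq_cross' {p p' : Fin a} (h : p' < p) {v : Fin n → Fin a} {K : Finset (Fin n)}
    (hK : K ⊆ positions v p) : shiftStat p p' v K = cross K (positions v p') := by
  rw [shiftStat, cross, Finset.sum_comm, ← Finset.sum_product', ← Finset.sum_filter,
    ← Finset.card_eq_sum_ones]
  congr 1
  ext ⟨l, k⟩
  simp only [Finset.mem_filter, Finset.mem_univ, true_and, Finset.mem_product, mem_positions,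
    h.not_gt, iff_false, not_lt]
  constructor
  · rintro ⟨hk, hl, hkl⟩
    refine ⟨⟨hl, hk⟩, lt_of_le_of_ne hkl ?_⟩
    rintro rfl
    exact h.ne (hl.symm.trans (mem_positions.1 (hK hk)))
  · rintro ⟨⟨hl, hk⟩, hkl⟩
    exact ⟨hk, hl, hkl.le⟩

end Theta

end HeckeAlgebra

/-! ### The main theorem -/

namespace HeckeAlgebra

variable {R : Type*} [CommRing R] (q : Rˣ) {n a b : ℕ} {lam : WeakComposition n a}
  {ν : WeakComposition n b}

theorem shiftVanishing_wordClass {r r' : Fin a} (hr : (r' : ℕ) = r + 1) :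
    ShiftVanishing (q : R) r r' (wordClass q lam) := by
  have hlt : r < r' := by rw [Fin.lt_def]; omega
  have hcov : r ⋖ r' := ⟨hlt, fun c h h' => by rw [Fin.lt_def] at h h'; omega⟩
  intro v t ht
  rw [← sum_smul_wordClass q r r' t v
    (shiftSum_mem_higherIdeal q 1 (fun _ => rfl) hlt (Or.inl hcov) ht v)]
  exact Finset.sum_congr rfl fun K _ => by rw [shiftStat_eq_cross hlt]

/-- Rows of equal length may be interchanged by `τ` in `shiftSum_mem_higherIdeal`. This permits
changing letters of the lower row into the upper one, with crossings of the opposite orientation. -/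
theorem shiftVanishing_wordClass' {r r' : Fin a} (hr : (r' : ℕ) = r + 1)
    (h : lam.part r = lam.part r') (v : Fin n → Fin a) (t : ℕ) (ht : 0 < t) :
    ∑ K ∈ (positions v r').powersetCard t,
      (q : R) ^ cross K (positions v r) • wordClass q lam (overwrite r v K) = 0 := by
  have hlt : r < r' := by rw [Fin.lt_def]; omega
  have hcov : r ⋖ r' := ⟨hlt, fun c h h' => by rw [Fin.lt_def] at h h'; omega⟩
  have hmem := shiftSum_mem_higherIdeal q (lam := lam) (Equiv.swap r r') (fun i => by
    rw [Equiv.swap_apply_def]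
    split_ifs with h1 h2
    · rw [h1, h]
    · rw [h2, h]
    · rfl) hlt (by simpa using Or.inr hcov) ht v
  rw [Equiv.swap_apply_left, Equiv.swap_apply_right] at hmem
  rw [← sum_smul_wordClass q r' r t v hmem]
  exact Finset.sum_congr rfl fun K hK => by
    rw [shiftStat_eq_cross' hlt (Finset.mem_powersetCard.1 hK).1]

theorem coe_theta_move (S : RowTableau lam ν) {d : Fin b} {r₁ r₂ : Fin a} (hr : r₁ ≠ r₂)
    (g : S.moves d r₁ r₂) :
    (theta q (S.move hr g) (permGen q ν) : HeckeAlgebra R q n ⧸ higherIdeal q lam) =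
      ∑ v ∈ words ν.rowIndex (exchangeCount (fun r i => S.count i r) d r₁ r₂ g.1),
        wordClass q lam v := by
  rw [coe_theta_permGen]
  congr 2
  funext r i
  exact RowTableau.count_ofCounts _ _ _ i r

/-- Homomorphisms on $M^\nu$ are compared at $m_\nu$. The scalar `u` redistributes a power of $q$
between the prefactor and the summands. -/
theorem theta_eq_of_straighten (S : RowTableau lam ν) {d : Fin b} {r₁ r₂ : Fin a} (hr : r₁ ≠ r₂)
    {A c : R} {f k : (Fin b → ℕ) → R} (u : R)
    (h : A • ∑ v ∈ words ν.rowIndex (fun r i => S.count i r), wordClass q lam v =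
      ∑ g ∈ S.moves d r₁ r₂, f g •
        ∑ v ∈ words ν.rowIndex (exchangeCount (fun r i => S.count i r) d r₁ r₂ g),
          wordClass q lam v)
    (hc : c * u * A = 1) (hf : ∀ g ∈ S.moves d r₁ r₂, k g = u * f g) :
    theta q S = c • ∑ g : S.moves d r₁ r₂, k g.1 • theta q (S.move hr g) := by
  apply permModule_hom_ext
  apply Subtype.ext
  rw [LinearMap.smul_apply, LinearMap.sum_apply]
  rw [Submodule.coe_smul_of_tower, AddSubmonoidClass.coe_finsetSum, coe_theta_permGen]
  simp only [LinearMap.smul_apply, Submodule.coe_smul_of_tower, coe_theta_move]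
  rw [Finset.sum_coe_sort (S.moves d r₁ r₂) fun g => k g •
    ∑ v ∈ words ν.rowIndex (exchangeCount (fun r i => S.count i r) d r₁ r₂ g), wordClass q lam v,
    Finset.sum_congr (s₁ := S.moves d r₁ r₂) rfl fun g hg => by rw [hf g hg, mul_smul],
    ← Finset.smul_sum, ← h, smul_smul, smul_smul, hc, one_smul]

theorem sum_Iio_eq {b : ℕ} (d : Fin b) (f : Fin b → ℕ) :
    ∑ i ∈ Finset.Iio d, f i = ∑ i with i < d, f i :=
  Finset.sum_congr (by ext; simp) fun _ _ => rfl

theorem sum_Ioi_eq {b : ℕ} (d : Fin b) (f : Fin b → ℕ) :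
    ∑ i ∈ Finset.Ioi d, f i = ∑ i with d < i, f i :=
  Finset.sum_congr (by ext; simp) fun _ _ => rfl

end HeckeAlgebra

theorem mainTheorem2 {R : Type*} [CommRing R] (q : Rˣ) {n a b : ℕ}
    (lam : WeakComposition n a) (hlam : lam.IsPartition) (ν : WeakComposition n b) :
    -- the maps `Θ_U` are well defined
    (∀ U : RowTableau lam ν, HeckeAlgebra.IsTheta q U (HeckeAlgebra.theta q U)) ∧
    ∀ (S : RowTableau lam ν) (r r' : Fin a) (hr : (r' : ℕ) = r + 1) (d : Fin b),
      -- part (1): rows `r` and `r' = r + 1`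
      (HeckeAlgebra.theta q S =
        ((-1 : R) ^ S.count d r' *
          ((q ^ (-((S.count d r' + 1).choose 2 : ℤ)) : Rˣ) : R) *
          ((q ^ (-((S.count d r' : ℤ) * S.countLT d r')) : Rˣ) : R)) •
        ∑ g : S.moves d r r',
          ((q : R) ^ (∑ i ∈ Finset.Iio d, g.1 i) *
            ∏ i, ((q : R) ^ (g.1 i * S.countLT i r') *
              qBinomial (q : R) (S.count i r' + g.1 i) (g.1 i))) •
          HeckeAlgebra.theta q (S.move (RowTableau.ne_of_adjacent hr) g)) ∧
      -- part (2)
      (lam.part r = lam.part r' →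
        HeckeAlgebra.theta q S =
        ((-1 : R) ^ S.count d r *
          ((q ^ (-((S.count d r).choose 2 : ℤ)) : Rˣ) : R) *
          ((q ^ (-((S.count d r : ℤ) * S.countGT d r)) : Rˣ) : R)) •
        ∑ g : S.moves d r' r,
          (((q ^ (-((∑ i ∈ Finset.Iio d, g.1 i : ℕ) : ℤ)) : Rˣ) : R) *
            ∏ i, ((q : R) ^ (g.1 i * S.countGT i r) *
              qBinomial (q : R) (S.count i r + g.1 i) (g.1 i))) •
          HeckeAlgebra.theta q (S.move (RowTableau.ne_of_adjacent hr).symm g)) := by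
  have hsign : ∀ s : ℕ, (-1 : R) ^ s * (-1) ^ s = 1 := fun s => by
    rw [← mul_pow, neg_one_mul, neg_neg, one_pow]
  refine ⟨fun U => HeckeAlgebra.isTheta_theta q U, fun S r r' hr d => ⟨?_, fun hpart => ?_⟩⟩
  · have hne := RowTableau.ne_of_adjacent hr
    have h := (HeckeAlgebra.shiftVanishing_wordClass q (lam := lam) hr).straighten hne
      ν.rowIndex_monotone (fun r i => S.count i r) d (S.moves d r r') (fun g => S.mem_moves)
    -- Straightening yields $q^{-\sum_{i>d}g_i}$. Multiplication by $u=q^s$ with $s=\sum_i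
    -- g_i=S^d_{r+1}$ turns it into $q^{g_1+\dots+g_{d-1}}$ and accounts for $\binom{s+1}{2}=\binom
    -- s2+s$ in the prefactor.
    refine HeckeAlgebra.theta_eq_of_straighten q S hne
      (k := fun g => (q : R) ^ (∑ i ∈ Finset.Iio d, g i) *
            ∏ i, ((q : R) ^ (g i * S.countLT i r') *
              qBinomial (q : R) (S.count i r' + g i) (g i)))
      ((q ^ S.count d r' : Rˣ) : R) h ?_ ?_
    · have hu : q ^ (-((S.count d r' + 1).choose 2 : ℤ)) *
          q ^ (-((S.count d r' : ℤ) * S.countLT d r')) * q ^ S.count d r' *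
          (q ^ (S.count d r').choose 2 * q ^ (S.count d r' * S.countLT d r')) = 1 := by
        simp only [← zpow_natCast, ← zpow_add]
        rw [← zpow_zero q]
        congr 1
        have : (S.count d r' + 1).choose 2 = S.count d r' + (S.count d r').choose 2 := by
          rw [Nat.choose_succ_succ' _ 1, Nat.choose_one_right]
        rw [this]
        push_cast
        ring
      have hu' := congrArg (Units.val) hu
      simp only [Units.val_mul, Units.val_one, Units.val_pow_eq_pow_val] at hu' ⊢
      rw [← HeckeAlgebra.sum_Iio_eq]
      change _ * _ * _ * _ * (_ * _ * (q : R) ^ (S.count d r' * S.countLT d r')) = 1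
      linear_combination ((-1 : R) ^ S.count d r' * (-1) ^ S.count d r') * hu' + hsign (S.count d r')
    · intro g hg
      obtain ⟨h0, hs, -⟩ := S.mem_moves.1 hg
      have hsplit : S.count d r' = ∑ i ∈ Finset.Iio d, g i + ∑ i with d < i, g i := by
        rw [← hs, HeckeAlgebra.sum_Iio_eq, Finset.sum_filter, Finset.sum_filter, ← Finset.sum_add_distrib]
        refine Finset.sum_congr rfl fun i _ => ?_
        rcases lt_trichotomy i d with h | h | h
        · simp [h, h.not_gt]
        · simp [h, h0]
        · simp [h, h.not_gt]
      simp only [RowTableau.countLT, HeckeAlgebra.sum_Iio_eq] at hsplit ⊢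
      rw [← mul_assoc, ← Units.val_mul, hsplit, pow_add, mul_assoc (q ^ _), zpow_neg, zpow_natCast,
        mul_inv_cancel, mul_one, Units.val_pow_eq_pow_val]
  · have hne := (RowTableau.ne_of_adjacent hr).symm
    have h := HeckeAlgebra.straighten_dual (HeckeAlgebra.shiftVanishing_wordClass' q (lam := lam) hr hpart) hne
      ν.rowIndex_monotone (fun r i => S.count i r) d (S.moves d r' r) (fun g => S.mem_moves)
    -- The dual straightening already has the factor $q^{-(g_1+\dots+g_{d-1})}$, so no power of $q$
    -- has to be moved.
    refine HeckeAlgebra.theta_eq_of_straighten q S hne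
      (k := fun g => ((q ^ (-((∑ i ∈ Finset.Iio d, g i : ℕ) : ℤ)) : Rˣ) : R) *
            ∏ i, ((q : R) ^ (g i * S.countGT i r) *
              qBinomial (q : R) (S.count i r + g i) (g i)))
      1 h ?_ ?_
    · have hu : q ^ (-((S.count d r).choose 2 : ℤ)) *
          q ^ (-((S.count d r : ℤ) * S.countGT d r)) *
          (q ^ (S.count d r).choose 2 * q ^ (S.count d r * S.countGT d r)) = 1 := by
        simp only [← zpow_natCast, ← zpow_add]
        rw [← zpow_zero q]
        congr 1
        push_cast
        ring
      have hu' := congrArg (Units.val) hu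
      simp only [Units.val_mul, Units.val_one, Units.val_pow_eq_pow_val] at hu' ⊢
      rw [← HeckeAlgebra.sum_Ioi_eq]
      change _ * _ * _ * _ * (_ * _ * (q : R) ^ (S.count d r * S.countGT d r)) = 1
      linear_combination ((-1 : R) ^ S.count d r * (-1) ^ S.count d r) * hu' + hsign (S.count d r)
    · intro g _
      simp only [RowTableau.countGT, HeckeAlgebra.sum_Iio_eq, HeckeAlgebra.sum_Ioi_eq, one_mul]
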